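/- Let $\alpha\in(0,1)$ and identify $\mathbb R^2$ with $\mathbb C$. For a regular curve $U:\mathbb R\to\mathbb C$ of class $C^2$ let $\mathcal K(U)=\dfrac{i\dot U\cdot\ddot U}{|\dot U|^3}$ be its signed curvature. By an $H$-loop of class $C^{2,\alpha}$ we mean a periodic $U\in C^{2,\alpha}(\mathbb R;\mathbb C)$ with $\dot U\neq0$ everywhere and $\mathcal K(U)(t)=H(U(t))$ for all $t$ (a closed immersed curve whose curvature coincides with $H$ at every point). Let $H\in C^2(\mathbb R^2;\mathbb R)$ be radial, $H(p)=h(|p|)$, with $$h(s)=1+\frac{A}{s^{\gamma}}+\frac{\tilde h(s)}{s^{\gamma+\beta}}\quad\text{for all large }s,$$ where $A\in\mathbb R\setminus\{0\}$, $\gamma>1$, $\beta\ge0$, and $\tilde h\in C^2((0,+\infty);\mathbb R)$. Suppose that, as $s\to+\infty$, * if $\beta>1$: $\tilde h$ is bounded; * if $\beta\in(0,1]$: $\tilde h(s)=B+o(s^{\beta-1})$ for some $B\in\mathbb R$; * if $\beta=0$: $\tilde h(s)=B+o(s^{-1})$ for some $B\neq -A$; and that there is $C>0$ with $|h''(s)|\le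 C\,s^{-(\gamma+1+\min\{1,\beta\})}$ for all large $s$. Then: (i) There are infinitely many closed immersed curves of class $C^{2,\alpha}$ whose curvature coincides with $H$ at every point; more precisely, there is a sequence $(U_k)_{k\in\mathbb N}$ of $H$-loops of class $C^{2,\alpha}$ such that for $j\ne k$ no isometry of the plane maps the image of $U_j$ onto the image of $U_k$. (ii) Suppose $A>0$, and $B>-A$ in case $\beta=0$. For $n\in\mathbb N$ and $R>0$ put $U_{n,R}(t)=Re^{it/n}+e^{it}$ and $\mathbf N_{n,R}=i\dot U_{n,R}/|\dot U_{n,R}|$. There exist $\overline n\ge2$, $\overline M>0$, $0<r_0<r_1$, and sequences $(r_n)$, $(R_n)$ of real numbers and $(\phi_n)$ of functions such that for every $n\ge\overline n$: $$r_n\in(r_0,r_1),\qquad R_n=(r_nn)^{\frac1{\gamma+2}},$$ $\phi_n:\mathbb R\to\mathbb R$ is of class $C^{2,\alpha}$ and $2\pi\frac{n}{n-1}$-periodic with $$\|\phi_n\|_{C^{2,\alpha}}=\sup|\phi_n|+\sup|\phi_n'|+\sup|\phi_n''|+[\phi_n'']_{\alpha}\le\overline M\,n^{-\frac{\gamma}{\gamma+2}},$$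 $\dot U_{n,R_n}\neq0$ everywhere, and $U_{n,R_n}+\phi_n\mathbf N_{n,R_n}$ is an $H$-loop of class $C^{2,\alpha}$. (iii) Suppose $A<0$, and $B<-A$ in case $\beta=0$. Then the conclusion of (ii) holds with $U_{n,R}$ replaced by $V_{n,R}(t)=Re^{-it/n}+e^{it}$, with $\mathbf N_{n,R}=i\dot V_{n,R}/|\dot V_{n,R}|$, and with $\phi_n$ being $2\pi\frac{n}{n+1}$-periodic. -/

import Mathlib

open Real Set Filter Topology Asymptotics
open scoped NNReal ENNReal

noncomputable section

/-- Signed curvature `(i U' · U'') / |U'|^3` of a regular parametrized plane curve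
(the plane is identified with `ℂ`, and `·` is the Euclidean scalar product). -/
def signedCurvature (U : ℝ → ℂ) (t : ℝ) : ℝ :=
  inner ℝ (Complex.I * deriv U t) (iteratedDeriv 2 U t) / ‖deriv U t‖ ^ 3

/-- `f` is of class `C^{2,α}`: twice continuously differentiable with globally
`α`-Hölder second derivative. -/
def IsC2Holder {E : Type*} [NormedAddCommGroup E] [NormedSpace ℝ E]
    (α : ℝ≥0) (f : ℝ → E) : Prop :=
  ContDiff ℝ 2 f ∧ MemHolder α (iteratedDeriv 2 f)

/-- The `C^{2,α}` norm (with values in `[0, ∞]`): the sup norms of `f`, `f'`, `f''` plus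
the `α`-Hölder seminorm of `f''`. -/
def c2HolderNorm {E : Type*} [NormedAddCommGroup E] [NormedSpace ℝ E]
    (α : ℝ≥0) (f : ℝ → E) : ℝ≥0∞ :=
  (⨆ t : ℝ, ‖f t‖ₑ) + (⨆ t : ℝ, ‖deriv f t‖ₑ) + (⨆ t : ℝ, ‖iteratedDeriv 2 f t‖ₑ)
    + eHolderNorm α (iteratedDeriv 2 f)

/-- `U` parametrizes a closed immersed plane curve of class `C^{2,α}` whose curvature
at every point is prescribed by `H`. -/
structure IsCurvatureLoop (H : ℂ → ℝ) (α : ℝ≥0) (U : ℝ → ℂ) : Prop where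
  smooth : IsC2Holder α U
  immersed : ∀ t, deriv U t ≠ 0
  closed : ∃ T : ℝ, 0 < T ∧ Function.Periodic U T
  curvature : ∀ t, signedCurvature U t = H (U t)

/-- The curve `t ↦ R e^{iσt/n} + e^{it}`, used with `σ = 1` and `σ = -1`. -/
def baseCurve (σ : ℝ) (n : ℕ) (R : ℝ) (t : ℝ) : ℂ :=
  (R : ℂ) * Complex.exp (Complex.I * ((σ * t / n : ℝ) : ℂ))
    + Complex.exp (Complex.I * (t : ℂ))

/-- The unit normal `i U' / |U'|` of a regular curve. -/
def unitNormal (U : ℝ → ℂ) (t : ℝ) : ℂ :=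
  Complex.I * deriv U t / (‖deriv U t‖ : ℂ)

/-- The normal graph `U + φ N` over a regular curve `U`. -/
def normalGraph (U : ℝ → ℂ) (φ : ℝ → ℝ) (t : ℝ) : ℂ :=
  U t + (φ t : ℂ) * unitNormal U t

/-- For all large `n` there is a loop of curvature `H` which is a normal graph over the curve
`R_n e^{iσt/n} + e^{it}`, where `R_n = (r_n n)^{1/(γ+2)}` with `r_n` in a fixed interval
`(r₀, r₁)`, the graph function being `2πn/(n-σ)`-periodic with `C^{2,α}` norm at most
`M n^{-γ/(γ+2)}`. -/
def HasPerturbedLoops (H : ℂ → ℝ) (γ : ℝ) (α : ℝ≥0) (σ : ℝ) : Prop :=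
  ∃ (N : ℕ) (M r₀ r₁ : ℝ) (r R : ℕ → ℝ) (φ : ℕ → ℝ → ℝ),
    2 ≤ N ∧ 0 < M ∧ 0 < r₀ ∧ r₀ < r₁ ∧
    ∀ n : ℕ, N ≤ n →
      r n ∈ Ioo r₀ r₁ ∧
      R n = (r n * n) ^ (1 / (γ + 2)) ∧
      IsC2Holder α (φ n) ∧
      Function.Periodic (φ n) (2 * π * (n / (n - σ))) ∧
      c2HolderNorm α (φ n) ≤ ENNReal.ofReal (M * (n : ℝ) ^ (-(γ / (γ + 2)))) ∧
      (∀ t, deriv (baseCurve σ n (R n)) t ≠ 0) ∧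
      IsCurvatureLoop H α (normalGraph (baseCurve σ n (R n)) (φ n))

end

/-! The curve is parametrized by its tangent angle minus `π / 2`. Where `H > 0`, write `1 / H = 1 +
g`; then curvature `H` means `U' = i e^{it} (1 + g(|U|))`. Splitting `U = c + e^{it}` leaves an
equation for the slowly moving guiding centre, `c' = i e^{it} g(|c + e^{it}|)`, as for a charged
particle in a magnetic field.

This equation commutes with rotations combined with time shifts and with time-reversing reflections.
A solution with `c 0 = R` real that meets the axis of angle `w / 2` at time `π + w / 2` therefore
satisfies `c (t + 2π + w) = e^{iw} c t` (`guidingCentre_equivariant`). With `w = 2πσ/(n - σ)`, the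
curve closes after `n - σ` such steps. Radial symmetry thus reduces closing to one real equation in
`R`.

In one turn the centre drifts transversally: `|c + e^{it}| ≈ R + cos t` and `g' ≈ a R^{-(γ+1)}`, so
half a turn gives about `a (π/2) R^{-(γ+1)}`, to be matched with `R sin (w/2) ≈ πσR/n`. For `R^{γ+2}
= r n` both terms have the same order, and the rescaled defect tends to `a π/2 - r π σ`
(`tendsto_shooting`). It changes sign at `r = aσ/2`, and the intermediate value theorem gives a
closing radius (`exists_closing`). Here `a = γ A'`, where `A'` is the effective leading coefficient
of `h - 1`, so the sign of `A'` selects `σ`.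

The orbit lies within `O(R^{-γ})` of the epicycle `R e^{iσt/n} + e^{it}`. Foot points, produced by
monotonicity and the implicit function theorem, reparametrize it as a normal graph
(`exists_footPoint`). A bootstrap through the differential equations bounds three derivatives of the
graph function by `R^{-γ}`, hence its `C^{2,α}` norm (`UBdd.footPoint_bootstrap`); and `R^{-γ}` is
comparable with `n^{-γ/(γ+2)}`. Since the diameters tend to infinity, a subsequence of the loops is
pairwise non-congruent.

The function `h̃` is never differentiated: the drift only needs increments of `h` over bounded steps
(`DriftAsymp`), and the bound on `h''` controls `h'` by interpolation. -/

/-! ### Families of functions with uniformly bounded derivatives -/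

section UniformBounds

variable {ι E F : Type*} {l : Filter ι} [NormedAddCommGroup E] [NormedSpace ℝ E]
  [NormedAddCommGroup F] [NormedSpace ℝ F] {A : Type*} [NormedRing A] [NormedAlgebra ℝ A]

/-- Along the filter `l`, the members of the family `f` are `k` times differentiable and their
derivatives up to order `k` are bounded by a fixed multiple of `ε`. -/
def UBdd (l : Filter ι) {E : Type*} [NormedAddCommGroup E] [NormedSpace ℝ E] :
    ℕ → (ι → ℝ) → (ι → ℝ → E) → Prop
  | 0, ε, f => ∃ M : ℝ, ∀ᶠ i in l, ∀ t, ‖f i t‖ ≤ M * ε i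
  | k + 1, ε, f => (∃ M : ℝ, ∀ᶠ i in l, ∀ t, ‖f i t‖ ≤ M * ε i) ∧
      (∀ᶠ i in l, Differentiable ℝ (f i)) ∧ UBdd l k ε (fun i => deriv (f i))

namespace UBdd

variable {k : ℕ} {ε δ : ι → ℝ} {f g : ι → ℝ → E}

theorem zero_level (hf : UBdd l k ε f) : UBdd l 0 ε f := by
  cases k with
  | zero => exact hf
  | succ k => exact hf.1

theorem congr (hf : UBdd l k ε f) (h : ∀ᶠ i in l, ∀ t, f i t = g i t) : UBdd l k ε g := by
  induction k generalizing f g with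
  | zero =>
    obtain ⟨M, hM⟩ := hf
    exact ⟨M, by filter_upwards [hM, h] with i h1 h2 t using h2 t ▸ h1 t⟩
  | succ k ih =>
    obtain ⟨⟨M, hM⟩, hd, h'⟩ := hf
    refine ⟨⟨M, by filter_upwards [hM, h] with i h1 h2 t using h2 t ▸ h1 t⟩, ?_, ih h' ?_⟩
    · filter_upwards [hd, h] with i h1 h2 using (funext h2 : f i = g i) ▸ h1
    · filter_upwards [h] with i h2 t using by rw [(funext h2 : f i = g i)]

theorem of_hasDerivAt {f' : ι → ℝ → E} (h0 : UBdd l 0 ε f)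
    (hd : ∀ᶠ i in l, ∀ t, HasDerivAt (f i) (f' i t) t) (h' : UBdd l k ε f') :
    UBdd l (k + 1) ε f := by
  refine ⟨h0, ?_, h'.congr ?_⟩
  · filter_upwards [hd] with i hi t using (hi t).differentiableAt
  · filter_upwards [hd] with i hi t using (hi t).deriv.symm

theorem hasDerivAt (hf : UBdd l (k + 1) ε f) :
    ∀ᶠ i in l, ∀ t, HasDerivAt (f i) (deriv (f i) t) t := by
  filter_upwards [hf.2.1] with i hi t using (hi t).hasDerivAt

theorem pred (hf : UBdd l (k + 1) ε f) : UBdd l k ε f := by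
  induction k generalizing f with
  | zero => exact hf.1
  | succ k ih => exact ⟨hf.1, hf.2.1, ih hf.2.2⟩

theorem of_le {m : ℕ} (hf : UBdd l k ε f) (h : m ≤ k) : UBdd l m ε f := by
  induction h with
  | refl => exact hf
  | step _ ih => exact ih hf.pred

theorem mono (hf : UBdd l k ε f) (h : ∀ᶠ i in l, 0 ≤ ε i ∧ ε i ≤ δ i) : UBdd l k δ f := by
  have base : ∀ {f : ι → ℝ → E}, (∃ M : ℝ, ∀ᶠ i in l, ∀ t, ‖f i t‖ ≤ M * ε i) →
      ∃ M : ℝ, ∀ᶠ i in l, ∀ t, ‖f i t‖ ≤ M * δ i := by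
    rintro f ⟨M, hM⟩
    refine ⟨|M|, ?_⟩
    filter_upwards [hM, h] with i h1 h2 t
    calc ‖f i t‖ ≤ M * ε i := h1 t
      _ ≤ |M| * ε i := by gcongr; exacts [h2.1, le_abs_self M]
      _ ≤ |M| * δ i := by gcongr; exact h2.2
  induction k generalizing f with
  | zero => exact base hf
  | succ k ih => exact ⟨base hf.1, hf.2.1, ih hf.2.2⟩

theorem add (hf : UBdd l k ε f) (hg : UBdd l k ε g) : UBdd l k ε (fun i t => f i t + g i t) := by
  have base : ∀ {f g : ι → ℝ → E}, UBdd l 0 ε f → UBdd l 0 ε g →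
      UBdd l 0 ε (fun i t => f i t + g i t) := by
    rintro f g ⟨M, hM⟩ ⟨M', hM'⟩
    refine ⟨M + M', ?_⟩
    filter_upwards [hM, hM'] with i h1 h2 t
    exact (norm_add_le _ _).trans (by linarith [h1 t, h2 t])
  induction k generalizing f g with
  | zero => exact base hf hg
  | succ k ih =>
    refine of_hasDerivAt (base hf.1 hg.1) ?_ (ih hf.2.2 hg.2.2)
    filter_upwards [hf.hasDerivAt, hg.hasDerivAt] with i h1 h2 t using (h1 t).add (h2 t)

theorem clm (L : E →L[ℝ] F) (hf : UBdd l k ε f) : UBdd l k ε (fun i t => L (f i t)) := by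
  have base : ∀ {f : ι → ℝ → E}, UBdd l 0 ε f → UBdd l 0 ε (fun i t => L (f i t)) := by
    rintro f ⟨M, hM⟩
    refine ⟨‖L‖ * M, ?_⟩
    filter_upwards [hM] with i h1 t
    calc ‖L (f i t)‖ ≤ ‖L‖ * ‖f i t‖ := L.le_opNorm _
      _ ≤ ‖L‖ * M * ε i := by rw [mul_assoc]; gcongr; exact h1 t
  induction k generalizing f with
  | zero => exact base hf
  | succ k ih =>
    refine of_hasDerivAt (base hf.1) ?_ (ih hf.2.2)
    filter_upwards [hf.hasDerivAt] with i h1 t using L.hasFDerivAt.comp_hasDerivAt t (h1 t)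

theorem neg (hf : UBdd l k ε f) : UBdd l k ε (fun i t => -f i t) :=
  (hf.clm (-ContinuousLinearMap.id ℝ E)).congr (by simp)

theorem sub (hf : UBdd l k ε f) (hg : UBdd l k ε g) : UBdd l k ε (fun i t => f i t - g i t) := by
  simpa only [sub_eq_add_neg] using hf.add hg.neg

theorem bilin {G : Type*} [NormedAddCommGroup G] [NormedSpace ℝ G] (B : E →L[ℝ] F →L[ℝ] G)
    {g : ι → ℝ → F} (hf : UBdd l k ε f) (hg : UBdd l k δ g) :
    UBdd l k (fun i => ε i * δ i) (fun i t => B (f i t) (g i t)) := by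
  have base : ∀ {f : ι → ℝ → E} {g : ι → ℝ → F}, UBdd l 0 ε f → UBdd l 0 δ g →
      UBdd l 0 (fun i => ε i * δ i) (fun i t => B (f i t) (g i t)) := by
    rintro f g ⟨M, hM⟩ ⟨M', hM'⟩
    refine ⟨‖B‖ * (M * M'), ?_⟩
    filter_upwards [hM, hM'] with i h1 h2 t
    calc ‖B (f i t) (g i t)‖ ≤ ‖B‖ * ‖f i t‖ * ‖g i t‖ := B.le_opNorm₂ _ _
      _ = ‖B‖ * (‖f i t‖ * ‖g i t‖) := by ring
      _ ≤ ‖B‖ * ((M * ε i) * (M' * δ i)) := by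
        gcongr ?_ * ?_
        exact mul_le_mul (h1 t) (h2 t) (norm_nonneg _) ((norm_nonneg _).trans (h1 t))
      _ = ‖B‖ * (M * M') * (ε i * δ i) := by ring
  induction k generalizing f g with
  | zero => exact base hf hg
  | succ k ih =>
    refine of_hasDerivAt (base hf.1 hg.1) ?_ ((ih hf.pred hg.2.2).add (ih hf.2.2 hg.pred))
    filter_upwards [hf.hasDerivAt, hg.hasDerivAt] with i h1 h2 t
    exact B.hasDerivAt_of_bilinear (fun _ => h1 t) (fun _ => h2 t)

theorem mul {f g : ι → ℝ → A} (hf : UBdd l k ε f) (hg : UBdd l k δ g) :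
    UBdd l k (fun i => ε i * δ i) (fun i t => f i t * g i t) :=
  hf.bilin (ContinuousLinearMap.mul ℝ A) hg

theorem smul {u : ι → ℝ → ℝ} (hu : UBdd l k δ u) (hf : UBdd l k ε f) :
    UBdd l k (fun i => δ i * ε i) (fun i t => u i t • f i t) :=
  hu.bilin (ContinuousLinearMap.lsmul ℝ ℝ) hf

theorem one_smul {u : ι → ℝ → ℝ} (hu : UBdd l k 1 u) (hf : UBdd l k ε f) :
    UBdd l k ε (fun i t => u i t • f i t) := by
  simpa using hu.smul hf

theorem inner_one {f g : ι → ℝ → ℂ} (hf : UBdd l k ε f) (hg : UBdd l k 1 g) :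
    UBdd l k ε (fun i t => inner ℝ (f i t) (g i t)) := by
  simpa only [Pi.one_apply, _root_.mul_one] using! hf.bilin (innerSL ℝ) hg

theorem mul_one {f g : ι → ℝ → A} (hf : UBdd l k ε f) (hg : UBdd l k 1 g) :
    UBdd l k ε (fun i t => f i t * g i t) := by
  simpa using hf.mul hg

theorem one_mul {f g : ι → ℝ → A} (hf : UBdd l k 1 f) (hg : UBdd l k ε g) :
    UBdd l k ε (fun i t => f i t * g i t) := by
  simpa using hf.mul hg

theorem const_fun {a : ι → E} {M : ℝ} (h : ∀ᶠ i in l, ‖a i‖ ≤ M * ε i) :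
    UBdd l k ε (fun i _ => a i) := by
  have key : ∀ (k : ℕ) (a : ι → E), (∃ M : ℝ, ∀ᶠ i in l, ‖a i‖ ≤ M * ε i) →
      UBdd l k ε (fun i _ => a i) := by
    intro k
    induction k with
    | zero => rintro a ⟨M, h⟩; exact ⟨M, by filter_upwards [h] with i hi _ using hi⟩
    | succ k ih =>
      rintro a ⟨M, h⟩
      refine of_hasDerivAt ⟨M, by filter_upwards [h] with i hi _ using hi⟩
        (f' := fun _ _ => 0) (.of_forall fun i t => hasDerivAt_const _ _) (ih _ ⟨M, ?_⟩)
      filter_upwards [h] with i hi using by simpa using (norm_nonneg _).trans hi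
  exact key k a ⟨M, h⟩

theorem const (a : E) : UBdd l k 1 (fun _ _ => a) := const_fun (M := ‖a‖) (by simp)

theorem inv {f : ι → ℝ → ℝ} {d : ℝ} (hd : 0 < d) (hf : UBdd l k 1 f)
    (h : ∀ᶠ i in l, ∀ t, d ≤ f i t) : UBdd l k 1 (fun i t => (f i t)⁻¹) := by
  have base : UBdd l 0 1 (fun i t => (f i t)⁻¹) := by
    refine ⟨d⁻¹, ?_⟩
    filter_upwards [h] with i hi t
    have := hi t
    rw [norm_inv, norm_of_nonneg (by linarith)]
    simpa using inv_anti₀ hd this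
  induction k with
  | zero => exact base
  | succ k ih =>
    refine of_hasDerivAt base ?_ ((hf.2.2.neg.mul_one (ih hf.pred)).mul_one (ih hf.pred))
    filter_upwards [hf.hasDerivAt, h] with i h1 h2 t
    have : f i t ≠ 0 := by linarith [h2 t]
    exact ((h1 t).inv this).congr_deriv (by field_simp)

/-- Only the derivatives of the inner functions are controlled, because the maps `t ↦ t + u t` to be
inserted are themselves unbounded. The chain rule consumes one order, so `s'` is needed only to
orders below `k`. -/
theorem comp {s s' : ι → ℝ → ℝ} (hf : UBdd l k ε f)
    (hs : ∀ᶠ i in l, ∀ t, HasDerivAt (s i) (s' i t) t) (hs' : ∀ m < k, UBdd l m 1 s') :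
    UBdd l k ε (fun i t => f i (s i t)) := by
  have base : ∀ {f : ι → ℝ → E}, UBdd l 0 ε f → UBdd l 0 ε (fun i t => f i (s i t)) := by
    rintro f ⟨M, hM⟩
    exact ⟨M, by filter_upwards [hM] with i h1 t using h1 _⟩
  induction k generalizing f with
  | zero => exact base hf
  | succ k ih =>
    have h1 := ih hf.2.2 (fun m hm => hs' m (hm.trans k.lt_succ_self))
    have hsm : UBdd l k ε (fun i t => s' i t • deriv (f i) (s i t)) := (hs' k k.lt_succ_self).one_smul h1
    refine of_hasDerivAt (base hf.1) ?_ hsm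
    filter_upwards [hf.hasDerivAt, hs] with i h1 h2 t
    exact (h1 _).scomp t (h2 t)

/-- The derivative `i u' e^{iu}` is split as `i u' (e^{iu} - 1) + i u'`, which allows induction; `ε
≤ 1` absorbs the product of two small factors. -/
theorem exp_sub_one {u : ι → ℝ → ℝ} (hε : ∀ᶠ i in l, 0 ≤ ε i ∧ ε i ≤ 1) (hu : UBdd l k ε u) :
    UBdd l k ε (fun i t => Complex.exp (Complex.I * (u i t : ℂ)) - 1) := by
  have base : UBdd l 0 ε (fun i t => Complex.exp (Complex.I * (u i t : ℂ)) - 1) := by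
    obtain ⟨M, hM⟩ := hu.zero_level
    refine ⟨M, ?_⟩
    filter_upwards [hM] with i hi t
    exact (Real.norm_exp_I_mul_ofReal_sub_one_le).trans (hi t)
  induction k with
  | zero => exact base
  | succ k ih =>
    have h1 : UBdd l k ε (fun i t => Complex.I * ((deriv (u i) t : ℝ) : ℂ)) :=
      (UBdd.const Complex.I).one_mul (hu.2.2.clm Complex.ofRealCLM)
    refine of_hasDerivAt base ?_ ((h1.mul_one ((ih hu.pred).mono hε)).add h1)
    filter_upwards [hu.hasDerivAt] with i h2 t
    have := (((h2 t).ofReal_comp.const_mul Complex.I).cexp).sub_const 1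
    exact this.congr_deriv (by ring)

theorem exp_mul {a : ι → ℝ} {M : ℝ} (ha : ∀ᶠ i in l, |a i| ≤ M) :
    UBdd l k 1 (fun i t => Complex.exp (Complex.I * ((a i * t : ℝ) : ℂ))) := by
  have base : UBdd l 0 1 (fun i t => Complex.exp (Complex.I * ((a i * t : ℝ) : ℂ))) :=
    ⟨1, .of_forall fun i t => by
      simp only [mul_comm Complex.I, Complex.norm_exp_ofReal_mul_I]; simp⟩
  induction k with
  | zero => exact base
  | succ k ih =>
    have h1 : UBdd l k 1 (fun i _ => Complex.I * (a i : ℂ)) :=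
      const_fun (M := M) (by filter_upwards [ha] with i hi using by simpa using hi)
    refine of_hasDerivAt base (.of_forall fun i t => ?_) (h1.mul_one ih)
    have := (((hasDerivAt_id t).const_mul (a i)).ofReal_comp.const_mul Complex.I).cexp
    exact this.congr_deriv (by simp; ring)

end UBdd

/-- At distances at most one the Lipschitz bound dominates, since `α ≤ 1`; at larger distances the
sup bound suffices. -/
theorem holderWith_of_bdd_deriv {α M : ℝ≥0} (hα0 : 0 < α) (hα : α ≤ 1) {f : ℝ → E} (hf : Differentiable ℝ f)
    (h0 : ∀ t, ‖f t‖ ≤ M) (h1 : ∀ t, ‖deriv f t‖ ≤ M) : HolderWith (2 * M) α f := by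
  have hL : LipschitzWith M f := lipschitzWith_of_nnnorm_deriv_le hf fun t => h1 t
  refine fun x y => ?_
  rcases le_total (edist x y) 1 with hxy | hxy
  · calc edist (f x) (f y) ≤ M * edist x y := hL x y
      _ ≤ M * edist x y ^ (α : ℝ) := by
        gcongr
        simpa using ENNReal.rpow_le_rpow_of_exponent_ge hxy (show (α : ℝ) ≤ 1 from hα)
      _ ≤ (2 * M : ℝ≥0) * edist x y ^ (α : ℝ) := by
        gcongr
        exact le_mul_of_one_le_left zero_le one_le_two
  · have : edist (f x) (f y) ≤ (2 * M : ℝ≥0) := by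
      rw [edist_nndist, ENNReal.coe_le_coe, ← NNReal.coe_le_coe, coe_nndist, dist_eq_norm]
      push_cast
      linarith [norm_sub_le (f x) (f y), h0 x, h0 y]
    calc edist (f x) (f y) ≤ (2 * M : ℝ≥0) * 1 := by simpa using this
      _ ≤ _ := by
        gcongr
        exact ENNReal.one_le_rpow hxy (by positivity)

theorem isC2Holder_of_bdd {α M : ℝ≥0} (hα0 : 0 < α) (hα : α ≤ 1) {f : ℝ → E} (hf : Differentiable ℝ f)
    (hf1 : Differentiable ℝ (deriv f)) (hf2 : Differentiable ℝ (deriv (deriv f)))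
    (h2 : ∀ t, ‖deriv (deriv f) t‖ ≤ M) (h3 : ∀ t, ‖deriv (deriv (deriv f)) t‖ ≤ M) :
    IsC2Holder α f ∧ HolderWith (2 * M) α (iteratedDeriv 2 f) := by
  have e : iteratedDeriv 2 f = deriv (deriv f) := by
    rw [iteratedDeriv_succ, iteratedDeriv_one]
  have hH : HolderWith (2 * M) α (iteratedDeriv 2 f) := by
    rw [e]
    exact holderWith_of_bdd_deriv hα0 hα hf2 h2 h3
  refine ⟨⟨?_, hH.memHolder⟩, hH⟩
  rw [show (2 : WithTop ℕ∞) = 1 + 1 by norm_num, contDiff_succ_iff_deriv]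
  refine ⟨hf, by simp, ?_⟩
  rw [contDiff_one_iff_deriv]
  exact ⟨hf1, hf2.continuous⟩

theorem UBdd.exists_c2HolderNorm_le {α : ℝ≥0} (hα0 : 0 < α) (hα : α ≤ 1) {ε : ι → ℝ} {f : ι → ℝ → E}
    (hε : ∀ᶠ i in l, 0 ≤ ε i) (hf : UBdd l 3 ε f) :
    ∃ M : ℝ, 0 < M ∧ ∀ᶠ i in l, IsC2Holder α (f i) ∧
      c2HolderNorm α (f i) ≤ ENNReal.ofReal (M * ε i) := by
  obtain ⟨⟨M0, h0⟩, d0, ⟨M1, h1⟩, d1, ⟨M2, h2⟩, d2, M3, h3⟩ := hf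
  set M := |M0| + |M1| + |M2| + |M3| + 1
  -- Three sup norms contribute `M` each and the Hölder seminorm `2 * M`.
  refine ⟨5 * M, by positivity, ?_⟩
  filter_upwards [hε, h0, h1, h2, h3, d0, d1, d2] with i hε h0 h1 h2 h3 d0 d1 d2
  have hMε : 0 ≤ M * ε i := by positivity
  have key : ∀ {N x : ℝ}, |N| ≤ M → x ≤ N * ε i → x ≤ M * ε i := fun hN hx =>
    hx.trans (mul_le_mul_of_nonneg_right ((le_abs_self _).trans hN) hε)
  have k0 := fun t => key (by simp only [M]; linarith [abs_nonneg M1, abs_nonneg M2, abs_nonneg M3]) (h0 t)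
  have k1 := fun t => key (by simp only [M]; linarith [abs_nonneg M0, abs_nonneg M2, abs_nonneg M3]) (h1 t)
  have k2 := fun t => key (by simp only [M]; linarith [abs_nonneg M0, abs_nonneg M1, abs_nonneg M3]) (h2 t)
  have k3 := fun t => key (by simp only [M]; linarith [abs_nonneg M0, abs_nonneg M1, abs_nonneg M2]) (h3 t)
  obtain ⟨hC, hH⟩ := isC2Holder_of_bdd (M := ⟨M * ε i, hMε⟩) hα0 hα d0 d1 d2 k2 k3
  refine ⟨hC, ?_⟩
  have e : iteratedDeriv 2 (f i) = deriv (deriv (f i)) := by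
    rw [iteratedDeriv_succ, iteratedDeriv_one]
  have sup : ∀ {u : ℝ → E}, (∀ t, ‖u t‖ ≤ M * ε i) →
      ⨆ t, ‖u t‖ₑ ≤ ENNReal.ofReal (M * ε i) := fun hu => iSup_le fun t => by
    rw [← ofReal_norm]
    exact ENNReal.ofReal_le_ofReal (hu t)
  have hh : eHolderNorm α (iteratedDeriv 2 (f i)) ≤ ENNReal.ofReal (2 * (M * ε i)) := by
    refine hH.eHolderNorm_le.trans (le_of_eq ?_)
    rw [ENNReal.ofReal, ENNReal.coe_inj]
    ext
    rw [Real.coe_toNNReal _ (by positivity)]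
    rfl
  calc c2HolderNorm α (f i) ≤ ENNReal.ofReal (M * ε i) + ENNReal.ofReal (M * ε i)
        + ENNReal.ofReal (M * ε i) + ENNReal.ofReal (2 * (M * ε i)) := by
        unfold c2HolderNorm
        gcongr
        · exact sup k0
        · exact sup k1
        · rw [e]; exact sup k2
    _ = ENNReal.ofReal (5 * M * ε i) := by
      rw [← ENNReal.ofReal_add hMε hMε, ← ENNReal.ofReal_add (by positivity) hMε,
        ← ENNReal.ofReal_add (by positivity) (by positivity)]
      ring_nf

end UniformBounds

/-! ### Global solutions of ordinary differential equations -/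

section GlobalODE

variable {E : Type*} [NormedAddCommGroup E] [NormedSpace ℝ E]
  {v : ℝ → E → E} {K L : ℝ≥0}

/-- The global bound `L` confines solutions to the ball of radius `L * b`, so the Picard–Lindelöf
interval need not shrink. -/
theorem exists_solution_Ioo [CompleteSpace E] (hlip : ∀ t, LipschitzWith K (v t))
    (hcont : ∀ x, Continuous (v · x)) (hb : ∀ t x, ‖v t x‖ ≤ L) (x₀ : E) (b : ℝ) (hb0 : 0 ≤ b) :
    ∃ c : ℝ → E, c 0 = x₀ ∧ ∀ t ∈ Ioo (-b) b, HasDerivAt c (v t (c t)) t := by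
  have hpl : IsPicardLindelof v (tmin := -b) (tmax := b) ⟨0, by simpa using hb0, hb0⟩ x₀
      (L * ⟨b, hb0⟩) 0 L K :=
    ⟨fun t _ => (hlip t).lipschitzOnWith, fun x _ => (hcont x).continuousOn,
      fun t _ x _ => hb t x, by simp; rfl⟩
  obtain ⟨c, h0, hc⟩ := hpl.exists_eq_forall_mem_Icc_hasDerivWithinAt₀
  exact ⟨c, h0, fun t ht => (hc t (Ioo_subset_Icc_self ht)).hasDerivAt (Icc_mem_nhds ht.1 ht.2)⟩

theorem exists_global_solution [CompleteSpace E] (hlip : ∀ t, LipschitzWith K (v t))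
    (hcont : ∀ x, Continuous (v · x)) (hb : ∀ t x, ‖v t x‖ ≤ L) (x₀ : E) :
    ∃ c : ℝ → E, c 0 = x₀ ∧ ∀ t, HasDerivAt c (v t (c t)) t := by
  choose a ha0 ha using fun m : ℕ =>
    exists_solution_Ioo hlip hcont hb x₀ (m + 1 : ℝ) (by positivity)
  have agree : ∀ m m' : ℕ, m ≤ m' → ∀ t : ℝ, |t| < m + 1 → a m t = a m' t := by
    intro m m' hm t ht
    have hmm : (m : ℝ) ≤ m' := by exact_mod_cast hm
    have hsub : Ioo (-(m + 1 : ℝ)) (m + 1) ⊆ Ioo (-(m' + 1 : ℝ)) (m' + 1) :=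
      Ioo_subset_Ioo (by linarith) (by linarith)
    exact ODE_solution_unique_of_mem_Ioo (s := fun _ => univ) (t₀ := 0)
      (fun t _ => (hlip t).lipschitzOnWith)
      (by constructor <;> linarith [(Nat.cast_nonneg m : (0 : ℝ) ≤ m)])
      (fun t ht => ⟨ha m t ht, mem_univ _⟩) (fun t ht => ⟨ha m' t (hsub ht), mem_univ _⟩)
      (by rw [ha0, ha0]) (abs_lt.1 ht)
  -- The glued solution uses the index `⌈|t|⌉₊`; near any point it coincides with a single local
  -- solution, so it inherits the derivative.
  have eq_of : ∀ (m : ℕ) (t : ℝ), |t| < m + 1 → a ⌈|t|⌉₊ t = a m t := by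
    intro m t ht
    have h1 : |t| < (⌈|t|⌉₊ : ℝ) + 1 := (Nat.le_ceil _).trans_lt (lt_add_one _)
    rcases le_total ⌈|t|⌉₊ m with h | h
    · exact agree _ _ h t h1
    · exact (agree _ _ h t ht).symm
  refine ⟨fun t => a ⌈|t|⌉₊ t, by simp [ha0], fun t => ?_⟩
  have h1 : |t| < (⌈|t|⌉₊ : ℝ) + 1 := (Nat.le_ceil _).trans_lt (lt_add_one _)
  refine (ha ⌈|t|⌉₊ t (abs_lt.1 h1)).congr_of_eventuallyEq ?_
  filter_upwards [continuous_abs.continuousAt.eventually_lt continuousAt_const h1] with x hx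
  exact eq_of _ x hx

end GlobalODE

/-! ### The guiding centre equation -/

section GuidingCentre

/-- Right hand side of the equation of the centre of curvature type
`c' = i e^{it} g(|c + e^{it}|)`. -/
noncomputable def guidingField (g : ℝ → ℝ) (t : ℝ) (c : ℂ) : ℂ :=
  Complex.I * Complex.exp (Complex.I * (t : ℂ)) *
    (g ‖c + Complex.exp (Complex.I * (t : ℂ))‖ : ℂ)

variable {g : ℝ → ℝ} {K : ℝ≥0} {M : ℝ}

theorem norm_exp_I_mul (t : ℝ) : ‖Complex.exp (Complex.I * (t : ℂ))‖ = 1 := by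
  rw [mul_comm, Complex.norm_exp_ofReal_mul_I]

theorem norm_guidingField (t : ℝ) (c : ℂ) :
    ‖guidingField g t c‖ = |g ‖c + Complex.exp (Complex.I * (t : ℂ))‖| := by
  simp [guidingField]

theorem lipschitzWith_guidingField (hg : LipschitzWith K g) (t : ℝ) :
    LipschitzWith K (guidingField g t) := by
  refine LipschitzWith.of_dist_le_mul fun x y => ?_
  rw [dist_eq_norm, guidingField, guidingField, ← mul_sub, norm_mul, norm_mul, norm_exp_I_mul,
    Complex.norm_I, one_mul, one_mul, ← Complex.ofReal_sub, Complex.norm_real, ← dist_eq_norm]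
  refine (hg.dist_le_mul _ _).trans ?_
  gcongr
  rw [dist_eq_norm, dist_eq_norm]
  refine (abs_norm_sub_norm_le _ _).trans (le_of_eq ?_)
  congr 1
  ring

theorem continuous_guidingField (hg : Continuous g) (c : ℂ) :
    Continuous (guidingField g · c) := by
  unfold guidingField
  fun_prop

theorem exists_guidingCentre (hg : LipschitzWith K g) (hM : ∀ s, |g s| ≤ M) :
    ∃ c : ℝ → ℝ → ℂ, (∀ R, c R 0 = R) ∧ ∀ R t, HasDerivAt (c R) (guidingField g t (c R t)) t := by
  have hM0 : 0 ≤ M := (abs_nonneg _).trans (hM 0)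
  choose c h0 hc using fun R : ℝ => exists_global_solution (L := ⟨M, hM0⟩)
    (lipschitzWith_guidingField hg) (continuous_guidingField hg.continuous)
    (fun t x => by rw [norm_guidingField]; exact hM _) (R : ℂ)
  exact ⟨c, h0, hc⟩

theorem guidingCentre_unique (hg : LipschitzWith K g) {a b : ℝ → ℂ} {t₀ : ℝ}
    (ha : ∀ t, HasDerivAt a (guidingField g t (a t)) t)
    (hb : ∀ t, HasDerivAt b (guidingField g t (b t)) t) (h : a t₀ = b t₀) : a = b :=
  ODE_solution_unique_univ (s := fun _ => univ)
    (fun t => (lipschitzWith_guidingField hg t).lipschitzOnWith)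
    (fun t => ⟨ha t, mem_univ _⟩) (fun t => ⟨hb t, mem_univ _⟩) h

/-- Solutions are reflected to solutions. -/
theorem guidingCentre_reflect {a : ℝ → ℂ} {T w : ℝ}
    (hT : Complex.exp (Complex.I * (T : ℂ)) = Complex.exp (Complex.I * (w : ℂ)))
    (ha : ∀ t, HasDerivAt a (guidingField g t (a t)) t) (t : ℝ) :
    HasDerivAt (fun t => Complex.exp (Complex.I * (w : ℂ)) * (starRingEnd ℂ) (a (T - t)))
      (guidingField g t (Complex.exp (Complex.I * (w : ℂ)) * (starRingEnd ℂ) (a (T - t)))) t := by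
  have h1 : HasDerivAt (fun t => a (T - t)) (-guidingField g (T - t) (a (T - t))) t := by
    simpa using! (ha (T - t)).scomp t ((hasDerivAt_id t).const_sub T)
  have h2 := (Complex.conjCLE.toContinuousLinearMap.hasFDerivAt.comp_hasDerivAt t h1).const_mul
    (Complex.exp (Complex.I * (w : ℂ)))
  refine h2.congr_deriv ?_
  have e1 : Complex.exp (Complex.I * (t : ℂ)) =
      Complex.exp (Complex.I * (w : ℂ)) *
        (starRingEnd ℂ) (Complex.exp (Complex.I * ((T - t : ℝ) : ℂ))) := by
    rw [← Complex.exp_conj, ← hT, ← Complex.exp_add]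
    simp only [map_mul, Complex.conj_I, Complex.conj_ofReal]
    congr 1
    push_cast
    ring
  have e2 : ‖Complex.exp (Complex.I * (w : ℂ)) * (starRingEnd ℂ) (a (T - t)) +
      Complex.exp (Complex.I * (t : ℂ))‖ =
      ‖a (T - t) + Complex.exp (Complex.I * ((T - t : ℝ) : ℂ))‖ := by
    rw [e1, ← mul_add, ← map_add, norm_mul, norm_exp_I_mul, one_mul, Complex.norm_conj]
  simp only [guidingField, e2]
  rw [e1]
  simp [-Complex.ofReal_sub]
  ring

/-- Solutions are shifted and rotated to solutions. -/
theorem guidingCentre_shift {a : ℝ → ℂ} {T w : ℝ}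
    (hT : Complex.exp (Complex.I * (T : ℂ)) = Complex.exp (Complex.I * (w : ℂ)))
    (ha : ∀ t, HasDerivAt a (guidingField g t (a t)) t) (t : ℝ) :
    HasDerivAt (fun t => Complex.exp (-(Complex.I * (w : ℂ))) * a (t + T))
      (guidingField g t (Complex.exp (-(Complex.I * (w : ℂ))) * a (t + T))) t := by
  have h1 : HasDerivAt (fun t => a (t + T)) (guidingField g (t + T) (a (t + T))) t :=
    (ha (t + T)).comp_add_const t T
  refine (h1.const_mul (Complex.exp (-(Complex.I * (w : ℂ))))).congr_deriv ?_
  have e1 : Complex.exp (Complex.I * (t : ℂ)) = Complex.exp (-(Complex.I * (w : ℂ))) *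
      Complex.exp (Complex.I * ((t + T : ℝ) : ℂ)) := by
    rw [Complex.ofReal_add, mul_add, Complex.exp_add, hT, Complex.exp_neg]
    field_simp
  have e2 : ‖Complex.exp (-(Complex.I * (w : ℂ))) * a (t + T) + Complex.exp (Complex.I * (t : ℂ))‖
      = ‖a (t + T) + Complex.exp (Complex.I * ((t + T : ℝ) : ℂ))‖ := by
    rw [e1, ← mul_add, norm_mul, show -(Complex.I * (w : ℂ)) = Complex.I * ((-w : ℝ) : ℂ) by
      push_cast; ring, norm_exp_I_mul, one_mul]
  simp only [guidingField, e2]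
  rw [e1]
  ring

/-- If the solution hits the axis of angle `w / 2` at time `T / 2`, where `T = 2π + w`, then it is
invariant under the combined shift by `T` and rotation by `w`. -/
theorem guidingCentre_equivariant (hg : LipschitzWith K g) {a : ℝ → ℂ} {R w : ℝ}
    (ha : ∀ t, HasDerivAt a (guidingField g t (a t)) t) (h0 : a 0 = R)
    (hmid : (Complex.exp (-(Complex.I * ((w / 2 : ℝ) : ℂ))) * a (π + w / 2)).im = 0) (t : ℝ) :
    a (t + (2 * π + w)) = Complex.exp (Complex.I * (w : ℂ)) * a t := by
  have hT : Complex.exp (Complex.I * ((2 * π + w : ℝ) : ℂ)) =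
      Complex.exp (Complex.I * (w : ℂ)) := by
    rw [show Complex.I * ((2 * π + w : ℝ) : ℂ) = Complex.I * w + 2 * π * Complex.I by
      push_cast; ring, Complex.exp_periodic]
  have hsq : Complex.exp (Complex.I * (w : ℂ)) =
      Complex.exp (Complex.I * ((w / 2 : ℝ) : ℂ)) * Complex.exp (Complex.I * ((w / 2 : ℝ) : ℂ)) := by
    rw [← Complex.exp_add]; congr 1; push_cast; ring
  have hrefl : a = fun t => Complex.exp (Complex.I * (w : ℂ)) *
      (starRingEnd ℂ) (a (2 * π + w - t)) := by
    refine guidingCentre_unique hg (t₀ := π + w / 2) ha (guidingCentre_reflect hT ha) ?_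
    have h1 := Complex.conj_eq_iff_im.2 hmid
    rw [map_mul, ← Complex.exp_conj, map_neg, map_mul, Complex.conj_I, Complex.conj_ofReal,
      neg_mul, neg_neg, Complex.exp_neg] at h1
    rw [show 2 * π + w - (π + w / 2) = π + w / 2 by ring, hsq, mul_assoc, h1, ← mul_assoc,
      mul_inv_cancel₀ (Complex.exp_ne_zero _), one_mul]
  have hT0 : a (2 * π + w) = Complex.exp (Complex.I * (w : ℂ)) * R := by
    rw [hrefl]
    simp [h0]
  have hshift := guidingCentre_unique hg (t₀ := 0) ha (guidingCentre_shift hT ha)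
    (by simp only [zero_add]
        rw [hT0, h0, ← mul_assoc, ← Complex.exp_add, neg_add_cancel, Complex.exp_zero, one_mul])
  conv_rhs => rw [hshift]
  simp only
  rw [← mul_assoc, ← Complex.exp_add, add_neg_cancel, Complex.exp_zero, one_mul]

/-- Grönwall's inequality makes the time `τ` map Lipschitz in the initial radius; this continuity
feeds the intermediate value theorem. -/
theorem continuous_guidingCentre (hg : LipschitzWith K g) {c : ℝ → ℝ → ℂ} (h0 : ∀ R, c R 0 = R)
    (hc : ∀ R t, HasDerivAt (c R) (guidingField g t (c R t)) t) {τ : ℝ} (hτ : 0 ≤ τ) :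
    Continuous fun R => c R τ := by
  have : LipschitzWith (Real.toNNReal (exp (K * (τ - 0)))) fun R => c R τ := by
    refine LipschitzWith.of_dist_le_mul fun x y => ?_
    have := dist_le_of_trajectories_ODE (δ := dist x y) (a := 0) (b := τ)
      (lipschitzWith_guidingField hg)
      (fun t _ => (hc x t).continuousAt.continuousWithinAt)
      (fun t _ => (hc x t).hasDerivWithinAt)
      (fun t _ => (hc y t).continuousAt.continuousWithinAt)
      (fun t _ => (hc y t).hasDerivWithinAt)
      (by rw [h0, h0, Complex.dist_of_im_eq (by simp)]; simp) τ ⟨hτ, le_rfl⟩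
    rw [Real.coe_toNNReal _ (exp_pos _).le]
    linarith
  exact this.continuous

theorem norm_guidingCentre_sub_le {a : ℝ → ℂ} {R : ℝ} {t : ℝ} (ht : 0 ≤ t)
    (ha : ∀ t, HasDerivAt a (guidingField g t (a t)) t) (h0 : a 0 = R)
    (hM : ∀ x ∈ Icc 0 t, |g ‖a x + Complex.exp (Complex.I * (x : ℂ))‖| ≤ M) :
    ‖a t - R‖ ≤ M * t := by
  have := norm_image_sub_le_of_norm_deriv_le_segment' (f := a) (a := 0) (b := t) (C := M)
    (fun x _ => (ha x).hasDerivWithinAt)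
    (fun x hx => by rw [norm_guidingField]; exact hM x (Ico_subset_Icc_self hx)) t ⟨ht, le_rfl⟩
  simpa [h0] using this

end GuidingCentre

/-! ### The closing condition -/

section Shooting

/-- Radial profiles `g` which are small, globally Lipschitz, of size `s ^ (-γ)` with their first two
derivatives for `s > S`, and whose increments at large `s` are asymptotic to those of a function
with derivative `a * s ^ (-(γ + 1))`. -/
structure DriftProfile (g g₁ g₂ : ℝ → ℝ) (K : ℝ≥0) (M S γ a : ℝ) : Prop where
  gamma_pos : 0 < γ
  one_le : 1 ≤ S
  lip : LipschitzWith K g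
  small : ∀ s, |g s| ≤ 1 / 16
  bound : ∀ s, S < s → |g s| ≤ M * s ^ (-γ)
  bound₁ : ∀ s, S < s → |g₁ s| ≤ M * s ^ (-γ)
  bound₂ : ∀ s, S < s → |g₂ s| ≤ M * s ^ (-γ)
  deriv₁ : ∀ s, S < s → HasDerivAt g (g₁ s) s
  deriv₂ : ∀ s, S < s → HasDerivAt g₁ (g₂ s) s
  drift : ∀ η > 0, ∀ᶠ s in atTop, ∀ x, |x| ≤ 2 →
    |g (s + x) - g s - a * x * s ^ (-(γ + 1))| ≤ η * s ^ (-(γ + 1))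

variable {g g₁ g₂ : ℝ → ℝ} {K : ℝ≥0} {M S γ a : ℝ}

theorem rpow_neg_sub_two_le (hγ : 0 < γ) {R s : ℝ} (hR : 4 ≤ R) (hs : R - 2 ≤ s) :
    s ^ (-γ) ≤ 2 ^ γ * R ^ (-γ) := by
  calc s ^ (-γ) ≤ (R / 2) ^ (-γ) :=
        rpow_le_rpow_of_nonpos (by linarith) (by linarith) (by linarith)
    _ = 2 ^ γ * R ^ (-γ) := by
        rw [div_rpow (by linarith) (by norm_num), rpow_neg (by norm_num : (0 : ℝ) ≤ 2)]
        field_simp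

namespace DriftProfile

theorem bound_nonneg (hg : DriftProfile g g₁ g₂ K M S γ a) : 0 ≤ M := by
  have h := (abs_nonneg _).trans (hg.bound (S + 1) (by linarith))
  have : 0 < (S + 1) ^ (-γ) := rpow_pos_of_pos (by linarith [hg.one_le]) _
  exact nonneg_of_mul_nonneg_left h this

/-- The speed of the centre is at most `1 / 16`, and the time window of length `8` covers a full
step `2π + w` for small `w`. This crude bound keeps the orbit at large radius, where the decay of
`g` applies. -/
theorem norm_sub_le_half (hg : DriftProfile g g₁ g₂ K M S γ a) {b : ℝ → ℂ} {R t : ℝ}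
    (hb : ∀ t, HasDerivAt b (guidingField g t (b t)) t) (h0 : b 0 = R) (ht : t ∈ Icc 0 8) :
    ‖b t - R‖ ≤ 1 / 2 := by
  refine (norm_guidingCentre_sub_le ht.1 hb h0 (M := 1 / 16) fun x _ => hg.small _).trans ?_
  linarith [ht.2]

theorem norm_add_exp_ge {z : ℂ} {R : ℝ} (hz : R - 1 ≤ ‖z‖) (t : ℝ) :
    R - 2 ≤ ‖z + Complex.exp (Complex.I * (t : ℂ))‖ := by
  have h1 := norm_sub_le (z + Complex.exp (Complex.I * (t : ℂ))) (Complex.exp (Complex.I * (t : ℂ)))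
  rw [add_sub_cancel_right, norm_exp_I_mul] at h1
  linarith

theorem norm_sub_le (hg : DriftProfile g g₁ g₂ K M S γ a) {b : ℝ → ℂ} {R t : ℝ}
    (hb : ∀ t, HasDerivAt b (guidingField g t (b t)) t) (h0 : b 0 = R) (hR : S + 4 ≤ R)
    (ht : t ∈ Icc 0 8) : ‖b t - R‖ ≤ 8 * M * 2 ^ γ * R ^ (-γ) := by
  have hM := hg.bound_nonneg
  have hS := hg.one_le
  refine (norm_guidingCentre_sub_le (M := M * (2 ^ γ * R ^ (-γ))) ht.1 hb h0 fun x hx => ?_).trans ?_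
  · have h1 := hg.norm_sub_le_half hb h0 (t := x) ⟨hx.1, hx.2.trans ht.2⟩
    have h2 : R - 1 ≤ ‖b x‖ := by
      have := norm_sub_norm_le (R : ℂ) (b x)
      rw [norm_sub_rev, Complex.norm_of_nonneg (by linarith)] at this
      linarith
    have h3 := norm_add_exp_ge h2 x
    refine (hg.bound _ (by linarith)).trans ?_
    gcongr
    exact rpow_neg_sub_two_le hg.gamma_pos (by linarith) h3
  · have : 0 ≤ M * (2 ^ γ * R ^ (-γ)) := by
      have := rpow_nonneg (show 0 ≤ R by linarith) (-γ)
      positivity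
    nlinarith [ht.2]

/-- The squared norm is `(R + cos t)² + sin² t`; for `R ≥ 2` the cross term `2 (R + cos t) / R ≥ 1`
absorbs `sin² t`. -/
theorem norm_real_add_exp_bounds {R : ℝ} (hR : 2 ≤ R) (t : ℝ) :
    R + cos t ≤ ‖(R : ℂ) + Complex.exp (Complex.I * (t : ℂ))‖ ∧
      ‖(R : ℂ) + Complex.exp (Complex.I * (t : ℂ))‖ ≤ R + cos t + R⁻¹ := by
  have hn : ‖(R : ℂ) + Complex.exp (Complex.I * (t : ℂ))‖ ^ 2 = (R + cos t) ^ 2 + sin t ^ 2 := by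
    rw [mul_comm, Complex.exp_mul_I, ← Complex.normSq_eq_norm_sq, Complex.normSq_apply]
    simp [Complex.cos_ofReal_re, Complex.sin_ofReal_re]
    ring
  have hc := neg_one_le_cos t
  have hs : sin t ^ 2 ≤ 1 := sin_sq_le_one t
  have hRi : R * R⁻¹ = 1 := mul_inv_cancel₀ (by linarith)
  have hRp : 0 < R⁻¹ := by positivity
  constructor
  · exact le_of_sq_le_sq (by nlinarith) (norm_nonneg _)
  · refine le_of_sq_le_sq ?_ (by linarith)
    nlinarith

/-- Along the orbit `|b + e^{it}| - R` equals `cos t` up to `O(R^{-γ} + R⁻¹)`, so replacing one by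
the other costs only `o(R^{-(γ+1)})`. It is also at most `2` in absolute value, the step size
allowed in `drift`. -/
theorem drift_along (hg : DriftProfile g g₁ g₂ K M S γ a) {η : ℝ} (hη : 0 < η) :
    ∀ᶠ R in atTop, ∀ b : ℝ → ℂ, (∀ t, HasDerivAt b (guidingField g t (b t)) t) → b 0 = (R : ℝ) →
      ∀ t ∈ Icc (0 : ℝ) 8, |g ‖b t + Complex.exp (Complex.I * (t : ℂ))‖ - g R
        - a * cos t * R ^ (-(γ + 1))| ≤ η * R ^ (-(γ + 1)) := by
  have hlim : Tendsto (fun R : ℝ => |a| * (8 * M * 2 ^ γ * R ^ (-γ) + R⁻¹)) atTop (𝓝 0) := by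
    simpa using (((tendsto_rpow_neg_atTop hg.gamma_pos).const_mul (8 * M * 2 ^ γ)).add
      tendsto_inv_atTop_zero).const_mul |a|
  filter_upwards [hg.drift (η / 2) (by positivity), eventually_ge_atTop (S + 4),
    hlim.eventually_le_const (show 0 < η / 2 by positivity)] with R hR hRS hsmall b hb h0 t ht
  have hS := hg.one_le
  have hRpos : 0 < R := by linarith
  have h1 := hg.norm_sub_le hb h0 hRS ht
  have h2 := hg.norm_sub_le_half hb h0 ht
  set x := ‖b t + Complex.exp (Complex.I * (t : ℂ))‖ - R with hx
  obtain ⟨h3, h4⟩ := norm_real_add_exp_bounds (R := R) (by linarith) t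
  have h5 : |‖b t + Complex.exp (Complex.I * (t : ℂ))‖ -
      ‖(R : ℂ) + Complex.exp (Complex.I * (t : ℂ))‖| ≤ ‖b t - R‖ := by
    simpa using abs_norm_sub_norm_le (b t + Complex.exp (Complex.I * (t : ℂ)))
      ((R : ℂ) + Complex.exp (Complex.I * (t : ℂ)))
  have hRi : R⁻¹ ≤ 1 / 2 := by
    rw [one_div]
    exact inv_anti₀ (by norm_num) (by linarith)
  have hc1 := neg_one_le_cos t
  have hc2 := cos_le_one t
  have h5' := abs_le.1 h5
  have hx2 : |x| ≤ 2 := abs_le.2 ⟨by linarith [h5'.1], by linarith [h5'.2]⟩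
  have hxc : |x - cos t| ≤ 8 * M * 2 ^ γ * R ^ (-γ) + R⁻¹ :=
    abs_le.2 ⟨by linarith [h5'.1, inv_pos.2 hRpos], by linarith [h5'.2]⟩
  have key := hR x hx2
  have hP : 0 < R ^ (-(γ + 1)) := rpow_pos_of_pos hRpos _
  have h6 : |a * (x - cos t) * R ^ (-(γ + 1))| ≤ η / 2 * R ^ (-(γ + 1)) := by
    rw [abs_mul, abs_mul, abs_of_pos hP]
    gcongr
    exact (mul_le_mul_of_nonneg_left hxc (abs_nonneg a)).trans hsmall
  rw [show ‖b t + Complex.exp (Complex.I * (t : ℂ))‖ = R + x by simp [hx]]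
  calc |g (R + x) - g R - a * cos t * R ^ (-(γ + 1))|
      = |(g (R + x) - g R - a * x * R ^ (-(γ + 1))) + a * (x - cos t) * R ^ (-(γ + 1))| := by
        congr 1; ring
    _ ≤ η / 2 * R ^ (-(γ + 1)) + η / 2 * R ^ (-(γ + 1)) :=
        (abs_add_le _ _).trans (add_le_add key h6)
    _ = η * R ^ (-(γ + 1)) := by ring

/-- The component transversal to the axis of angle `w / 2` has derivative `cos (t - w/2) g`.
Replacing `g` by `g R + P cos t` gives an explicit primitive, and the error is integrated over a
time below `8`. -/
theorem defect_estimate {b : ℝ → ℂ} {R w ε : ℝ} (hw : |w| ≤ 1)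
    (hb : ∀ t, HasDerivAt b (guidingField g t (b t)) t) (h0 : b 0 = R) (P : ℝ)
    (h : ∀ t ∈ Icc (0 : ℝ) 8, |g ‖b t + Complex.exp (Complex.I * (t : ℂ))‖ - g R
      - P * cos t| ≤ ε) :
    |(Complex.exp (-(Complex.I * ((w / 2 : ℝ) : ℂ))) * b (π + w / 2)).im + R * sin (w / 2)
      - g R * sin (w / 2) - P * ((sin (w / 2) + (π + w / 2) * cos (w / 2)) / 2)| ≤ ε * 8 := by
  have hw' := abs_le.1 hw
  have hpi := pi_gt_three
  have hpi4 := pi_le_four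
  set ψ : ℝ → ℝ := fun t => (Complex.exp (-(Complex.I * ((w / 2 : ℝ) : ℂ))) * b t).im
    - (g R * sin (t - w / 2) + P * ((sin (2 * t - w / 2) / 2 + t * cos (w / 2)) / 2)) with hψ
  have hd : ∀ t, HasDerivAt ψ (cos (t - w / 2) *
      (g ‖b t + Complex.exp (Complex.I * (t : ℂ))‖ - g R - P * cos t)) t := by
    intro t
    have h1 : HasDerivAt (fun t => (Complex.exp (-(Complex.I * ((w / 2 : ℝ) : ℂ))) * b t).im)
        (Complex.exp (-(Complex.I * ((w / 2 : ℝ) : ℂ))) * guidingField g t (b t)).im t :=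
      Complex.imCLM.hasFDerivAt.comp_hasDerivAt t
        ((hb t).const_mul (Complex.exp (-(Complex.I * ((w / 2 : ℝ) : ℂ)))))
    have h2 : HasDerivAt (fun t => sin (t - w / 2)) (cos (t - w / 2)) t := by
      simpa using ((hasDerivAt_id t).sub_const (w / 2)).sin
    have h3 : HasDerivAt (fun t => sin (2 * t - w / 2)) (cos (2 * t - w / 2) * 2) t := by
      simpa using (((hasDerivAt_id t).const_mul 2).sub_const (w / 2)).sin
    have h4 := h1.sub ((h2.const_mul (g R)).add
      ((((h3.div_const 2).add ((hasDerivAt_id t).mul_const (cos (w / 2)))).div_const 2).const_mul P))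
    refine h4.congr_deriv ?_
    have e1 : (Complex.exp (-(Complex.I * ((w / 2 : ℝ) : ℂ))) * guidingField g t (b t)).im =
        cos (t - w / 2) * g ‖b t + Complex.exp (Complex.I * (t : ℂ))‖ := by
      rw [guidingField, show Complex.exp (-(Complex.I * ((w / 2 : ℝ) : ℂ))) * (Complex.I *
        Complex.exp (Complex.I * (t : ℂ)) * (g ‖b t + Complex.exp (Complex.I * (t : ℂ))‖ : ℂ)) =
        Complex.I * Complex.exp (((t - w / 2 : ℝ) : ℂ) * Complex.I) *
          (g ‖b t + Complex.exp (Complex.I * (t : ℂ))‖ : ℂ) by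
        rw [show ((t - w / 2 : ℝ) : ℂ) * Complex.I =
          -(Complex.I * ((w / 2 : ℝ) : ℂ)) + Complex.I * (t : ℂ) by push_cast; ring,
          Complex.exp_add]; ring]
      rw [Complex.im_mul_ofReal, Complex.I_mul_im, Complex.exp_ofReal_mul_I_re]
    have e2 : cos (2 * t - w / 2) + cos (w / 2) = 2 * (cos t * cos (t - w / 2)) := by
      have := cos_add_cos (2 * t - w / 2) (w / 2)
      rw [this, show (2 * t - w / 2 + w / 2) / 2 = t by ring,
        show (2 * t - w / 2 - w / 2) / 2 = t - w / 2 by ring, mul_assoc]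
    rw [e1]
    linear_combination (-P / 2) * e2
  have hmv := norm_image_sub_le_of_norm_deriv_le_segment' (f := ψ) (a := 0) (b := π + w / 2)
    (C := ε) (fun x _ => (hd x).hasDerivWithinAt)
    (fun x hx => by
      rw [norm_mul, Real.norm_eq_abs, Real.norm_eq_abs]
      calc _ ≤ 1 * |g ‖b x + Complex.exp (Complex.I * (x : ℂ))‖ - g R - P * cos x| := by
            gcongr; exact abs_cos_le_one _
        _ ≤ ε := by rw [one_mul]; exact h x ⟨hx.1, by linarith [hx.2]⟩) (π + w / 2)
    ⟨by linarith, le_rfl⟩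
  have hε : 0 ≤ ε := (abs_nonneg _).trans (h 0 ⟨le_rfl, by norm_num⟩)
  have hval : ψ (π + w / 2) - ψ 0 =
      (Complex.exp (-(Complex.I * ((w / 2 : ℝ) : ℂ))) * b (π + w / 2)).im + R * sin (w / 2)
      - g R * sin (w / 2) - P * ((sin (w / 2) + (π + w / 2) * cos (w / 2)) / 2) := by
    have e0 : (Complex.exp (-(Complex.I * ((w / 2 : ℝ) : ℂ))) * b 0).im = - (R * sin (w / 2)) := by
      rw [h0, Complex.im_mul_ofReal, show -(Complex.I * ((w / 2 : ℝ) : ℂ)) =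
        ((-(w / 2) : ℝ) : ℂ) * Complex.I by push_cast; ring, Complex.exp_ofReal_mul_I_im, sin_neg]
      ring
    simp only [hψ]
    rw [e0, show π + w / 2 - w / 2 = π by ring, show 2 * (π + w / 2) - w / 2 = w / 2 + 2 * π by ring,
      sin_add_two_pi, sin_pi, show 0 - w / 2 = -(w / 2) by ring,
      show 2 * 0 - w / 2 = -(w / 2) by ring, sin_neg]
    ring
  rw [hval, Real.norm_eq_abs] at hmv
  refine hmv.trans (mul_le_mul_of_nonneg_left ?_ hε)
  linarith

/-- After scaling by `R^{γ+1}`, the constant part `g R` contributes at most a multiple of `|R w|`,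
which vanishes in the limit. The part proportional to `cos t` contributes `a ∫₀^π cos² = a π/2`. -/
theorem tendsto_defect (hg : DriftProfile g g₁ g₂ K M S γ a) {R w : ℕ → ℝ} {b : ℕ → ℝ → ℂ}
    (hR : Tendsto R atTop atTop) (hw : Tendsto w atTop (𝓝 0))
    (hRw : Tendsto (fun n => R n * w n) atTop (𝓝 0))
    (hb : ∀ n t, HasDerivAt (b n) (guidingField g t (b n t)) t) (h0 : ∀ n, b n 0 = (R n : ℝ)) :
    Tendsto (fun n => R n ^ (γ + 1) *
      ((Complex.exp (-(Complex.I * ((w n / 2 : ℝ) : ℂ))) * b n (π + w n / 2)).im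
        + R n * sin (w n / 2))) atTop (𝓝 (a * (π / 2))) := by
  have hS := hg.one_le
  have hJ : Tendsto (fun n => (sin (w n / 2) + (π + w n / 2) * cos (w n / 2)) / 2) atTop
      (𝓝 (π / 2)) := by
    have hc : Continuous fun x : ℝ => (sin (x / 2) + (π + x / 2) * cos (x / 2)) / 2 := by fun_prop
    simpa using! (hc.tendsto 0).comp hw
  have hG : Tendsto (fun n => R n ^ (γ + 1) * (g (R n) * sin (w n / 2))) atTop (𝓝 0) := by
    refine squeeze_zero_norm' (a := fun n => M * |R n * w n|) ?_ (by simpa using hRw.abs.const_mul M)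
    filter_upwards [hR.eventually_gt_atTop S] with n hn
    have hpos : 0 < R n := by linarith
    have h1 := hg.bound _ hn
    have h2 : |sin (w n / 2)| ≤ |w n| :=
      abs_sin_le_abs.trans (by rw [abs_div, abs_two]; linarith [abs_nonneg (w n)])
    rw [norm_mul, norm_mul, norm_of_nonneg (rpow_nonneg hpos.le _), Real.norm_eq_abs,
      Real.norm_eq_abs]
    calc R n ^ (γ + 1) * (|g (R n)| * |sin (w n / 2)|)
        ≤ R n ^ (γ + 1) * ((M * R n ^ (-γ)) * |w n|) := by
          have := (abs_nonneg _).trans h1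
          gcongr
      _ = M * (R n ^ (γ + 1) * R n ^ (-γ)) * |w n| := by ring
      _ = M * |R n * w n| := by
        rw [← rpow_add hpos, show γ + 1 + -γ = 1 by ring, rpow_one, abs_mul, abs_of_pos hpos]
        ring
  have hdiff : Tendsto (fun n => R n ^ (γ + 1) *
      ((Complex.exp (-(Complex.I * ((w n / 2 : ℝ) : ℂ))) * b n (π + w n / 2)).im
        + R n * sin (w n / 2)) - (R n ^ (γ + 1) * (g (R n) * sin (w n / 2)) +
          a * ((sin (w n / 2) + (π + w n / 2) * cos (w n / 2)) / 2))) atTop (𝓝 0) := by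
    rw [Metric.tendsto_nhds]
    intro η hη
    filter_upwards [hR.eventually (hg.drift_along (show 0 < η / 16 by positivity)),
      hR.eventually_gt_atTop S, hw.abs.eventually_le_const (show |(0 : ℝ)| < 1 by simp)]
      with n h1 h2 h3
    have hpos : 0 < R n := by linarith
    have h4 := defect_estimate h3 (hb n) (h0 n) (a * R n ^ (-(γ + 1)))
      (ε := η / 16 * R n ^ (-(γ + 1)))
      (fun t ht => by simpa only [mul_right_comm] using h1 (b n) (hb n) (h0 n) t ht)
    have hP : R n ^ (γ + 1) * R n ^ (-(γ + 1)) = 1 := by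
      rw [← rpow_add hpos, add_neg_cancel, rpow_zero]
    have hQ : 0 < R n ^ (γ + 1) := rpow_pos_of_pos hpos _
    rw [dist_zero_right, Real.norm_eq_abs]
    have h5 := mul_le_mul_of_nonneg_left h4 hQ.le
    rw [← abs_of_pos hQ, ← abs_mul, abs_of_pos hQ] at h5
    rw [show R n ^ (γ + 1) * (η / 16 * R n ^ (-(γ + 1)) * 8) = η / 2 by
      linear_combination (η / 2) * hP] at h5
    refine lt_of_le_of_lt (le_of_eq_of_le ?_ h5) (by linarith)
    congr 1
    linear_combination (a * ((sin (w n / 2) + (π + w n / 2) * cos (w n / 2)) / 2)) * hP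
  simpa using hdiff.add (hG.add (hJ.const_mul a))

theorem tendsto_natCast_mul_angle (σ : ℝ) :
    Tendsto (fun n : ℕ => (n : ℝ) * (2 * π * σ / (n - σ))) atTop (𝓝 (2 * π * σ)) := by
  have h1 : Tendsto (fun n : ℕ => (n : ℝ) / (n + (-σ))) atTop (𝓝 1) :=
    tendsto_natCast_div_add_atTop (-σ)
  have h2 := h1.const_mul (2 * π * σ)
  rw [mul_one] at h2
  refine h2.congr fun n => ?_
  rw [← sub_eq_add_neg]
  ring

theorem tendsto_angle (σ : ℝ) :
    Tendsto (fun n : ℕ => 2 * π * σ / (n - σ)) atTop (𝓝 0) := by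
  refine tendsto_const_nhds.div_atTop ?_
  simpa only [sub_eq_add_neg] using tendsto_atTop_add_const_right _ _ tendsto_natCast_atTop_atTop

theorem rpow_radius {γ x : ℝ} (hγ : 0 < γ) (hx : 0 ≤ x) :
    (x ^ (1 / (γ + 2))) ^ (γ + 2) = x := by
  rw [← rpow_mul hx, one_div, inv_mul_cancel₀ (by linarith), rpow_one]

theorem tendsto_radius {γ r : ℝ} (hγ : 0 < γ) (hr : 0 < r) :
    Tendsto (fun n : ℕ => (r * n) ^ (1 / (γ + 2))) atTop atTop :=
  (tendsto_rpow_atTop (by positivity)).comp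
    (tendsto_natCast_atTop_atTop.const_mul_atTop hr)

theorem tendsto_shooting (hg : DriftProfile g g₁ g₂ K M S γ a) {σ r : ℝ} (hr : 0 < r)
    {c : ℝ → ℝ → ℂ} (h0 : ∀ R, c R 0 = R)
    (hc : ∀ R t, HasDerivAt (c R) (guidingField g t (c R t)) t) :
    Tendsto (fun n : ℕ => ((r * n) ^ (1 / (γ + 2))) ^ (γ + 1) *
      (Complex.exp (-(Complex.I * ((2 * π * σ / (n - σ) / 2 : ℝ) : ℂ))) *
        c ((r * n) ^ (1 / (γ + 2))) (π + 2 * π * σ / (n - σ) / 2)).im) atTop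
      (𝓝 (a * (π / 2) - r * (π * σ))) := by
  have hγ := hg.gamma_pos
  have hR := tendsto_radius hγ hr
  have hpow : ∀ᶠ n : ℕ in atTop, 0 < (r * n : ℝ) ^ (1 / (γ + 2)) := hR.eventually_gt_atTop 0
  have hRn : Tendsto (fun n : ℕ => (r * n : ℝ) ^ (1 / (γ + 2)) / n) atTop (𝓝 0) := by
    have h1 : Tendsto (fun n : ℕ => r * ((r * n : ℝ) ^ (1 / (γ + 2))) ^ (-(γ + 1))) atTop (𝓝 0) := by
      simpa using! ((tendsto_rpow_neg_atTop (by linarith : 0 < γ + 1)).comp hR).const_mul r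
    refine h1.congr' ?_
    filter_upwards [hpow, eventually_gt_atTop 0] with n hn hn0
    have hn0' : (0 : ℝ) < n := by exact_mod_cast hn0
    have e := rpow_radius hγ (show 0 ≤ r * n by positivity)
    rw [eq_div_iff hn0'.ne', mul_right_comm]
    set ρ := (r * n : ℝ) ^ (1 / (γ + 2))
    rw [← e, ← rpow_add hn, show γ + 2 + -(γ + 1) = 1 by ring, rpow_one]
  have hnw := tendsto_natCast_mul_angle σ
  have hw := tendsto_angle σ
  have hRw : Tendsto (fun n : ℕ => (r * n : ℝ) ^ (1 / (γ + 2)) * (2 * π * σ / (n - σ)))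
      atTop (𝓝 0) := by
    have := hRn.mul hnw
    rw [zero_mul] at this
    refine this.congr' ?_
    filter_upwards [eventually_gt_atTop 0] with n hn0
    have hn0' : (n : ℝ) ≠ 0 := by exact_mod_cast hn0.ne'
    rw [← mul_assoc, div_mul_cancel₀ _ hn0']
  have hmain := hg.tendsto_defect hR hw hRw (fun n => hc _) (fun n => h0 _)
  -- Since `R^{γ+2} = r n`, the scaled term `R^{γ+1} R sin (w/2)` is `r n sin (w/2)`, with limit `r
  -- π σ`.
  have hsin : Tendsto (fun n : ℕ => r * ((n : ℝ) * (2 * π * σ / (n - σ)) / 2 *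
      sinc (2 * π * σ / (n - σ) / 2))) atTop (𝓝 (r * (π * σ))) := by
    have h1 : Tendsto (fun n : ℕ => sinc (2 * π * σ / (n - σ) / 2)) atTop (𝓝 1) := by
      have hc : Continuous fun x : ℝ => sinc (x / 2) := continuous_sinc.comp (by fun_prop)
      simpa using! (hc.tendsto 0).comp hw
    convert ((hnw.div_const 2).mul h1).const_mul r using 2
    ring
  refine (hmain.sub hsin).congr' ?_
  filter_upwards [hpow] with n hn
  have e := rpow_radius hγ (show 0 ≤ r * n by positivity)
  have e2 : ((r * n : ℝ) ^ (1 / (γ + 2))) ^ (γ + 1) * (r * n : ℝ) ^ (1 / (γ + 2)) = r * n := by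
    conv_rhs => rw [← e]
    set ρ := (r * n : ℝ) ^ (1 / (γ + 2))
    rw [← rpow_add_one hn.ne']
    ring_nf
  have e3 : ∀ x : ℝ, sin x = x * sinc x := fun x => by
    rcases eq_or_ne x 0 with rfl | hx
    · simp
    · rw [sinc_of_ne_zero hx, mul_div_cancel₀ _ hx]
  rw [mul_add, ← mul_assoc, e2, e3]
  ring

/-- The limiting defect `a π/2 - r π σ` vanishes at `r = aσ/2`, which the endpoints `aσ/4` and `aσ`
straddle. For large `n` the defect therefore changes sign between them. -/
theorem exists_closing (hg : DriftProfile g g₁ g₂ K M S γ a) {σ : ℝ} (hσ : σ = 1 ∨ σ = -1)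
    (haσ : 0 < a * σ) {c : ℝ → ℝ → ℂ} (h0 : ∀ R, c R 0 = R)
    (hc : ∀ R t, HasDerivAt (c R) (guidingField g t (c R t)) t) :
    ∀ᶠ n : ℕ in atTop, ∃ r ∈ Ioo (a * σ / 4) (a * σ),
      (Complex.exp (-(Complex.I * ((2 * π * σ / (n - σ) / 2 : ℝ) : ℂ))) *
        c ((r * n) ^ (1 / (γ + 2))) (π + 2 * π * σ / (n - σ) / 2)).im = 0 := by
  have hσ2 : σ * σ = 1 := by rcases hσ with rfl | rfl <;> norm_num
  have hpi := pi_pos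
  have hγ := hg.gamma_pos
  have hlo := (hg.tendsto_shooting (σ := σ) (show 0 < a * σ / 4 by linarith) h0 hc).const_mul σ
  have hhi := (hg.tendsto_shooting (σ := σ) haσ h0 hc).const_mul σ
  have h1 : 0 < σ * (a * (π / 2) - a * σ / 4 * (π * σ)) := by
    rw [show σ * (a * (π / 2) - a * σ / 4 * (π * σ)) = (a * σ) * π * (1 / 2 - σ * σ / 4) by ring, hσ2]
    norm_num
    positivity
  have h2 : σ * (a * (π / 2) - a * σ * (π * σ)) < 0 := by
    rw [show σ * (a * (π / 2) - a * σ * (π * σ)) = -((a * σ) * π * (σ * σ - 1 / 2)) by ring, hσ2]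
    norm_num
    positivity
  have hw := (tendsto_angle σ).abs.eventually_le_const (show |(0 : ℝ)| < 1 by simp)
  filter_upwards [hlo.eventually_const_lt h1, hhi.eventually_lt_const h2, hw] with n hn1 hn2 hn3
  have hτ : 0 ≤ π + 2 * π * σ / (n - σ) / 2 := by
    have := (abs_le.1 hn3).1
    linarith [pi_gt_three]
  have hcont := continuous_guidingCentre hg.lip h0 hc hτ
  set F : ℝ → ℝ := fun r => σ * (((r * n) ^ (1 / (γ + 2))) ^ (γ + 1) *
    (Complex.exp (-(Complex.I * ((2 * π * σ / (n - σ) / 2 : ℝ) : ℂ))) *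
      c ((r * n) ^ (1 / (γ + 2))) (π + 2 * π * σ / (n - σ) / 2)).im) with hF
  have hrad : Continuous fun r : ℝ => (r * n) ^ (1 / (γ + 2)) :=
    (continuous_id.mul continuous_const).rpow_const fun _ => Or.inr (by positivity)
  have hFc : Continuous F := by
    refine continuous_const.mul ((hrad.rpow_const fun _ => Or.inr (by positivity)).mul ?_)
    exact Complex.continuous_im.comp (continuous_const.mul (hcont.comp hrad))
  obtain ⟨r, hr, hr0⟩ := intermediate_value_Ioo' (show a * σ / 4 ≤ a * σ by linarith)
    hFc.continuousOn ⟨hn2, hn1⟩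
  refine ⟨r, hr, ?_⟩
  -- For `n = 0` the radius and the prefactor of `F` would vanish, contradicting strict positivity
  -- at the left endpoint.
  have hn : (0 : ℝ) < n := by
    rcases (Nat.cast_nonneg n : (0 : ℝ) ≤ n).eq_or_lt with h | h
    · rw [← h] at hn1
      simp [zero_rpow (show (γ + 2)⁻¹ ≠ 0 by positivity),
        zero_rpow (show γ + 1 ≠ 0 by positivity)] at hn1
    · exact h
  have hrn : 0 < r * n := mul_pos (by linarith [hr.1]) hn
  have hne : ((r * n) ^ (1 / (γ + 2))) ^ (γ + 1) ≠ 0 := by positivity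
  have hσ0 : σ ≠ 0 := by rintro rfl; simp at hσ2
  exact ((mul_eq_zero.1 ((mul_eq_zero.1 hr0).resolve_left hσ0)).resolve_left hne)

end DriftProfile

end Shooting

/-! ### Bounds along equivariant orbits -/

section Orbits

variable {ι : Type*} {l : Filter ι} {g g₁ g₂ : ℝ → ℝ} {K : ℝ≥0} {M S γ a : ℝ}
  {R rate T : ι → ℝ} {b : ι → ℝ → ℂ}

/-- A family of solutions of the guiding centre equation, starting at large real points `R`, which
are invariant under a shift by `T` combined with a rotation of speed `rate`. -/
structure OrbitFamily (l : Filter ι) (g : ℝ → ℝ) (γ : ℝ) (R rate T : ι → ℝ) (b : ι → ℝ → ℂ) :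
    Prop where
  tendsto : Tendsto R l atTop
  solves : ∀ i t, HasDerivAt (b i) (guidingField g t (b i t)) t
  init : ∀ i, b i 0 = (R i : ℝ)
  period : ∀ᶠ i in l, 0 < T i ∧ T i ≤ 8
  angle : ∀ᶠ i in l, T i = 2 * π + rate i * T i
  equivariant : ∀ᶠ i in l, ∀ t, b i (t + T i) = Complex.exp (Complex.I * ((rate i * T i : ℝ) : ℂ)) * b i t
  rate_le : ∃ C, ∀ᶠ i in l, R i * |rate i| ≤ C * R i ^ (-γ)

theorem norm_exp_sub_one_le (x : ℝ) : ‖Complex.exp (Complex.I * (x : ℂ)) - 1‖ ≤ |x| :=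
  Real.norm_exp_I_mul_ofReal_sub_one_le

namespace OrbitFamily

theorem radius_pos (hO : OrbitFamily l g γ R rate T b) : ∀ᶠ i in l, 0 ≤ R i ^ (-γ) := by
  filter_upwards [hO.tendsto.eventually_ge_atTop 0] with i hi using rpow_nonneg hi _

theorem exp_period (hO : OrbitFamily l g γ R rate T b) :
    ∀ᶠ i in l, ∀ t : ℝ, Complex.exp (Complex.I * ((t + T i : ℝ) : ℂ)) =
      Complex.exp (Complex.I * ((rate i * T i : ℝ) : ℂ)) * Complex.exp (Complex.I * (t : ℂ)) := by
  filter_upwards [hO.angle] with i hi t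
  rw [← Complex.exp_add, show Complex.I * ((t + T i : ℝ) : ℂ) =
    Complex.I * ((rate i * T i : ℝ) : ℂ) + Complex.I * (t : ℂ) + 2 * π * Complex.I by
      nth_rw 1 [hi]; push_cast; ring, Complex.exp_periodic]

theorem exp_rate_period (t : ℝ) (i : ι) :
    Complex.exp (Complex.I * ((rate i * (t + T i) : ℝ) : ℂ)) =
      Complex.exp (Complex.I * ((rate i * T i : ℝ) : ℂ)) *
        Complex.exp (Complex.I * ((rate i * t : ℝ) : ℂ)) := by
  rw [← Complex.exp_add]
  congr 1
  push_cast
  ring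

/-- Bounds for the norm of an equivariant function hold globally if they hold on a period. -/
theorem norm_of_period {f : ℝ → ℂ} {z : ℂ} {T : ℝ} (hT : 0 < T) (hz : ‖z‖ = 1)
    (hf : ∀ t, f (t + T) = z * f t) {p : ℝ → Prop} (hp : ∀ t ∈ Icc 0 T, p ‖f t‖) (t : ℝ) :
    p ‖f t‖ := by
  have hper : Function.Periodic (fun t => ‖f t‖) T := fun t => by simp [hf, hz]
  obtain ⟨y, hy, hye⟩ := hper.exists_mem_Ico₀ hT t
  rw [show ‖f t‖ = ‖f y‖ from hye]
  exact hp y (Ico_subset_Icc_self hy)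

theorem centre_bound (hO : OrbitFamily l g γ R rate T b) (hg : DriftProfile g g₁ g₂ K M S γ a) :
    UBdd l 0 (fun i => R i ^ (-γ))
      (fun i t => b i t - R i * Complex.exp (Complex.I * ((rate i * t : ℝ) : ℂ))) := by
  obtain ⟨C, hC⟩ := hO.rate_le
  refine ⟨8 * M * 2 ^ γ + C * 8, ?_⟩
  filter_upwards [hC, hO.period, hO.equivariant, hO.tendsto.eventually_ge_atTop (S + 4)]
    with i hCi hT he hR t
  have hR0 : 0 ≤ R i := by linarith [hg.one_le]
  -- The orbit and the rotating point `R e^{i rate t}` turn by the same angle over a period, so one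
  -- period suffices. There the orbit has moved by `O(R^{-γ})`, and so has the rotating point,
  -- because `R |rate| t ≤ 8 C R^{-γ}`.
  refine norm_of_period
    (f := fun t => b i t - R i * Complex.exp (Complex.I * ((rate i * t : ℝ) : ℂ)))
    hT.1 (norm_exp_I_mul (rate i * T i)) (fun t => ?_) (p := fun x => x ≤ (8 * M * 2 ^ γ + C * 8) * R i ^ (-γ)) (fun t ht => ?_) t
  · rw [he, exp_rate_period]
    ring
  · have h1 := hg.norm_sub_le (hO.solves i) (hO.init i) hR ⟨ht.1, ht.2.trans hT.2⟩
    have h2 := norm_exp_sub_one_le (rate i * t)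
    have h3 : ‖(R i : ℂ) * (Complex.exp (Complex.I * ((rate i * t : ℝ) : ℂ)) - 1)‖ ≤
        C * R i ^ (-γ) * 8 := by
      rw [norm_mul, Complex.norm_of_nonneg hR0]
      calc R i * ‖Complex.exp (Complex.I * ((rate i * t : ℝ) : ℂ)) - 1‖
          ≤ R i * (|rate i| * 8) := by
            gcongr
            refine h2.trans ?_
            rw [abs_mul, abs_of_nonneg ht.1]
            gcongr
            exact ht.2.trans hT.2
        _ = R i * |rate i| * 8 := by ring
        _ ≤ _ := by gcongr
    calc _ = ‖(b i t - R i) -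
          (R i : ℂ) * (Complex.exp (Complex.I * ((rate i * t : ℝ) : ℂ)) - 1)‖ := by
          congr 1; ring
      _ ≤ 8 * M * 2 ^ γ * R i ^ (-γ) + C * R i ^ (-γ) * 8 :=
          (_root_.norm_sub_le _ _).trans (add_le_add h1 h3)
      _ = _ := by ring

theorem norm_ge (hO : OrbitFamily l g γ R rate T b) (hg : DriftProfile g g₁ g₂ K M S γ a) :
    ∀ᶠ i in l, ∀ t, R i - 2 ≤ ‖b i t + Complex.exp (Complex.I * (t : ℂ))‖ := by
  filter_upwards [hO.period, hO.equivariant, hO.tendsto.eventually_ge_atTop 0]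
    with i hT he hR t
  refine DriftProfile.norm_add_exp_ge ?_ t
  refine norm_of_period hT.1 (norm_exp_I_mul (rate i * T i)) he
    (p := fun x => R i - 1 ≤ x) (fun t ht => ?_) t
  have h1 := hg.norm_sub_le_half (hO.solves i) (hO.init i) ⟨ht.1, ht.2.trans hT.2⟩
  have h2 := norm_sub_norm_le (R i : ℂ) (b i t)
  rw [norm_sub_rev, Complex.norm_of_nonneg hR] at h2
  linarith

end OrbitFamily

theorem hasDerivAt_norm {U : ℝ → ℂ} {U' : ℂ} {t : ℝ} (hU : HasDerivAt U U' t) (h0 : U t ≠ 0) :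
    HasDerivAt (fun t => ‖U t‖) (inner ℝ (‖U t‖⁻¹ • U t) U') t := by
  have h1 := hU.norm_sq.sqrt (pow_ne_zero 2 (norm_ne_zero_iff.2 h0))
  simp only [sqrt_sq (norm_nonneg _)] at h1
  refine h1.congr_deriv ?_
  rw [real_inner_smul_left]
  have := norm_ne_zero_iff.2 h0
  field_simp

/-- A small radial profile is uniformly small in `C²` along curves of bounded speed whose velocity
is controlled by the profile itself. -/
theorem UBdd.profile_comp_norm {ε : ι → ℝ} {U U' : ι → ℝ → ℂ}
    (hU : ∀ᶠ i in l, ∀ t, HasDerivAt (U i) (U' i t) t)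
    (hpos : ∀ᶠ i in l, ∀ t, S < ‖U i t‖ ∧ 1 ≤ ‖U i t‖)
    (h0 : UBdd l 0 ε (fun i t => g ‖U i t‖)) (h1 : UBdd l 0 ε (fun i t => g₁ ‖U i t‖))
    (h2 : UBdd l 0 ε (fun i t => g₂ ‖U i t‖))
    (hd1 : ∀ s, S < s → HasDerivAt g (g₁ s) s) (hd2 : ∀ s, S < s → HasDerivAt g₁ (g₂ s) s)
    (hU' : ∀ k, UBdd l k ε (fun i t => g ‖U i t‖) → UBdd l k 1 U') :
    UBdd l 2 ε (fun i t => g ‖U i t‖) := by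
  set ν : ι → ℝ → ℂ := fun i t => ‖U i t‖⁻¹ • U i t with hν
  set κ : ι → ℝ → ℝ := fun i t => ‖U i t‖⁻¹ with hκ
  set ρ' : ι → ℝ → ℝ := fun i t => inner ℝ (ν i t) (U' i t) with hρ'
  have hρ : ∀ᶠ i in l, ∀ t, HasDerivAt (fun t => ‖U i t‖) (ρ' i t) t := by
    filter_upwards [hU, hpos] with i h1 h2 t
    exact hasDerivAt_norm (h1 t) (norm_pos_iff.1 (by linarith [(h2 t).2]))
  have hν0 : UBdd l 0 1 ν := by
    refine ⟨1, ?_⟩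
    filter_upwards [hpos] with i hi t
    have : ‖U i t‖ ≠ 0 := by linarith [(hi t).2]
    simp [hν, this]
  have hκ0 : UBdd l 0 1 κ := by
    refine ⟨1, ?_⟩
    filter_upwards [hpos] with i hi t
    simpa [hκ] using inv_le_one_of_one_le₀ (hi t).2
  have hρ'k : ∀ k, UBdd l k 1 ν → UBdd l k ε (fun i t => g ‖U i t‖) → UBdd l k 1 ρ' :=
    fun k hk hgk => hk.inner_one (hU' k hgk)
  have hr0 := hρ'k 0 hν0 h0
  have hcomp : ∀ {u u₁ : ℝ → ℝ} (k : ℕ), (∀ s, S < s → HasDerivAt u (u₁ s) s) →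
      UBdd l 0 ε (fun i t => u ‖U i t‖) → UBdd l k ε (fun i t => u₁ ‖U i t‖) → UBdd l k 1 ρ' →
      UBdd l (k + 1) ε (fun i t => u ‖U i t‖) := by
    intro u u₁ k hu hu0 hu1 hr
    refine of_hasDerivAt hu0 ?_ (hu1.mul_one hr)
    filter_upwards [hρ, hpos] with i h1 h2 t
    exact (hu _ (h2 t).1).comp t (h1 t)
  -- The velocity depends on `g ‖U‖` itself, so orders are gained alternately: first order for `g
  -- ‖U‖` and `g₁ ‖U‖`, then for the direction `ν`, hence for the radial speed `ρ'`, and finally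
  -- second order for `g ‖U‖`.
  have hg1 := hcomp 0 hd1 h0 h1 hr0
  have hg11 := hcomp 0 hd2 h1 h2 hr0
  have hν1 : UBdd l 1 1 ν := by
    refine of_hasDerivAt hν0 (f' := fun i t => κ i t • U' i t - (κ i t * ρ' i t) • ν i t) ?_
      ((hκ0.one_smul (hU' 0 h0)).sub ((hκ0.mul_one hr0).one_smul hν0))
    filter_upwards [hU, hρ, hpos] with i h1 h2 h3 t
    have hne : ‖U i t‖ ≠ 0 := by linarith [(h3 t).2]
    refine (((h2 t).inv hne).smul (h1 t)).congr_deriv ?_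
    simp only [hν, hκ, smul_smul, sub_eq_add_neg, ← neg_smul]
    congr 2
    field_simp
  exact hcomp 1 hd1 h0 hg11 (hρ'k 1 hν1 hg1)

namespace OrbitFamily

theorem velocity (hO : OrbitFamily l g γ R rate T b) (i : ι) (t : ℝ) :
    HasDerivAt (fun t => b i t + Complex.exp (Complex.I * (t : ℂ)))
      (Complex.I * Complex.exp (Complex.I * (t : ℂ)) *
        (1 + (g ‖b i t + Complex.exp (Complex.I * (t : ℂ))‖ : ℂ))) t := by
  have h1 : HasDerivAt (fun t : ℝ => Complex.exp (Complex.I * (t : ℂ)))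
      (Complex.exp (Complex.I * (t : ℂ)) * (Complex.I * 1)) t :=
    ((hasDerivAt_id t).ofReal_comp.const_mul Complex.I).cexp
  refine ((hO.solves i t).add h1).congr_deriv ?_
  rw [guidingField]
  ring

theorem exp_id_bdd (k : ℕ) :
    UBdd l k 1 (fun _ t => Complex.exp (Complex.I * (t : ℂ))) := by
  simpa using UBdd.exp_mul (l := l) (k := k) (a := fun _ => 1) (M := 1) (by simp)

theorem eps_le_one (hO : OrbitFamily l g γ R rate T b) (hγ : 0 < γ) :
    ∀ᶠ i in l, 0 ≤ R i ^ (-γ) ∧ R i ^ (-γ) ≤ 1 := by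
  filter_upwards [hO.tendsto.eventually_ge_atTop 1] with i hi
  exact ⟨rpow_nonneg (by linarith) _, rpow_le_one_of_one_le_of_nonpos hi (by linarith)⟩

theorem velocity_bdd {k : ℕ} {ε : ι → ℝ} (hε : ∀ᶠ i in l, 0 ≤ ε i ∧ ε i ≤ 1)
    {G : ι → ℝ → ℝ} (h : UBdd l k ε G) :
    UBdd l k 1 (fun i t => Complex.I * Complex.exp (Complex.I * (t : ℂ)) * (1 + (G i t : ℂ))) :=
  ((UBdd.const Complex.I).mul_one (exp_id_bdd k)).mul_one
    ((UBdd.const 1).add ((h.mono hε).clm Complex.ofRealCLM))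

theorem profile_bdd (hO : OrbitFamily l g γ R rate T b) (hg : DriftProfile g g₁ g₂ K M S γ a) :
    UBdd l 2 (fun i => R i ^ (-γ))
      (fun i t => g ‖b i t + Complex.exp (Complex.I * (t : ℂ))‖) := by
  have hpos : ∀ᶠ i in l, ∀ t, S < ‖b i t + Complex.exp (Complex.I * (t : ℂ))‖ ∧
      1 ≤ ‖b i t + Complex.exp (Complex.I * (t : ℂ))‖ := by
    filter_upwards [hO.norm_ge hg, hO.tendsto.eventually_ge_atTop (S + 3)] with i h1 h2 t
    have := hg.one_le
    constructor <;> linarith [h1 t]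
  have hbase : ∀ {u : ℝ → ℝ}, (∀ s, S < s → |u s| ≤ M * s ^ (-γ)) →
      UBdd l 0 (fun i => R i ^ (-γ))
        (fun i t => u ‖b i t + Complex.exp (Complex.I * (t : ℂ))‖) := by
    intro u hu
    refine ⟨M * 2 ^ γ, ?_⟩
    filter_upwards [hO.norm_ge hg, hO.tendsto.eventually_ge_atTop 4, hpos] with i h1 h2 h3 t
    refine (hu _ (h3 t).1).trans ?_
    rw [mul_assoc]
    exact mul_le_mul_of_nonneg_left (rpow_neg_sub_two_le hg.gamma_pos h2 (h1 t)) hg.bound_nonneg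
  have hε := hO.eps_le_one hg.gamma_pos
  exact UBdd.profile_comp_norm (.of_forall fun i t => hO.velocity i t) hpos (hbase hg.bound)
    (hbase hg.bound₁) (hbase hg.bound₂) hg.deriv₁ hg.deriv₂ fun k hk => velocity_bdd hε hk

end OrbitFamily

end Orbits

/-! ### Reparametrization as a normal graph -/

section FootPoint

/-- Strict differentiability of the function whose zeros are the foot points. -/
theorem hasStrictFDerivAt_foot {U V V₁ : ℝ → ℂ} {u v w : ℂ} {t y : ℝ}
    (hU : HasStrictDerivAt U u y) (hV : HasStrictDerivAt V v t) (hV₁ : HasStrictDerivAt V₁ w t) :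
    ∃ L : ℝ × ℝ →L[ℝ] ℝ, L (0, 1) = inner ℝ u (V₁ t) ∧
      HasStrictFDerivAt (fun p : ℝ × ℝ => inner ℝ (U p.2 - V p.1) (V₁ p.1)) L (t, y) := by
  have hU' := HasStrictFDerivAt.comp (t, y) hU.hasStrictFDerivAt
    (hasStrictFDerivAt_snd (𝕜 := ℝ) (E := ℝ) (F := ℝ))
  have hV' := HasStrictFDerivAt.comp (t, y) hV.hasStrictFDerivAt
    (hasStrictFDerivAt_fst (𝕜 := ℝ) (E := ℝ) (F := ℝ))
  have hV₁' := HasStrictFDerivAt.comp (t, y) hV₁.hasStrictFDerivAt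
    (hasStrictFDerivAt_fst (𝕜 := ℝ) (E := ℝ) (F := ℝ))
  exact ⟨_, by simp [fderivInnerCLM_apply], (hU'.sub hV').inner ℝ hV₁'⟩

/-- For fixed `t` the function `y ↦ ⟨U y - V t, V₁ t⟩` has slope at least `1/4` for `|y - t| ≤ 1`. A
value of size at most `δ/8` at `y = t` thus forces a zero within `δ`, unique in the unit window. The
implicit function theorem gives a differentiable branch, which uniqueness identifies with `s`. -/
theorem exists_footPoint {U V U' V₁ V₂ : ℝ → ℂ} {δ : ℝ} (hδ : 0 < δ) (hδ1 : δ ≤ 1 / 2)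
    (hU : ∀ t, HasDerivAt U (U' t) t) (hU' : Continuous U')
    (hV : ∀ t, HasDerivAt V (V₁ t) t) (hV₁ : ∀ t, HasDerivAt V₁ (V₂ t) t) (hV₂ : Continuous V₂)
    (hmono : ∀ t y, |y - t| ≤ 1 → 1 / 4 ≤ inner ℝ (U' y) (V₁ t))
    (hsmall : ∀ t, |inner ℝ (U t - V t) (V₁ t)| ≤ δ / 8) :
    ∃ s : ℝ → ℝ, (∀ t, |s t - t| ≤ δ) ∧ (∀ t, inner ℝ (U (s t) - V t) (V₁ t) = 0) ∧
      (∀ t y, |y - t| ≤ 1 → inner ℝ (U y - V t) (V₁ t) = 0 → y = s t) ∧ Differentiable ℝ s := by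
  have hd : ∀ t y, HasDerivAt (fun y => inner ℝ (U y - V t) (V₁ t)) (inner ℝ (U' y) (V₁ t)) y := by
    intro t y
    simpa using ((hU y).sub_const (V t)).inner ℝ (hasDerivAt_const y (V₁ t))
  have hinc : ∀ t y z, |y - t| ≤ 1 → |z - t| ≤ 1 → y ≤ z →
      1 / 4 * (z - y) ≤ inner ℝ (U z - V t) (V₁ t) - inner ℝ (U y - V t) (V₁ t) := by
    intro t y z hy hz hyz
    refine Convex.mul_sub_le_image_sub_of_le_deriv (convex_Icc y z)
      (fun x _ => (hd t x).continuousAt.continuousWithinAt)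
      (fun x _ => (hd t x).differentiableAt.differentiableWithinAt) (fun x hx => ?_)
      y (left_mem_Icc.2 hyz) z (right_mem_Icc.2 hyz) hyz
    rw [(hd t x).deriv]
    have hx' := interior_subset hx
    have hy' := abs_le.1 hy
    have hz' := abs_le.1 hz
    exact hmono t x (abs_le.2 ⟨by linarith [hx'.1], by linarith [hx'.2]⟩)
  have huniq : ∀ t y z, |y - t| ≤ 1 → |z - t| ≤ 1 → inner ℝ (U y - V t) (V₁ t) = 0 →
      inner ℝ (U z - V t) (V₁ t) = 0 → y = z := by
    intro t y z hy hz h1 h2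
    rcases le_total y z with h | h
    · have := hinc t y z hy hz h
      linarith
    · have := hinc t z y hz hy h
      linarith
  have hex : ∀ t, ∃ y, |y - t| ≤ δ ∧ inner ℝ (U y - V t) (V₁ t) = 0 := by
    intro t
    have h0 := abs_le.1 (hsmall t)
    have habs : |t + δ - t| ≤ 1 ∧ |t - δ - t| ≤ 1 ∧ |t - t| ≤ 1 := by
      rw [add_sub_cancel_left, sub_sub_cancel_left, abs_neg, abs_of_pos hδ, sub_self, abs_zero]
      exact ⟨by linarith, by linarith, by norm_num⟩
    have h1 := hinc t t (t + δ) habs.2.2 habs.1 (by linarith)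
    have h2 := hinc t (t - δ) t habs.2.1 habs.2.2 (by linarith)
    obtain ⟨y, hy, hy0⟩ := intermediate_value_Icc (show t - δ ≤ t + δ by linarith)
      (f := fun y => inner ℝ (U y - V t) (V₁ t))
      (fun x _ => (hd t x).continuousAt.continuousWithinAt)
      (show (0 : ℝ) ∈ Icc _ _ from ⟨by linarith, by linarith⟩)
    exact ⟨y, abs_le.2 ⟨by linarith [hy.1], by linarith [hy.2]⟩, hy0⟩
  choose s hs1 hs2 using hex
  have hs1' : ∀ t, |s t - t| ≤ 1 := fun t => (hs1 t).trans (by linarith)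
  refine ⟨s, hs1, hs2, fun t y hy h => huniq t y _ hy (hs1' t) h (hs2 t), fun t => ?_⟩
  have sV₁ : Continuous V₁ := continuous_iff_continuousAt.2 fun t => (hV₁ t).continuousAt
  obtain ⟨L, hL, hF⟩ := hasStrictFDerivAt_foot (y := s t)
    (hasStrictDerivAt_of_hasDerivAt_of_continuousAt (.of_forall hU) hU'.continuousAt)
    (hasStrictDerivAt_of_hasDerivAt_of_continuousAt (.of_forall hV) sV₁.continuousAt)
    (hasStrictDerivAt_of_hasDerivAt_of_continuousAt (x := t) (.of_forall hV₁) hV₂.continuousAt)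
  have hne : inner ℝ (U' (s t)) (V₁ t) ≠ 0 := by
    have := hmono t (s t) (hs1' t)
    linarith
  have hinv : (L ∘L .inr ℝ ℝ ℝ).IsInvertible := by
    refine ⟨ContinuousLinearEquiv.unitsEquivAut ℝ (Units.mk0 _ hne), ?_⟩
    ext
    simp [hL]
  set ψ := hF.implicitFunctionOfProdDomain hinv
  have hψd : DifferentiableAt ℝ ψ t :=
    (hF.hasStrictFDerivAt_implicitFunctionOfProdDomain hinv).hasFDerivAt.differentiableAt
  refine hψd.congr_of_eventuallyEq ?_
  have hψt : Tendsto ψ (𝓝 t) (𝓝 (s t)) := hF.tendsto_implicitFunctionOfProdDomain hinv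
  have hclose : ∀ᶠ x in 𝓝 t, |ψ x - x| < 1 := by
    have : Tendsto (fun x => |ψ x - x|) (𝓝 t) (𝓝 |s t - t|) := (hψt.sub tendsto_id).abs
    exact this.eventually_lt_const ((hs1 t).trans_lt (by linarith))
  have hzero : ∀ᶠ x in 𝓝 t, inner ℝ (U (ψ x) - V x) (V₁ x) = inner ℝ (U (s t) - V t) (V₁ t) :=
    hF.eventually_apply_implicitFunctionOfProdDomain hinv
  filter_upwards [hclose, hzero] with x h1 h2
  exact huniq x _ _ (hs1' x) h1.le (hs2 x) (h2.trans (hs2 t))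

/-- Derivative of the foot point. -/
theorem deriv_footPoint {U V U' V₁ V₂ : ℝ → ℂ} {s : ℝ → ℝ}
    (hU : ∀ t, HasDerivAt U (U' t) t) (hV : ∀ t, HasDerivAt V (V₁ t) t)
    (hV₁ : ∀ t, HasDerivAt V₁ (V₂ t) t) (hs : ∀ t, inner ℝ (U (s t) - V t) (V₁ t) = 0)
    (hsd : Differentiable ℝ s) (hD : ∀ t, inner ℝ (U' (s t)) (V₁ t) ≠ (0 : ℝ)) (t : ℝ) :
    HasDerivAt s (1 + (-(inner ℝ (U' (s t) - V₁ t) (V₁ t) + inner ℝ (U (s t) - V t) (V₂ t))) *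
      (inner ℝ (U' (s t)) (V₁ t))⁻¹) t := by
  have h1 : HasDerivAt (fun t => U (s t) - V t) (deriv s t • U' (s t) - V₁ t) t :=
    ((hU (s t)).scomp t (hsd t).hasDerivAt).sub (hV t)
  have h2 := h1.inner ℝ (hV₁ t)
  have h3 : HasDerivAt (fun t => inner ℝ (U (s t) - V t) (V₁ t)) 0 t := by
    simp only [hs]
    exact hasDerivAt_const _ _
  have h4 := h2.unique h3
  refine (hsd t).hasDerivAt.congr_deriv ?_
  have hDt := hD t
  rw [inner_sub_left (deriv s t • U' (s t)), real_inner_smul_left] at h4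
  rw [inner_sub_left (U' (s t))]
  field_simp
  linarith

end FootPoint

section NormalGraph

variable {ι : Type*} {l : Filter ι}

/-- If the distance to the base curves and the shift of the foot points are small, then they are
small together with as many derivatives as the velocities permit. -/
theorem UBdd.footPoint_bootstrap {ε : ι → ℝ} (hε : ∀ᶠ i in l, 0 ≤ ε i ∧ ε i ≤ 1)
    {u : ι → ℝ → ℝ} {G : ι → ℝ → ℝ} {q : ι → ℝ → ℂ} {V₁ V₂ W : ι → ℝ → ℂ} {k : ℕ}
    (hV₁ : UBdd l k 1 V₁) (hV₂ : UBdd l k 1 V₂)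
    (hV₁ε : UBdd l k ε (fun i t => V₁ i t - Complex.I * Complex.exp (Complex.I * (t : ℂ))))
    (hG : UBdd l k ε G)
    (hW : W = fun i t => Complex.I * Complex.exp (Complex.I * ((t + u i t : ℝ) : ℂ)) *
      (1 + (G i (t + u i t) : ℂ)))
    (hD : ∀ᶠ i in l, ∀ t, 1 / 4 ≤ (inner ℝ (W i t) (V₁ i t) : ℝ))
    (hu' : ∀ᶠ i in l, ∀ t, HasDerivAt (u i)
      ((-(inner ℝ (W i t - V₁ i t) (V₁ i t) + inner ℝ (q i t) (V₂ i t))) *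
      (inner ℝ (W i t) (V₁ i t))⁻¹) t)
    (hq' : ∀ᶠ i in l, ∀ t, HasDerivAt (q i) ((1 + deriv (u i) t) • W i t - V₁ i t) t)
    (hu : UBdd l k ε u) (hq : UBdd l k ε q) :
    UBdd l (k + 1) ε u ∧ UBdd l (k + 1) ε q := by
  have hder : ∀ᶠ i in l, ∀ t, HasDerivAt (fun t => t + u i t) (1 + deriv (u i) t) t := by
    filter_upwards [hu'] with i h1 t
    exact (hasDerivAt_id t).add ((h1 t).differentiableAt.hasDerivAt)
  have hGs : UBdd l k ε (fun i t => G i (t + u i t)) :=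
    hG.comp hder fun m hm => (UBdd.const 1).add (((hu.of_le hm).2.2).mono hε)
  have hE := OrbitFamily.exp_id_bdd (l := l) k
  have hIE : UBdd l k 1 (fun _ t => Complex.I * Complex.exp (Complex.I * (t : ℂ))) :=
    (UBdd.const Complex.I).mul_one hE
  have hexp := hu.exp_sub_one hε
  -- With `E = e^{it}`, the difference is `iE (e^{iu} - 1) + iE e^{iu} G(t + u) - (V₁ - iE)`, and
  -- each term carries a factor of order `ε`.
  have hWε : UBdd l k ε (fun i t => W i t - V₁ i t) := by
    have h1 := (hIE.one_mul hexp)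
    have h2 := (hIE.mul_one ((UBdd.const 1).add (hexp.mono hε))).one_mul
      (hGs.clm Complex.ofRealCLM)
    refine ((h1.add h2).sub hV₁ε).congr (.of_forall fun i t => ?_)
    have : Complex.exp (Complex.I * ((t + u i t : ℝ) : ℂ)) =
        Complex.exp (Complex.I * (t : ℂ)) * Complex.exp (Complex.I * (u i t : ℂ)) := by
      rw [← Complex.exp_add]; congr 1; push_cast; ring
    simp only [hW, this, Complex.ofRealCLM_apply]
    ring
  have hW1 : UBdd l k 1 W := ((hWε.mono hε).add hV₁).congr (.of_forall fun i t => by simp)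
  have hDi := UBdd.inv (by norm_num : (0 : ℝ) < 1 / 4) (hW1.inner_one hV₁) hD
  have hu1 := (((hWε.inner_one hV₁).add (hq.inner_one hV₂)).neg).mul_one hDi
  have hu2 : UBdd l (k + 1) ε u := UBdd.of_hasDerivAt hu.zero_level hu' hu1
  refine ⟨hu2, UBdd.of_hasDerivAt (f' := fun i t => (W i t - V₁ i t) + deriv (u i) t • W i t)
    hq.zero_level ?_ (hWε.add (by simpa using hu2.2.2.smul hW1))⟩
  filter_upwards [hq'] with i hi t
  refine (hi t).congr_deriv ?_
  rw [add_smul, _root_.one_smul]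
  ring

theorem UBdd.norm_inv {k : ℕ} {V V₁ : ι → ℝ → ℂ} {d : ℝ} (hd : 0 < d)
    (hV : UBdd l k 1 V) (hV₁ : UBdd l k 1 V₁)
    (hder : ∀ᶠ i in l, ∀ t, HasDerivAt (V i) (V₁ i t) t)
    (hlow : ∀ᶠ i in l, ∀ t, d ≤ ‖V i t‖) : UBdd l k 1 (fun i t => ‖V i t‖⁻¹) := by
  have base : UBdd l 0 1 (fun i t => ‖V i t‖⁻¹) := by
    refine ⟨d⁻¹, ?_⟩
    filter_upwards [hlow] with i hi t
    simpa using inv_anti₀ hd (hi t)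
  induction k with
  | zero => exact base
  | succ k ih =>
    have hk := ih hV.pred hV₁.pred
    refine of_hasDerivAt base ?_ (((hk.one_smul hV.pred).inner_one hV₁.pred).neg.mul_one
      (hk.mul_one hk))
    filter_upwards [hder, hlow] with i h1 h2 t
    have hne : ‖V i t‖ ≠ 0 := by linarith [h2 t]
    refine ((hasDerivAt_norm (h1 t) (norm_ne_zero_iff.1 hne)).inv hne).congr_deriv ?_
    field_simp

/-- Curvature of a curve with tangent angle `s + π / 2` and speed `A`. -/
theorem signedCurvature_of_angle {X : ℝ → ℂ} {A s : ℝ → ℝ} {A' s' : ℝ} {t : ℝ}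
    (hX : ∀ t, HasDerivAt X ((A t : ℂ) * (Complex.I * Complex.exp (Complex.I * (s t : ℂ)))) t)
    (hA : HasDerivAt A A' t) (hs : HasDerivAt s s' t) (hpos : 0 < A t) :
    signedCurvature X t = s' / A t := by
  have h1 : deriv X = fun t => (A t : ℂ) * (Complex.I * Complex.exp (Complex.I * (s t : ℂ))) :=
    funext fun t => (hX t).deriv
  have h2 : iteratedDeriv 2 X t = (A' : ℂ) * (Complex.I * Complex.exp (Complex.I * (s t : ℂ)))
      - ((A t * s' : ℝ) : ℂ) * Complex.exp (Complex.I * (s t : ℂ)) := by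
    rw [iteratedDeriv_succ, iteratedDeriv_one, h1]
    have h3 := hA.ofReal_comp.mul (((hs.ofReal_comp.const_mul Complex.I).cexp).const_mul Complex.I)
    rw [show deriv (fun t => (A t : ℂ) * (Complex.I * Complex.exp (Complex.I * (s t : ℂ)))) t = _
      from h3.deriv]
    push_cast
    linear_combination (A t : ℂ) * s' * Complex.exp (Complex.I * (s t : ℂ)) * Complex.I_mul_I
  rw [signedCurvature, h2, h1]
  have hn : ‖(A t : ℂ) * (Complex.I * Complex.exp (Complex.I * (s t : ℂ)))‖ = A t := by
    rw [norm_mul, norm_mul, norm_exp_I_mul, Complex.norm_I, Complex.norm_of_nonneg hpos.le]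
    ring
  have hi : (inner ℝ (Complex.I * ((A t : ℂ) * (Complex.I * Complex.exp (Complex.I * (s t : ℂ)))))
      ((A' : ℂ) * (Complex.I * Complex.exp (Complex.I * (s t : ℂ)))
      - ((A t * s' : ℝ) : ℂ) * Complex.exp (Complex.I * (s t : ℂ))) : ℝ) = A t * (A t * s') := by
    have e := Complex.exp_ofReal_mul_I_re (s t)
    have e' := Complex.exp_ofReal_mul_I_im (s t)
    rw [mul_comm] at e e'
    rw [Complex.inner]
    simp only [Complex.mul_re, Complex.mul_im, Complex.sub_re, Complex.sub_im, Complex.conj_re,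
      Complex.conj_im, Complex.I_re, Complex.I_im, Complex.ofReal_re, Complex.ofReal_im, e, e']
    linear_combination (A t * (A t * s')) * sin_sq_add_cos_sq (s t)
  rw [hi, hn]
  field_simp

/-- A vector orthogonal to the velocity is a multiple of the normal. -/
theorem eq_smul_normal {q v : ℂ} (hv : v ≠ 0) (h : inner ℝ q v = (0 : ℝ)) :
    q = ((inner ℝ q (Complex.I * v) * ‖v‖⁻¹ : ℝ) : ℂ) * (Complex.I * v / (‖v‖ : ℂ)) := by
  have hn : (‖v‖ : ℂ) ≠ 0 := by simpa using hv
  have hsq : (‖v‖ : ℂ) ^ 2 = v.re * v.re + v.im * v.im := by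
    rw [← Complex.ofReal_pow, ← Complex.normSq_eq_norm_sq, Complex.normSq_apply]
    push_cast
    ring
  rw [Complex.inner] at h ⊢
  simp at h
  push_cast
  field_simp
  rw [hsq]
  apply Complex.ext
  · simp
    linear_combination v.re * h
  · simp
    linear_combination v.im * h

end NormalGraph

/-! ### The unperturbed epicycle and its velocity -/

section Epicycle

/-- The curve `R e^{i rate t} + e^{it}`. -/
noncomputable def epicycle (R rate t : ℝ) : ℂ :=
  (R : ℂ) * Complex.exp (Complex.I * ((rate * t : ℝ) : ℂ)) + Complex.exp (Complex.I * (t : ℂ))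

/-- Velocity of `epicycle`. -/
noncomputable def epicycleVel (R rate t : ℝ) : ℂ :=
  Complex.I * Complex.exp (Complex.I * (t : ℂ)) +
    ((R * rate : ℝ) : ℂ) * (Complex.I * Complex.exp (Complex.I * ((rate * t : ℝ) : ℂ)))

/-- Acceleration of `epicycle`. -/
noncomputable def epicycleAcc (R rate t : ℝ) : ℂ :=
  -Complex.exp (Complex.I * (t : ℂ)) -
    ((R * rate * rate : ℝ) : ℂ) * Complex.exp (Complex.I * ((rate * t : ℝ) : ℂ))

theorem hasDerivAt_exp_I_mul (rate t : ℝ) :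
    HasDerivAt (fun t : ℝ => Complex.exp (Complex.I * ((rate * t : ℝ) : ℂ)))
      (Complex.exp (Complex.I * ((rate * t : ℝ) : ℂ)) * (Complex.I * (rate : ℂ))) t := by
  refine ((((hasDerivAt_id t).const_mul rate).ofReal_comp.const_mul Complex.I).cexp).congr_deriv ?_
  simp

theorem hasDerivAt_exp_I (t : ℝ) :
    HasDerivAt (fun t : ℝ => Complex.exp (Complex.I * (t : ℂ)))
      (Complex.exp (Complex.I * (t : ℂ)) * Complex.I) t := by
  refine (((hasDerivAt_id t).ofReal_comp.const_mul Complex.I).cexp).congr_deriv ?_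
  simp

theorem hasDerivAt_epicycle (R rate t : ℝ) :
    HasDerivAt (epicycle R rate) (epicycleVel R rate t) t := by
  refine (((hasDerivAt_exp_I_mul rate t).const_mul (R : ℂ)).add (hasDerivAt_exp_I t)).congr_deriv ?_
  rw [epicycleVel]
  push_cast
  ring

theorem hasDerivAt_epicycleVel (R rate t : ℝ) :
    HasDerivAt (epicycleVel R rate) (epicycleAcc R rate t) t := by
  refine (((hasDerivAt_exp_I t).const_mul Complex.I).add
    (((hasDerivAt_exp_I_mul rate t).const_mul Complex.I).const_mul
      ((R * rate : ℝ) : ℂ))).congr_deriv ?_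
  rw [epicycleAcc]
  push_cast
  linear_combination (Complex.exp (Complex.I * (t : ℂ)) +
    R * rate * rate * Complex.exp (Complex.I * (rate * t))) * Complex.I_mul_I

theorem continuous_epicycleAcc (R rate : ℝ) : Continuous (epicycleAcc R rate) := by
  unfold epicycleAcc
  fun_prop

theorem norm_epicycleVel_sub (R rate t : ℝ) :
    ‖epicycleVel R rate t - Complex.I * Complex.exp (Complex.I * (t : ℂ))‖ = |R * rate| := by
  rw [epicycleVel, add_sub_cancel_left, norm_mul, norm_mul, norm_exp_I_mul, Complex.norm_I,
    Complex.norm_real, Real.norm_eq_abs]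
  ring

theorem inner_exp_I (x y : ℝ) : (inner ℝ (Complex.I * Complex.exp (Complex.I * (x : ℂ)))
    (Complex.I * Complex.exp (Complex.I * (y : ℂ))) : ℝ) = cos (x - y) := by
  have e := Complex.exp_ofReal_mul_I_re x
  have e' := Complex.exp_ofReal_mul_I_im x
  have f := Complex.exp_ofReal_mul_I_re y
  have f' := Complex.exp_ofReal_mul_I_im y
  rw [mul_comm] at e e' f f'
  rw [Complex.inner, cos_sub]
  simp only [Complex.mul_re, Complex.mul_im, Complex.conj_re,
    Complex.conj_im, Complex.I_re, Complex.I_im, e, e', f, f']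
  ring

/-- Velocities at nearby times have a positive scalar product. -/
theorem inner_velocity_ge {R rate t y G : ℝ} (hG : |G| ≤ 1 / 16) (hR : |R * rate| ≤ 1 / 16)
    (hty : |y - t| ≤ 1) :
    1 / 4 ≤ (inner ℝ (Complex.I * Complex.exp (Complex.I * (y : ℂ)) * (1 + (G : ℂ)))
      (epicycleVel R rate t) : ℝ) := by
  have h1 : Complex.I * Complex.exp (Complex.I * (y : ℂ)) * (1 + (G : ℂ)) =
      (1 + G) • (Complex.I * Complex.exp (Complex.I * (y : ℂ))) := by
    rw [Complex.real_smul]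
    push_cast
    ring
  have h2 : epicycleVel R rate t = Complex.I * Complex.exp (Complex.I * (t : ℂ)) +
      (epicycleVel R rate t - Complex.I * Complex.exp (Complex.I * (t : ℂ))) := by ring
  rw [h1, real_inner_smul_left, h2, inner_add_right, inner_exp_I]
  have h3 := abs_real_inner_le_norm (Complex.I * Complex.exp (Complex.I * (y : ℂ)))
    (epicycleVel R rate t - Complex.I * Complex.exp (Complex.I * (t : ℂ)))
  rw [norm_epicycleVel_sub, norm_mul, norm_exp_I_mul, Complex.norm_I, one_mul, one_mul] at h3
  have h4 := (abs_le.1 (h3.trans hR)).1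
  have h5 := one_sub_sq_div_two_le_cos (x := y - t)
  have h6 : (y - t) ^ 2 ≤ 1 := by
    rw [← sq_abs]
    exact pow_le_one₀ (abs_nonneg _) hty
  have h7 := (abs_le.1 hG).1
  nlinarith

end Epicycle

section OrbitGraph

namespace OrbitFamily

variable {ι : Type*} {l : Filter ι} {g g₁ g₂ : ℝ → ℝ} {K : ℝ≥0} {M S γ a : ℝ}
  {R rate T : ι → ℝ} {b : ι → ℝ → ℂ}

theorem tendsto_eps (hO : OrbitFamily l g γ R rate T b) (hγ : 0 < γ) :
    Tendsto (fun i => R i ^ (-γ)) l (𝓝 0) :=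
  (tendsto_rpow_neg_atTop hγ).comp hO.tendsto

theorem speed_le (hO : OrbitFamily l g γ R rate T b) :
    ∃ C, ∀ᶠ i in l, |R i * rate i| ≤ C * R i ^ (-γ) := by
  obtain ⟨C, hC⟩ := hO.rate_le
  refine ⟨C, ?_⟩
  filter_upwards [hC, hO.tendsto.eventually_ge_atTop 0] with i hi hR
  rwa [abs_mul, abs_of_nonneg hR]

theorem speed_small (hO : OrbitFamily l g γ R rate T b) (hγ : 0 < γ) :
    ∀ᶠ i in l, |R i * rate i| ≤ 1 / 16 := by
  obtain ⟨C, hC⟩ := hO.speed_le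
  have h := (hO.tendsto_eps hγ).const_mul C
  rw [mul_zero] at h
  filter_upwards [hC, h.eventually_le_const (show (0 : ℝ) < 1 / 16 by norm_num)] with i h1 h2
  exact h1.trans h2

theorem rate_small (hO : OrbitFamily l g γ R rate T b) (hγ : 0 < γ) :
    ∀ᶠ i in l, |rate i| ≤ 1 := by
  filter_upwards [hO.speed_small hγ, hO.tendsto.eventually_ge_atTop 1] with i h1 h2
  rw [abs_mul, abs_of_nonneg (by linarith)] at h1
  nlinarith [abs_nonneg (rate i)]

theorem epicycleVel_sub_bdd (hO : OrbitFamily l g γ R rate T b) (hγ : 0 < γ) (k : ℕ) :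
    UBdd l k (fun i => R i ^ (-γ)) (fun i t => epicycleVel (R i) (rate i) t -
      Complex.I * Complex.exp (Complex.I * (t : ℂ))) := by
  obtain ⟨C, hC⟩ := hO.speed_le
  have h1 : UBdd l k (fun i => R i ^ (-γ)) (fun i _ => ((R i * rate i : ℝ) : ℂ)) :=
    UBdd.const_fun (M := C) (by simpa only [Complex.norm_real, Real.norm_eq_abs] using hC)
  refine (h1.mul_one ((UBdd.const Complex.I).one_mul (UBdd.exp_mul (hO.rate_small hγ)))).congr
    (.of_forall fun i t => ?_)
  rw [epicycleVel]
  ring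

theorem epicycleVel_bdd (hO : OrbitFamily l g γ R rate T b) (hγ : 0 < γ) (k : ℕ) :
    UBdd l k 1 (fun i => epicycleVel (R i) (rate i)) :=
  (((hO.epicycleVel_sub_bdd hγ k).mono (hO.eps_le_one hγ)).add
    ((UBdd.const Complex.I).mul_one (exp_id_bdd k))).congr (.of_forall fun i t => by simp)

theorem epicycleAcc_bdd (hO : OrbitFamily l g γ R rate T b) (hγ : 0 < γ) (k : ℕ) :
    UBdd l k 1 (fun i => epicycleAcc (R i) (rate i)) :=
  (hO.epicycleVel_bdd hγ (k + 1)).2.2.congr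
    (.of_forall fun i t => (hasDerivAt_epicycleVel (R i) (rate i) t).deriv)

theorem norm_epicycleVel_bounds {R rate : ℝ} (h : |R * rate| ≤ 1 / 16) (t : ℝ) :
    1 / 2 ≤ ‖epicycleVel R rate t‖ ∧ ‖epicycleVel R rate t‖ ≤ 2 := by
  have h1 := norm_epicycleVel_sub R rate t
  have h2 := abs_norm_sub_norm_le (epicycleVel R rate t)
    (Complex.I * Complex.exp (Complex.I * (t : ℂ)))
  rw [h1, norm_mul, norm_exp_I_mul, Complex.norm_I] at h2
  have := abs_le.1 (h2.trans h)
  constructor <;> linarith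

/-- Equivariant orbits have foot points over the epicycle. -/
theorem exists_foot [l.NeBot] (hO : OrbitFamily l g γ R rate T b) (hg : DriftProfile g g₁ g₂ K M S γ a) :
    ∃ s : ι → ℝ → ℝ, UBdd l 0 (fun i => R i ^ (-γ)) (fun i t => s i t - t) ∧ ∀ᶠ i in l,
      (∀ t, |s i t - t| ≤ 1 / 2) ∧
      (∀ t, inner ℝ (b i (s i t) + Complex.exp (Complex.I * (s i t : ℂ))
        - epicycle (R i) (rate i) t) (epicycleVel (R i) (rate i) t) = (0 : ℝ)) ∧
      (∀ t y, |y - t| ≤ 1 → inner ℝ (b i y + Complex.exp (Complex.I * (y : ℂ))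
        - epicycle (R i) (rate i) t) (epicycleVel (R i) (rate i) t) = (0 : ℝ) → y = s i t) ∧
      Differentiable ℝ (s i) := by
  obtain ⟨M₀, hM₀⟩ := hO.centre_bound hg
  -- The initial defect is at most `2 |M₀| R^{-γ}`, the epicycle having speed at most `2`, and must
  -- not exceed `δ / 8`; the `+ 1` keeps `δ` positive.
  set δ : ι → ℝ := fun i => 16 * (|M₀| + 1) * R i ^ (-γ)
  have hδ : Tendsto δ l (𝓝 0) := by
    simpa using (hO.tendsto_eps hg.gamma_pos).const_mul (16 * (|M₀| + 1))
  have hex : ∀ᶠ i in l, ∃ s : ℝ → ℝ, (∀ t, |s t - t| ≤ δ i) ∧ δ i ≤ 1 / 2 ∧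
      (∀ t, inner ℝ (b i (s t) + Complex.exp (Complex.I * (s t : ℂ))
        - epicycle (R i) (rate i) t) (epicycleVel (R i) (rate i) t) = (0 : ℝ)) ∧
      (∀ t y, |y - t| ≤ 1 → inner ℝ (b i y + Complex.exp (Complex.I * (y : ℂ))
        - epicycle (R i) (rate i) t) (epicycleVel (R i) (rate i) t) = (0 : ℝ) → y = s t) ∧
      Differentiable ℝ s := by
    filter_upwards [hM₀, hO.speed_small hg.gamma_pos,
      hδ.eventually_le_const (show (0 : ℝ) < 1 / 2 by norm_num),
      hO.tendsto.eventually_gt_atTop 0] with i h1 h2 h3 h4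
    have hε : 0 < R i ^ (-γ) := rpow_pos_of_pos h4 _
    have hδi : 0 < δ i := by positivity
    have hbc : Continuous (b i) :=
      continuous_iff_continuousAt.2 fun t => (hO.solves i t).continuousAt
    have hgc := hg.lip.continuous
    obtain ⟨s, hs⟩ := exists_footPoint hδi h3 (hO.velocity i) (by fun_prop)
      (hasDerivAt_epicycle (R i) (rate i)) (hasDerivAt_epicycleVel (R i) (rate i))
      (continuous_epicycleAcc _ _)
      (fun t y hty => inner_velocity_ge (hg.small _) h2 hty)
      (fun t => by
        have h5 : ‖b i t + Complex.exp (Complex.I * (t : ℂ)) - epicycle (R i) (rate i) t‖ ≤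
            |M₀| * R i ^ (-γ) := by
          rw [epicycle, add_sub_add_right_eq_sub]
          exact (h1 t).trans (by gcongr; exact le_abs_self _)
        refine (abs_real_inner_le_norm _ _).trans ?_
        calc _ ≤ |M₀| * R i ^ (-γ) * 2 := by
              gcongr
              exact (norm_epicycleVel_bounds h2 t).2
          _ ≤ δ i / 8 := by
              simp only [δ]
              nlinarith)
    exact ⟨s, hs.1, h3, hs.2⟩
  obtain ⟨s, hs⟩ := hex.choice
  refine ⟨s, ⟨16 * (|M₀| + 1), by filter_upwards [hs] with i hi t using hi.1 t⟩, ?_⟩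
  filter_upwards [hs] with i hi
  exact ⟨fun t => (hi.1 t).trans hi.2.1, hi.2.2⟩

end OrbitFamily

end OrbitGraph

/-! ### Equivariant orbits as smooth normal graphs -/

section PerturbedLoops

namespace OrbitFamily

variable {ι : Type*} {l : Filter ι} {g g₁ g₂ : ℝ → ℝ} {K : ℝ≥0} {M S γ a : ℝ}
  {R rate T : ι → ℝ} {b : ι → ℝ → ℂ}

theorem epicycle_period (hO : OrbitFamily l g γ R rate T b) : ∀ᶠ i in l, ∀ t,
    epicycle (R i) (rate i) (t + T i) =
      Complex.exp (Complex.I * ((rate i * T i : ℝ) : ℂ)) * epicycle (R i) (rate i) t ∧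
    epicycleVel (R i) (rate i) (t + T i) =
      Complex.exp (Complex.I * ((rate i * T i : ℝ) : ℂ)) * epicycleVel (R i) (rate i) t := by
  filter_upwards [hO.exp_period] with i hi t
  simp only [epicycle, epicycleVel, hi, exp_rate_period]
  constructor <;> ring

theorem inner_rotate (w : ℝ) (x y : ℂ) :
    (inner ℝ (Complex.exp (Complex.I * (w : ℂ)) * x) (Complex.exp (Complex.I * (w : ℂ)) * y) : ℝ) =
      inner ℝ x y := by
  have h : (starRingEnd ℂ) (Complex.exp (Complex.I * (w : ℂ))) * Complex.exp (Complex.I * (w : ℂ))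
      = 1 := by
    rw [← Complex.normSq_eq_conj_mul_self, Complex.normSq_eq_norm_sq, norm_exp_I_mul]
    simp
  rw [Complex.inner, Complex.inner, map_mul]
  congr 1
  linear_combination ((starRingEnd ℂ) x * y) * h

theorem orbit_period (hO : OrbitFamily l g γ R rate T b) : ∀ᶠ i in l, ∀ t,
    b i (t + T i) + Complex.exp (Complex.I * ((t + T i : ℝ) : ℂ)) =
      Complex.exp (Complex.I * ((rate i * T i : ℝ) : ℂ)) *
        (b i t + Complex.exp (Complex.I * (t : ℂ))) := by
  filter_upwards [hO.exp_period, hO.equivariant] with i h1 h2 t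
  rw [h1, h2, mul_add]

/-- Foot points and distances to the epicycle are uniformly small up to third order. -/
theorem exists_foot_smooth [l.NeBot] (hO : OrbitFamily l g γ R rate T b)
    (hg : DriftProfile g g₁ g₂ K M S γ a) :
    ∃ s : ι → ℝ → ℝ, UBdd l 3 (fun i => R i ^ (-γ)) (fun i t => s i t - t) ∧
      UBdd l 3 (fun i => R i ^ (-γ)) (fun i t => b i (s i t) +
        Complex.exp (Complex.I * (s i t : ℂ)) - epicycle (R i) (rate i) t) ∧ ∀ᶠ i in l,
      (∀ t, inner ℝ (b i (s i t) + Complex.exp (Complex.I * (s i t : ℂ))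
        - epicycle (R i) (rate i) t) (epicycleVel (R i) (rate i) t) = (0 : ℝ)) ∧
      ∀ t, s i (t + T i) = s i t + T i := by
  have hγ := hg.gamma_pos
  obtain ⟨s, hu0, hs⟩ := hO.exists_foot hg
  have hε := hO.eps_le_one hγ
  set u : ι → ℝ → ℝ := fun i t => s i t - t with hu
  set q : ι → ℝ → ℂ := fun i t => b i (s i t) + Complex.exp (Complex.I * (s i t : ℂ))
    - epicycle (R i) (rate i) t with hq
  set G : ι → ℝ → ℝ := fun i t => g ‖b i t + Complex.exp (Complex.I * (t : ℂ))‖ with hGdef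
  set W : ι → ℝ → ℂ := fun i t => Complex.I * Complex.exp (Complex.I * ((t + u i t : ℝ) : ℂ)) *
      (1 + (G i (t + u i t) : ℂ)) with hW
  have hus : ∀ i t, t + u i t = s i t := fun i t => by simp [hu]
  have hG := hO.profile_bdd hg
  have hD : ∀ᶠ i in l, ∀ t, 1 / 4 ≤ (inner ℝ (W i t) (epicycleVel (R i) (rate i) t) : ℝ) := by
    filter_upwards [hs, hO.speed_small hγ] with i h1 h2 t
    simp only [hW, hus]
    exact inner_velocity_ge (hg.small _) h2 ((h1.1 t).trans (by norm_num))
  have hs' : ∀ᶠ i in l, ∀ t, HasDerivAt (s i)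
      (1 + (-(inner ℝ (W i t - epicycleVel (R i) (rate i) t) (epicycleVel (R i) (rate i) t)
        + inner ℝ (q i t) (epicycleAcc (R i) (rate i) t))) *
      (inner ℝ (W i t) (epicycleVel (R i) (rate i) t))⁻¹) t := by
    filter_upwards [hs, hD] with i h1 h2 t
    have h3 := deriv_footPoint (hO.velocity i)
      (hasDerivAt_epicycle (R i) (rate i)) (hasDerivAt_epicycleVel (R i) (rate i)) h1.2.1 h1.2.2.2
      (fun t => by
        have := h2 t
        simp only [hW, hus] at this
        exact (lt_of_lt_of_le (by norm_num) this).ne') t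
    simpa only [hW, hus] using h3
  have hu' : ∀ᶠ i in l, ∀ t, HasDerivAt (u i)
      ((-(inner ℝ (W i t - epicycleVel (R i) (rate i) t) (epicycleVel (R i) (rate i) t)
        + inner ℝ (q i t) (epicycleAcc (R i) (rate i) t))) *
      (inner ℝ (W i t) (epicycleVel (R i) (rate i) t))⁻¹) t := by
    filter_upwards [hs'] with i hi t
    exact ((hi t).sub (hasDerivAt_id t)).congr_deriv (by ring)
  have hq' : ∀ᶠ i in l, ∀ t, HasDerivAt (q i)
      ((1 + deriv (u i) t) • W i t - epicycleVel (R i) (rate i) t) t := by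
    filter_upwards [hs', hu'] with i h1 h2 t
    rw [(h2 t).deriv]
    have h3 := ((hO.velocity i (s i t)).scomp t (h1 t)).sub (hasDerivAt_epicycle (R i) (rate i) t)
    simpa only [hW, hus] using! h3
  have hq0 : UBdd l 0 (fun i => R i ^ (-γ)) q := by
    obtain ⟨M₁, h1⟩ := hu0
    obtain ⟨M₂, h2⟩ := hO.centre_bound hg
    refine ⟨2 * M₁ + M₂, ?_⟩
    filter_upwards [h1, h2] with i h1 h2 t
    -- The orbit has speed at most `1 + 1/16 ≤ 2`, so shifting time from `t` to the foot point moves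
    -- it by at most `2 |s t - t|`.
    have h3 := Convex.norm_image_sub_le_of_norm_hasDerivWithin_le (C := 2) (s := univ)
      (fun x _ => (hO.velocity i x).hasDerivWithinAt) (fun x _ => by
        rw [norm_mul, norm_mul, norm_exp_I_mul, Complex.norm_I, one_mul, one_mul]
        refine (norm_add_le _ _).trans ?_
        rw [Complex.norm_real, norm_one]
        linarith [hg.small ‖b i x + Complex.exp (Complex.I * (x : ℂ))‖, Real.norm_eq_abs
          (g ‖b i x + Complex.exp (Complex.I * (x : ℂ))‖)]) convex_univ (mem_univ t)
      (mem_univ (s i t))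
    have h4 := h2 t
    have h5 := h1 t
    have e : q i t = (b i (s i t) + Complex.exp (Complex.I * (s i t : ℂ)) -
        (b i t + Complex.exp (Complex.I * (t : ℂ)))) +
        (b i t - R i * Complex.exp (Complex.I * ((rate i * t : ℝ) : ℂ))) := by
      simp only [hq, epicycle]
      ring
    rw [e]
    refine (norm_add_le _ _).trans ?_
    linarith
  -- The profile along the orbit is controlled to order two, so the bootstrap runs for `k = 0, 1, 2`
  -- and ends at order three.
  have step : ∀ k ≤ 2, UBdd l k (fun i => R i ^ (-γ)) u → UBdd l k (fun i => R i ^ (-γ)) q →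
      UBdd l (k + 1) (fun i => R i ^ (-γ)) u ∧ UBdd l (k + 1) (fun i => R i ^ (-γ)) q :=
    fun k hk => UBdd.footPoint_bootstrap hε (hO.epicycleVel_bdd hγ k) (hO.epicycleAcc_bdd hγ k)
      (hO.epicycleVel_sub_bdd hγ k) (hG.of_le hk) hW hD hu' hq'
  have h1 := step 0 (by norm_num) hu0 hq0
  have h2 := step 1 (by norm_num) h1.1 h1.2
  have h3 := step 2 le_rfl h2.1 h2.2
  refine ⟨s, h3.1, h3.2, ?_⟩
  filter_upwards [hs, hO.epicycle_period, hO.orbit_period] with i h1 h2 h4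
  refine ⟨h1.2.1, fun t => ?_⟩
  -- Equivariance makes `s t + T` a foot point for `t + T`; uniqueness identifies it with `s (t +
  -- T)`.
  refine (h1.2.2.1 (t + T i) (s i t + T i) ?_ ?_).symm
  · rw [add_sub_add_right_eq_sub]
    exact (h1.1 t).trans (by norm_num)
  · rw [h4, (h2 t).1, (h2 t).2, ← mul_sub, inner_rotate, h1.2.1]

/-- Equivariant orbits are normal graphs over the epicycle. -/
theorem exists_normalGraph [l.NeBot] (hO : OrbitFamily l g γ R rate T b)
    (hg : DriftProfile g g₁ g₂ K M S γ a) {H : ℂ → ℝ}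
    (hH : ∀ p, S < ‖p‖ → H p * (1 + g ‖p‖) = 1) {α : ℝ≥0} (hα0 : 0 < α) (hα : α ≤ 1) :
    ∃ φ : ι → ℝ → ℝ, UBdd l 3 (fun i => R i ^ (-γ)) φ ∧ ∀ᶠ i in l,
      (∀ t, φ i (t + T i) = φ i t) ∧ (∀ t, deriv (epicycle (R i) (rate i)) t ≠ 0) ∧
      IsC2Holder α (normalGraph (epicycle (R i) (rate i)) (φ i)) ∧
      (∀ t, deriv (normalGraph (epicycle (R i) (rate i)) (φ i)) t ≠ 0) ∧
      (∀ t, signedCurvature (normalGraph (epicycle (R i) (rate i)) (φ i)) t =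
        H (normalGraph (epicycle (R i) (rate i)) (φ i) t)) ∧
      ∀ t, normalGraph (epicycle (R i) (rate i)) (φ i) (t + T i) =
        Complex.exp (Complex.I * ((rate i * T i : ℝ) : ℂ)) *
          normalGraph (epicycle (R i) (rate i)) (φ i) t := by
  have hγ := hg.gamma_pos
  obtain ⟨s, hu, hq, hs⟩ := hO.exists_foot_smooth hg
  set q : ι → ℝ → ℂ := fun i t => b i (s i t) + Complex.exp (Complex.I * (s i t : ℂ))
    - epicycle (R i) (rate i) t with hqdef
  have hε := hO.eps_le_one hγ
  have hspeed := hO.speed_small hγ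
  have hderiv : ∀ i, deriv (epicycle (R i) (rate i)) = epicycleVel (R i) (rate i) :=
    fun i => funext fun t => (hasDerivAt_epicycle (R i) (rate i) t).deriv
  have hv0 : ∀ᶠ i in l, ∀ t, epicycleVel (R i) (rate i) t ≠ 0 := by
    filter_upwards [hspeed] with i hi t h0
    have := (norm_epicycleVel_bounds hi t).1
    rw [h0, norm_zero] at this
    norm_num at this
  set φ : ι → ℝ → ℝ := fun i t => inner ℝ (q i t) (Complex.I * epicycleVel (R i) (rate i) t) *
    ‖epicycleVel (R i) (rate i) t‖⁻¹ with hφ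
  have hφ3 : UBdd l 3 (fun i => R i ^ (-γ)) φ := by
    refine (hq.inner_one ((UBdd.const Complex.I).mul_one (hO.epicycleVel_bdd hγ 3))).mul_one
      (UBdd.norm_inv (d := 1 / 2) (by norm_num) (hO.epicycleVel_bdd hγ 3)
        (hO.epicycleAcc_bdd hγ 3) (.of_forall fun i t => hasDerivAt_epicycleVel _ _ t) ?_)
    filter_upwards [hspeed] with i hi t using (norm_epicycleVel_bounds hi t).1
  -- The displacement `q` is orthogonal to the epicycle's velocity, hence equals `φ` times the unit
  -- normal: the graph is the orbit reparametrized by `s`.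
  have hX : ∀ᶠ i in l, ∀ t, normalGraph (epicycle (R i) (rate i)) (φ i) t =
      b i (s i t) + Complex.exp (Complex.I * (s i t : ℂ)) := by
    filter_upwards [hs, hv0] with i h1 h2 t
    have h3 := eq_smul_normal (h2 t) (h1.1 t)
    rw [normalGraph, unitNormal, hderiv]
    have h4 : ((φ i t : ℝ) : ℂ) * (Complex.I * epicycleVel (R i) (rate i) t /
      (‖epicycleVel (R i) (rate i) t‖ : ℂ)) = q i t := h3.symm
    rw [h4]
    simp [hqdef]
  have hX1 : UBdd l 2 1 (fun i t => epicycleVel (R i) (rate i) t + deriv (q i) t) :=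
    (hO.epicycleVel_bdd hγ 2).add (hq.2.2.mono hε)
  have hXd : ∀ᶠ i in l, ∀ t, HasDerivAt (normalGraph (epicycle (R i) (rate i)) (φ i))
      (epicycleVel (R i) (rate i) t + deriv (q i) t) t := by
    filter_upwards [hX, hq.hasDerivAt] with i h1 h2 t
    have e : normalGraph (epicycle (R i) (rate i)) (φ i) =
        fun t => epicycle (R i) (rate i) t + q i t := by
      funext t
      rw [h1 t]
      simp [hqdef]
    rw [e]
    exact (hasDerivAt_epicycle _ _ t).add (h2 t)
  have hXU : UBdd l 2 1 (fun i => deriv (normalGraph (epicycle (R i) (rate i)) (φ i))) :=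
    hX1.congr (by filter_upwards [hXd] with i hi t using (hi t).deriv.symm)
  have hXC : ∀ᶠ i in l, IsC2Holder α (normalGraph (epicycle (R i) (rate i)) (φ i)) := by
    obtain ⟨-, d1, ⟨M1, h1⟩, d2, M2, h2⟩ := hXU
    filter_upwards [hXd, d1, h1, d2, h2] with i hd d1 h1 d2 h2
    simp only [Pi.one_apply, _root_.mul_one] at h1 h2
    exact (isC2Holder_of_bdd (M := Real.toNNReal (max M1 M2)) hα0 hα
      (fun t => (hd t).differentiableAt) d1 d2
      (fun t => (h1 t).trans ((le_max_left _ _).trans (Real.le_coe_toNNReal _)))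
      (fun t => (h2 t).trans ((le_max_right _ _).trans (Real.le_coe_toNNReal _)))).1
  have hsd : ∀ᶠ i in l, ∀ t, HasDerivAt (s i) (1 + deriv (fun t => s i t - t) t) t := by
    filter_upwards [hu.hasDerivAt] with i hi t
    exact ((hasDerivAt_id t).add (hi t)).congr_of_eventuallyEq (.of_forall fun x => by simp)
  have hpos : ∀ᶠ i in l, ∀ t, 0 < 1 + deriv (fun t => s i t - t) t := by
    obtain ⟨M₁, h1⟩ := hu.2.2.1
    have h2 := (hO.tendsto_eps hγ).const_mul M₁
    rw [mul_zero] at h2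
    filter_upwards [h1, h2.eventually_lt_const one_pos] with i h1 h2 t
    have := (abs_lt.1 ((h1 t).trans_lt h2)).1
    linarith
  have hG := hO.profile_bdd hg
  -- The reparametrized orbit has tangent angle `s + π/2` and speed `s' (1 + g)`; the factor `s'`
  -- cancels in the curvature, leaving `1 / (1 + g) = H`.
  have hangle : ∀ᶠ i in l, ∀ t, HasDerivAt (normalGraph (epicycle (R i) (rate i)) (φ i))
      ((((1 + deriv (fun t => s i t - t) t) *
        (1 + g ‖b i (s i t) + Complex.exp (Complex.I * (s i t : ℂ))‖) : ℝ) : ℂ) *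
        (Complex.I * Complex.exp (Complex.I * (s i t : ℂ)))) t := by
    filter_upwards [hX, hsd] with i h1 h2 t
    rw [funext h1]
    refine ((hO.velocity i (s i t)).scomp t (h2 t)).congr_deriv ?_
    rw [Complex.real_smul]
    push_cast
    ring
  have hAd : ∀ᶠ i in l, ∀ t, DifferentiableAt ℝ (fun t => (1 + deriv (fun t => s i t - t) t) *
        (1 + g ‖b i (s i t) + Complex.exp (Complex.I * (s i t : ℂ))‖)) t := by
    filter_upwards [hu.2.2.2.1, hG.2.1, hsd] with i h1 h2 h3 t
    exact (((h1 t).const_add 1)).mul (((h2 (s i t)).comp t (h3 t).differentiableAt).const_add 1)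
  refine ⟨φ, hφ3, ?_⟩
  filter_upwards [hs, hv0, hX, hXC, hsd, hpos, hangle, hAd, hO.epicycle_period, hO.orbit_period,
    hO.norm_ge hg, hO.tendsto.eventually_ge_atTop (S + 3)]
    with i hsi hv0 hX hXC hsd hpos hangle hAd hper hper' hnorm hRS
  have hGpos : ∀ x, 0 < 1 + g x := fun x => by
    have := (abs_le.1 (hg.small x)).1
    linarith
  have hq' : ∀ t, q i (t + T i) = Complex.exp (Complex.I * ((rate i * T i : ℝ) : ℂ)) * q i t := by
    intro t
    simp only [hqdef]
    rw [hsi.2, hper', (hper t).1, mul_sub]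
  refine ⟨fun t => ?_, fun t => by rw [hderiv]; exact hv0 t, hXC, fun t => ?_, fun t => ?_,
    fun t => ?_⟩
  · simp only [hφ]
    rw [hq', (hper t).2, norm_mul, norm_exp_I_mul, one_mul, mul_left_comm Complex.I, inner_rotate]
  · rw [(hangle t).deriv]
    refine mul_ne_zero ?_ (mul_ne_zero Complex.I_ne_zero (Complex.exp_ne_zero _))
    exact_mod_cast (mul_pos (hpos t) (hGpos _)).ne'
  · rw [signedCurvature_of_angle hangle (hAd t).hasDerivAt (hsd t) (mul_pos (hpos t) (hGpos _)),
      hX t]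
    have h1 := hH (b i (s i t) + Complex.exp (Complex.I * (s i t : ℂ)))
      (by linarith [hnorm (s i t)])
    have h2 := (hpos t).ne'
    rw [← div_div, div_self h2, eq_comm, eq_div_iff (hGpos _).ne']
    exact h1
  · rw [hX, hX, hsi.2, hper']

end OrbitFamily

end PerturbedLoops

/-! ### Closing the orbits, and non-congruence -/

section Loops

variable {g g₁ g₂ : ℝ → ℝ} {K : ℝ≥0} {M S γ a σ : ℝ} {H : ℂ → ℝ} {α : ℝ≥0}

theorem baseCurve_eq_epicycle (σ : ℝ) (n : ℕ) (R : ℝ) :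
    baseCurve σ n R = epicycle R (σ / n) := by
  funext t
  rw [baseCurve, epicycle, div_mul_eq_mul_div]

theorem exists_natCast_eq_sub (hσ : σ = 1 ∨ σ = -1) {n : ℕ} (hn : 2 ≤ n) :
    ∃ m : ℕ, 0 < m ∧ (m : ℝ) = n - σ := by
  rcases hσ with rfl | rfl
  · exact ⟨n - 1, by omega, by push_cast [show 1 ≤ n by omega]; ring⟩
  · exact ⟨n + 1, by omega, by push_cast; ring⟩

theorem rate_mul_period (hσ : σ = 1 ∨ σ = -1) {n : ℕ} (hn : 2 ≤ n) :
    σ / n * (2 * π * (n / (n - σ))) = 2 * π * σ / (n - σ) := by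
  obtain ⟨m, hm, hmn⟩ := exists_natCast_eq_sub hσ hn
  have h1 : (n : ℝ) - σ ≠ 0 := by rw [← hmn]; positivity
  have h2 : (n : ℝ) ≠ 0 := by positivity
  field_simp

theorem period_eq (hσ : σ = 1 ∨ σ = -1) {n : ℕ} (hn : 2 ≤ n) :
    2 * π * (n / (n - σ)) = 2 * π + 2 * π * σ / (n - σ) := by
  obtain ⟨m, hm, hmn⟩ := exists_natCast_eq_sub hσ hn
  have h1 : (n : ℝ) - σ ≠ 0 := by rw [← hmn]; positivity
  field_simp
  ring

/-- The family of closing orbits supplied by the shooting argument. -/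
theorem exists_orbitFamily (hg : DriftProfile g g₁ g₂ K M S γ a) (hσ : σ = 1 ∨ σ = -1)
    (haσ : 0 < a * σ) :
    ∃ (r : ℕ → ℝ) (b : ℕ → ℝ → ℂ), (∀ᶠ n in atTop, r n ∈ Ioo (a * σ / 4) (a * σ)) ∧
      OrbitFamily atTop g γ (fun n => (r n * n) ^ (1 / (γ + 2))) (fun n => σ / n)
        (fun n => 2 * π * (n / (n - σ))) b := by
  have hγ := hg.gamma_pos
  obtain ⟨c, h0, hc⟩ := exists_guidingCentre hg.lip hg.small
  obtain ⟨r, hr⟩ := (hg.exists_closing hσ haσ h0 hc).choice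
  have hR : Tendsto (fun n : ℕ => (r n * n) ^ (1 / (γ + 2))) atTop atTop := by
    refine tendsto_atTop_mono' _ ?_
      (DriftProfile.tendsto_radius hγ (show 0 < a * σ / 4 by linarith))
    filter_upwards [hr] with n hn
    have := hn.1.1
    gcongr
  refine ⟨r, fun n => c ((r n * n) ^ (1 / (γ + 2))), hr.mono fun n hn => hn.1, hR,
    fun n => hc _, fun n => h0 _, ?_, ?_, ?_, a * σ, ?_⟩
  · filter_upwards [eventually_ge_atTop 2,
      (DriftProfile.tendsto_angle σ).abs.eventually_le_const (show |(0 : ℝ)| < 1 / 2 by simp)]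
      with n hn h1
    have h2 := abs_le.1 h1
    rw [period_eq hσ hn]
    constructor
    · linarith [pi_gt_three]
    · linarith [pi_lt_d2]
  · filter_upwards [eventually_ge_atTop 2] with n hn
    rw [rate_mul_period hσ hn, period_eq hσ hn]
  · filter_upwards [eventually_ge_atTop 2, hr] with n hn h1 t
    rw [rate_mul_period hσ hn, period_eq hσ hn]
    exact guidingCentre_equivariant hg.lip (hc _) (h0 _) h1.2 t
  · filter_upwards [eventually_gt_atTop 0, hr, hR.eventually_ge_atTop 1] with n hn h1 h2
    have hn' : (0 : ℝ) < n := by exact_mod_cast hn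
    have hr0 : 0 < r n := by linarith [h1.1.1]
    have e := DriftProfile.rpow_radius hγ (show 0 ≤ r n * n by positivity)
    set ρ := (r n * n) ^ (1 / (γ + 2))
    have hρ : 0 < ρ := by linarith
    have hσ1 : |σ| = 1 := by rcases hσ with rfl | rfl <;> simp
    rw [abs_div, hσ1, Nat.abs_cast]
    -- By `ρ^{γ+2} = r n`, the rotation speed `ρ / n` even decays like `ρ^{-(γ+1)}`.
    have h3 : ρ * (1 / n) = r n * ρ ^ (-(γ + 1)) := by
      have : ρ ^ (-(γ + 1)) * (r n * n) = ρ := by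
        rw [← e, ← rpow_add hρ, show -(γ + 1) + (γ + 2) = 1 by ring, rpow_one]
      field_simp
      linarith
    rw [h3]
    have h4 : ρ ^ (-(γ + 1)) ≤ ρ ^ (-γ) := rpow_le_rpow_of_exponent_le h2 (by linarith)
    exact mul_le_mul h1.1.2.le h4 (rpow_nonneg hρ.le _) haσ.le

theorem hasPerturbedLoops_of_profile (hg : DriftProfile g g₁ g₂ K M S γ a)
    (hH : ∀ p, S < ‖p‖ → H p * (1 + g ‖p‖) = 1) (hα0 : 0 < α) (hα : α ≤ 1)
    (hσ : σ = 1 ∨ σ = -1) (haσ : 0 < a * σ) : HasPerturbedLoops H γ α σ := by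
  have hγ := hg.gamma_pos
  obtain ⟨r, b, hr, hO⟩ := exists_orbitFamily hg hσ haσ
  obtain ⟨φ, hφ, hX⟩ := hO.exists_normalGraph hg hH hα0 hα
  obtain ⟨M', hM', hnorm⟩ := hφ.exists_c2HolderNorm_le hα0 hα (hO.radius_pos)
  -- Since `R^{-γ} = (r n)^{-γ/(γ+2)}` and the exponent is nonpositive, the lower bound `aσ/4` for
  -- `r` gives the constant.
  set κ := (a * σ / 4) ^ (-(γ / (γ + 2)))
  have hκ : 0 < κ := rpow_pos_of_pos (by linarith) _
  obtain ⟨N, hN⟩ := eventually_atTop.1 (hr.and (hX.and hnorm))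
  refine ⟨max N 2, M' * κ, a * σ / 4, a * σ, r, fun n => (r n * n) ^ (1 / (γ + 2)), φ,
    le_max_right _ _, by positivity, by linarith, by linarith, fun n hn => ?_⟩
  obtain ⟨hrn, ⟨hper, hv, hC, hX', hK, hrot⟩, hCφ, hφn⟩ := hN n ((le_max_left _ _).trans hn)
  have hn2 : 2 ≤ n := (le_max_right _ _).trans hn
  have hn0 : (0 : ℝ) < n := by positivity
  have hr0 : 0 < r n := by linarith [hrn.1]
  obtain ⟨m, hm, hmn⟩ := exists_natCast_eq_sub hσ hn2
  have hmn0 : (n : ℝ) - σ ≠ 0 := by rw [← hmn]; positivity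
  simp only [← baseCurve_eq_epicycle] at hv hC hX' hK hrot
  refine ⟨hrn, rfl, hCφ, hper, hφn.trans (ENNReal.ofReal_le_ofReal ?_), hv, hC, hX',
    ⟨m * (2 * π * (n / (n - σ))), ?_, ?_⟩, hK⟩
  · rw [mul_assoc]
    gcongr
    rw [← rpow_mul (by positivity), mul_rpow hr0.le hn0.le,
      show 1 / (γ + 2) * -γ = -(γ / (γ + 2)) by ring]
    gcongr
    exact rpow_le_rpow_of_nonpos (by linarith) hrn.1.le (by
      have : 0 ≤ γ / (γ + 2) := by positivity
      linarith)
  · rw [← hmn]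
    positivity
  · have hk : ∀ (k : ℕ) (t : ℝ), normalGraph (baseCurve σ n ((r n * n) ^ (1 / (γ + 2)))) (φ n)
        (t + k * (2 * π * (n / (n - σ)))) =
        Complex.exp (Complex.I * ((σ / n * (2 * π * (n / (n - σ))) : ℝ) : ℂ)) ^ k *
          normalGraph (baseCurve σ n ((r n * n) ^ (1 / (γ + 2)))) (φ n) t := by
      intro k
      induction k with
      | zero => simp
      | succ k ih =>
        intro t
        rw [show t + ((k + 1 : ℕ) : ℝ) * (2 * π * (n / (n - σ))) =
          t + k * (2 * π * (n / (n - σ))) + 2 * π * (n / (n - σ)) by push_cast; ring, hrot, ih,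
          pow_succ']
        ring
    intro t
    -- Each period turns the curve by `2πσ/m` with `m = n - σ`, so `m` periods make one full turn.
    have hone : Complex.exp (Complex.I * ((σ / n * (2 * π * (n / (n - σ))) : ℝ) : ℂ)) ^ m = 1 := by
      rw [← Complex.exp_nat_mul, rate_mul_period hσ hn2, ← hmn,
        show (m : ℂ) * (Complex.I * ((2 * π * σ / m : ℝ) : ℂ)) = ((2 * π * σ : ℝ) : ℂ) * Complex.I by
          have : (m : ℂ) ≠ 0 := by exact_mod_cast hm.ne'
          push_cast
          field_simp]
      rcases hσ with rfl | rfl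
      · simp
      · simp [Complex.exp_neg]
    rw [hk, hone, one_mul]

theorem norm_normalGraph_sub_le (U : ℝ → ℂ) (φ : ℝ → ℝ) (t : ℝ) :
    ‖normalGraph U φ t - U t‖ ≤ |φ t| := by
  rw [normalGraph, add_sub_cancel_left, norm_mul, Complex.norm_real, Real.norm_eq_abs]
  refine mul_le_of_le_one_right (abs_nonneg _) ?_
  rw [unitNormal, norm_div, norm_mul, Complex.norm_I, one_mul, Complex.norm_real, norm_norm]
  exact div_self_le_one _

theorem abs_le_of_c2HolderNorm_le {φ : ℝ → ℝ} {M : ℝ} (hM : 0 ≤ M)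
    (h : c2HolderNorm α φ ≤ ENNReal.ofReal M) (t : ℝ) : |φ t| ≤ M := by
  have h1 : ‖φ t‖ₑ ≤ ENNReal.ofReal M :=
    (le_iSup (fun t => ‖φ t‖ₑ) t).trans (le_trans (by
      unfold c2HolderNorm
      rw [add_assoc, add_assoc]
      exact le_self_add) h)
  rw [← ofReal_norm, ENNReal.ofReal_le_ofReal_iff hM] at h1
  exact h1

/-- At time `nπ` the slow factor has reached `-1`, so the two large circle points are antipodal; the
unit circles cost at most `2`. -/
theorem dist_baseCurve_ge (hσ : σ = 1 ∨ σ = -1) {n : ℕ} (hn : n ≠ 0) (R : ℝ) :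
    2 * R - 2 ≤ ‖baseCurve σ n R 0 - baseCurve σ n R (n * π)‖ := by
  have h1 : Complex.exp (Complex.I * ((σ * (n * π) / n : ℝ) : ℂ)) = -1 := by
    have : σ * (n * π) / n = σ * π := by field_simp
    rw [this, mul_comm]
    rcases hσ with rfl | rfl
    · simp
    · simp [Complex.exp_neg]
  have h2 := norm_exp_I_mul (n * π)
  simp only [baseCurve, h1]
  have e : (R : ℂ) * Complex.exp (Complex.I * ((σ * 0 / n : ℝ) : ℂ)) +
      Complex.exp (Complex.I * ((0 : ℝ) : ℂ)) -
      ((R : ℂ) * -1 + Complex.exp (Complex.I * ((n * π : ℝ) : ℂ))) =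
      ((2 * R : ℝ) : ℂ) - (Complex.exp (Complex.I * ((n * π : ℝ) : ℂ)) - 1) := by
    simp
    ring
  rw [e]
  have h3 := norm_sub_norm_le ((2 * R : ℝ) : ℂ) (Complex.exp (Complex.I * ((n * π : ℝ) : ℂ)) - 1)
  have h4 := norm_sub_le (Complex.exp (Complex.I * ((n * π : ℝ) : ℂ))) 1
  rw [h2, norm_one] at h4
  have h5 : 2 * R ≤ ‖((2 * R : ℝ) : ℂ)‖ := by
    rw [Complex.norm_real]
    exact le_abs_self _
  linarith

theorem IsCurvatureLoop.isBounded_range {U : ℝ → ℂ} (hU : IsCurvatureLoop H α U) :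
    Bornology.IsBounded (range U) := by
  obtain ⟨T, hT, hper⟩ := hU.closed
  rw [← hper.image_Icc hT 0]
  exact (isCompact_Icc.image hU.smooth.1.continuous).isBounded

/-- Perturbed loops have unbounded diameters; in particular infinitely many of them are pairwise
non-congruent. -/
theorem HasPerturbedLoops.exists_noncongruent (hγ : 0 < γ) (hσ : σ = 1 ∨ σ = -1)
    (h : HasPerturbedLoops H γ α σ) :
    ∃ U : ℕ → ℝ → ℂ, (∀ k, IsCurvatureLoop H α (U k)) ∧
      Pairwise (fun j k => ¬ ∃ e : ℂ ≃ᵢ ℂ, e '' range (U j) = range (U k)) := by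
  obtain ⟨N, M, r₀, r₁, r, R, φ, hN, hM, hr₀, hr, h⟩ := h
  set X : ℕ → ℝ → ℂ := fun k => normalGraph (baseCurve σ (N + k) (R (N + k))) (φ (N + k)) with hX
  have hloop : ∀ k, IsCurvatureLoop H α (X k) := fun k => (h (N + k) (by omega)).2.2.2.2.2.2
  have hdiam : ∀ k, 2 * R (N + k) - 2 - 2 * M ≤ Metric.diam (range (X k)) := by
    intro k
    obtain ⟨-, -, -, -, h1, -⟩ := h (N + k) (by omega)
    have hn1 : (1 : ℝ) ≤ ((N + k : ℕ) : ℝ) := by exact_mod_cast (by omega : 1 ≤ N + k)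
    have hle : M * ((N + k : ℕ) : ℝ) ^ (-(γ / (γ + 2))) ≤ M := by
      refine mul_le_of_le_one_right hM.le (rpow_le_one_of_one_le_of_nonpos hn1 ?_)
      have : 0 ≤ γ / (γ + 2) := by positivity
      linarith
    have h2 := fun t => (norm_normalGraph_sub_le (baseCurve σ (N + k) (R (N + k))) (φ (N + k)) t).trans
      (abs_le_of_c2HolderNorm_le hM.le (h1.trans (ENNReal.ofReal_le_ofReal hle)) t)
    have h3 := dist_baseCurve_ge hσ (show N + k ≠ 0 by omega) (R (N + k))
    have h4 := Metric.dist_le_diam_of_mem (hloop k).isBounded_range (mem_range_self 0)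
      (mem_range_self ((N + k : ℕ) * π))
    have h5 := h2 0
    have h6 := h2 ((N + k : ℕ) * π)
    rw [← dist_eq_norm] at h3 h5 h6
    rw [dist_comm] at h5
    have h7 := dist_triangle4 (baseCurve σ (N + k) (R (N + k)) 0) (X k 0)
      (X k ((N + k : ℕ) * π)) (baseCurve σ (N + k) (R (N + k)) ((N + k : ℕ) * π))
    simp only [hX] at h4 h7 ⊢
    linarith
  have hRlim : Tendsto (fun k => R (N + k)) atTop atTop := by
    have h1 : Tendsto (fun k : ℕ => (r₀ * ((N + k : ℕ) : ℝ)) ^ (1 / (γ + 2))) atTop atTop :=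
      (DriftProfile.tendsto_radius hγ hr₀).comp (tendsto_add_atTop_nat N |>.congr fun k => by omega)
    refine tendsto_atTop_mono (fun k => ?_) h1
    obtain ⟨hr', hR, -⟩ := h (N + k) (by omega)
    rw [hR]
    have := hr'.1
    gcongr
  have hdlim : Tendsto (fun k => Metric.diam (range (X k))) atTop atTop := by
    refine tendsto_atTop_mono hdiam ?_
    have := tendsto_atTop_add_const_right _ (-2 - 2 * M)
      (hRlim.const_mul_atTop (show (0 : ℝ) < 2 by norm_num))
    refine this.congr fun k => by ring
  -- Isometries preserve diameters, so strictly increasing diameters exclude congruence.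
  obtain ⟨ψ, -, hψ⟩ := strictMono_subseq_of_tendsto_atTop hdlim
  refine ⟨fun k => X (ψ k), fun k => hloop _, fun j k hjk => ?_⟩
  rintro ⟨e, he⟩
  have h1 := e.isometry.diam_image (range (X (ψ j)))
  rw [he] at h1
  exact hjk (hψ.injective h1.symm)

end Loops

/-! ### Asymptotics of the prescribed curvature -/

section Asymptotics

/-- The increments of `f` over bounded steps at large `s` are those of a function with derivative
`a * s ^ (-p)`, up to `o(s ^ (-p))`. -/
def DriftAsymp (f : ℝ → ℝ) (p a : ℝ) : Prop :=
  ∀ η > 0, ∀ᶠ s in atTop, ∀ x, |x| ≤ 2 → |f (s + x) - f s - a * x * s ^ (-p)| ≤ η * s ^ (-p)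

theorem eventually_shift {p : ℝ → Prop} (h : ∀ᶠ s in atTop, p s) :
    ∀ᶠ s in atTop, ∀ x, |x| ≤ 2 → p (s + x) := by
  obtain ⟨b, hb⟩ := eventually_atTop.1 h
  filter_upwards [eventually_ge_atTop (b + 2)] with s hs x hx
  exact hb _ (by linarith [(abs_le.1 hx).1])

namespace DriftAsymp

variable {f f' : ℝ → ℝ} {p q a a' : ℝ}

theorem congr (hf : DriftAsymp f p a) (h : ∀ᶠ s in atTop, f s = f' s) : DriftAsymp f' p a := by
  intro η hη
  filter_upwards [hf η hη, h, eventually_shift h] with s h1 h2 h3 x hx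
  rw [← h2, ← h3 x hx]
  exact h1 x hx

theorem add (hf : DriftAsymp f p a) (hf' : DriftAsymp f' p a') :
    DriftAsymp (fun s => f s + f' s) p (a + a') := by
  intro η hη
  filter_upwards [hf (η / 2) (by positivity), hf' (η / 2) (by positivity)] with s h1 h2 x hx
  rw [show f (s + x) + f' (s + x) - (f s + f' s) - (a + a') * x * s ^ (-p) =
    (f (s + x) - f s - a * x * s ^ (-p)) + (f' (s + x) - f' s - a' * x * s ^ (-p)) by ring]
  exact (abs_add_le _ _).trans (by linarith [h1 x hx, h2 x hx])

theorem const_mul (c : ℝ) (hf : DriftAsymp f p a) : DriftAsymp (fun s => c * f s) p (c * a) := by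
  intro η hη
  filter_upwards [hf (η / (|c| + 1)) (by positivity), eventually_ge_atTop 0] with s h1 h2 x hx
  rw [show c * f (s + x) - c * f s - c * a * x * s ^ (-p) =
    c * (f (s + x) - f s - a * x * s ^ (-p)) by ring, abs_mul]
  calc |c| * |f (s + x) - f s - a * x * s ^ (-p)| ≤ (|c| + 1) * (η / (|c| + 1) * s ^ (-p)) := by
        gcongr
        · linarith
        · exact h1 x hx
    _ = η * s ^ (-p) := by field_simp

theorem const (c p : ℝ) : DriftAsymp (fun _ => c) p 0 := by
  intro η hη
  filter_upwards [eventually_ge_atTop 0] with s hs x _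
  have := rpow_nonneg hs (-p)
  simp
  positivity

/-- Both values in an increment are already `o(s^{-p})`. This lets a remainder enter without any
information on its derivative. -/
theorem of_isLittleO (hp : 0 < p) (hf : f =o[atTop] fun s => s ^ (-p)) : DriftAsymp f p 0 := by
  intro η hη
  have hc : 0 < η / (1 + 2 ^ p) := by positivity
  have h1 := hf.def hc
  filter_upwards [h1, eventually_shift h1, eventually_ge_atTop 4] with s h1 h2 hs x hx
  have h3 := h2 x hx
  have hx' := abs_le.1 hx
  rw [norm_of_nonneg (rpow_nonneg (by linarith) _), Real.norm_eq_abs] at h1 h3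
  have h4 := rpow_neg_sub_two_le hp hs (show s - 2 ≤ s + x by linarith)
  have h5 : |f (s + x)| ≤ η / (1 + 2 ^ p) * (2 ^ p * s ^ (-p)) := h3.trans (by gcongr)
  calc |f (s + x) - f s - 0 * x * s ^ (-p)| = |f (s + x) - f s| := by ring_nf
    _ ≤ |f (s + x)| + |f s| := abs_sub _ _
    _ ≤ η / (1 + 2 ^ p) * (2 ^ p * s ^ (-p)) + η / (1 + 2 ^ p) * s ^ (-p) := add_le_add h5 h1
    _ = η * s ^ (-p) := by field_simp; ring

theorem weaken (hf : DriftAsymp f q a) (hpq : p < q) : DriftAsymp f p 0 := by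
  intro η hη
  have h1 : ∀ᶠ s : ℝ in atTop, (1 + 2 * |a|) * s ^ (-(q - p)) ≤ η := by
    have := (tendsto_rpow_neg_atTop (show 0 < q - p by linarith)).const_mul (1 + 2 * |a|)
    rw [mul_zero] at this
    exact this.eventually_le_const hη
  filter_upwards [hf 1 one_pos, h1, eventually_gt_atTop 0] with s h2 h3 hs x hx
  have hq : 0 < s ^ (-q) := rpow_pos_of_pos hs _
  have h4 := h2 x hx
  have h5 : |a * x * s ^ (-q)| ≤ |a| * 2 * s ^ (-q) := by
    rw [abs_mul, abs_mul, abs_of_pos hq]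
    gcongr
  calc |f (s + x) - f s - 0 * x * s ^ (-p)|
      = |(f (s + x) - f s - a * x * s ^ (-q)) + a * x * s ^ (-q)| := by congr 1; ring
    _ ≤ 1 * s ^ (-q) + |a| * 2 * s ^ (-q) := (abs_add_le _ _).trans (add_le_add h4 h5)
    _ = (1 + 2 * |a|) * s ^ (-(q - p)) * s ^ (-p) := by
        rw [mul_assoc (1 + 2 * |a|), ← rpow_add hs, show -(q - p) + -p = -q by ring]
        ring
    _ ≤ η * s ^ (-p) := by gcongr

/-- By homogeneity this is differentiability of `(1 + y)^{-q}` at `y = 0`, applied to `y = x / s`,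
which is uniformly small for `|x| ≤ 2`. -/
theorem rpow (q : ℝ) : DriftAsymp (fun s => s ^ (-q)) (q + 1) (-q) := by
  intro η hη
  have hd : HasDerivAt (fun y : ℝ => (1 + y) ^ (-q)) (-q) 0 := by
    have := ((hasDerivAt_id (0 : ℝ)).const_add 1).rpow_const (p := -q) (Or.inl (by simp))
    simpa using this
  have h1 := hd.isLittleO.def (show 0 < η / 2 by positivity)
  rw [Metric.eventually_nhds_iff] at h1
  obtain ⟨d, hd0, hd⟩ := h1
  filter_upwards [eventually_gt_atTop (2 / d), eventually_gt_atTop 4] with s hs hs4 x hx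
  have hs0 : 0 < s := by linarith
  have hx' := abs_le.1 hx
  have hxs : |x / s| ≤ 2 / s := by
    rw [abs_div, abs_of_pos hs0]
    gcongr
  have h2 : dist (x / s) 0 < d := by
    rw [dist_zero_right, Real.norm_eq_abs]
    refine hxs.trans_lt ?_
    rw [div_lt_iff₀ hs0]
    rw [div_lt_iff₀ hd0] at hs
    linarith
  have h3 := hd h2
  simp only [add_zero, one_rpow, sub_zero, smul_eq_mul, Real.norm_eq_abs] at h3
  have h4 : (s + x) ^ (-q) = s ^ (-q) * (1 + x / s) ^ (-q) := by
    rw [← mul_rpow hs0.le, mul_add, mul_one, mul_div_cancel₀ _ hs0.ne']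
    have : -(1 / 2) ≤ x / s := by
      rw [le_div_iff₀ hs0]
      linarith
    linarith
  have h5 : s ^ (-(q + 1)) = s ^ (-q) / s := by
    rw [neg_add, rpow_add hs0, rpow_neg_one, div_eq_mul_inv]
  have h6 : 0 < s ^ (-q) := rpow_pos_of_pos hs0 _
  have e : (s + x) ^ (-q) - s ^ (-q) - -q * x * s ^ (-(q + 1)) =
      s ^ (-q) * ((1 + x / s) ^ (-q) - 1 - x / s * -q) := by
    rw [h4, h5]
    field_simp
  rw [e, abs_mul, abs_of_pos h6, h5]
  calc s ^ (-q) * |(1 + x / s) ^ (-q) - 1 - x / s * -q| ≤ s ^ (-q) * (η / 2 * (2 / s)) := by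
        gcongr
        exact h3.trans (by gcongr)
    _ = η * (s ^ (-q) / s) := by ring

/-- With `u = f s` and `v = f (s + x)`, one has `v⁻¹ - u⁻¹ = -(v - u) / (u v)`, and `u v` tends to
`1`. -/
theorem inv_sub_one (hf : DriftAsymp f p a) (hlim : Tendsto f atTop (𝓝 1)) :
    DriftAsymp (fun s => (f s)⁻¹ - 1) p (-a) := by
  intro η hη
  have hev : ∀ ζ > 0, ∀ᶠ s in atTop, |f s - 1| ≤ ζ := fun ζ hζ => by
    filter_upwards [Metric.tendsto_nhds.1 hlim ζ hζ] with s hs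
    rw [Real.dist_eq] at hs
    exact hs.le
  -- The bound `1/2` gives `u v ≥ 1/4`; the factor `48` gives `6 |a| ζ ≤ η/8`, so the two errors of
  -- `η/8` add up to at most `η u v`.
  have hζ : 0 < min (1 / 2) (η / (48 * (|a| + 1))) := by positivity
  have h1 := hev _ hζ
  filter_upwards [hf (η / 8) (by positivity), h1, eventually_shift h1, eventually_gt_atTop 0]
    with s h2 h3 h4 hs x hx
  have h5 := h2 x hx
  have h6 := h4 x hx
  set u := f s
  set v := f (s + x)
  set ζ := min (1 / 2) (η / (48 * (|a| + 1)))
  have hζ1 : ζ ≤ 1 / 2 := min_le_left _ _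
  have hζ2 : ζ * (48 * (|a| + 1)) ≤ η := by
    rw [← le_div_iff₀ (by positivity)]
    exact min_le_right _ _
  have hP : 0 < s ^ (-p) := rpow_pos_of_pos hs _
  have hu := abs_le.1 h3
  have hv := abs_le.1 h6
  have hu2 : 1 / 2 ≤ u := by linarith
  have hv2 : 1 / 2 ≤ v := by linarith
  have huv : 1 / 4 ≤ u * v := by nlinarith
  have huv1 : |u * v - 1| ≤ 3 * ζ := by
    rw [show u * v - 1 = (u - 1) * v + (v - 1) by ring]
    have hva : |v| ≤ 2 := abs_le.2 ⟨by linarith, by linarith⟩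
    calc |(u - 1) * v + (v - 1)| ≤ |u - 1| * |v| + |v - 1| := by
          rw [← abs_mul]; exact abs_add_le _ _
      _ ≤ ζ * 2 + ζ := add_le_add (mul_le_mul h3 hva (abs_nonneg _) hζ.le) h6
      _ = 3 * ζ := by ring
  have e : (v⁻¹ - 1 - (u⁻¹ - 1) - -a * x * s ^ (-p)) =
      (-(v - u - a * x * s ^ (-p)) + a * x * s ^ (-p) * (u * v - 1)) / (u * v) := by
    have : u ≠ 0 := by linarith
    have : v ≠ 0 := by linarith
    field_simp
    ring
  rw [e, abs_div, abs_of_pos (show 0 < u * v by linarith), div_le_iff₀ (by linarith)]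
  have h7 : |a * x * s ^ (-p) * (u * v - 1)| ≤ |a| * 2 * s ^ (-p) * (3 * ζ) := by
    rw [abs_mul, abs_mul, abs_mul, abs_of_pos hP]
    gcongr
  have h8 : |a| * 2 * s ^ (-p) * (3 * ζ) ≤ η / 8 * s ^ (-p) := by
    have : |a| * 6 * ζ ≤ η / 8 := by nlinarith
    nlinarith
  calc |-(v - u - a * x * s ^ (-p)) + a * x * s ^ (-p) * (u * v - 1)|
      ≤ |v - u - a * x * s ^ (-p)| + |a * x * s ^ (-p) * (u * v - 1)| := by
        rw [← abs_neg (v - u - a * x * s ^ (-p))]; exact abs_add_le _ _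
    _ ≤ η / 8 * s ^ (-p) + η / 8 * s ^ (-p) := add_le_add h5 (h7.trans h8)
    _ = η * s ^ (-p) * (1 / 4) := by ring
    _ ≤ η * s ^ (-p) * (u * v) := by gcongr

end DriftAsymp

/-- Expansion of the prescribed curvature covering all ranges of `β`. -/
theorem exists_expansion {h ht : ℝ → ℝ} {A B γ β : ℝ} (hβ : 0 ≤ β)
    (hform : ∀ᶠ s : ℝ in atTop, h s = 1 + A / s ^ γ + ht s / s ^ (γ + β))
    (hβ_large : 1 < β → ∃ K : ℝ, ∀ s : ℝ, 0 < s → |ht s| ≤ K)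
    (hβ_mid : 0 < β → β ≤ 1 →
      (fun s : ℝ => ht s - B) =o[atTop] (fun s : ℝ => s ^ (β - 1)))
    (hβ_zero : β = 0 → (fun s : ℝ => ht s - B) =o[atTop] (fun s : ℝ => s ^ (-1 : ℝ))) :
    ∃ (B' δ : ℝ) (e : ℝ → ℝ), 0 < δ ∧ (e =o[atTop] fun s => s ^ (-(γ + 1))) ∧
      ∀ᶠ s : ℝ in atTop, h s = 1 + (if β = 0 then A + B else A) * s ^ (-γ) +
        B' * s ^ (-(γ + δ)) + e s := by
  have hmul : ∀ {u : ℝ → ℝ} {x y : ℝ}, (u =o[atTop] fun s : ℝ => s ^ x) → x - y = -(γ + 1) →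
      (fun s => u s * s ^ (-y)) =o[atTop] fun s : ℝ => s ^ (-(γ + 1)) := by
    intro u x y hu hxy
    refine (hu.mul_isBigO (isBigO_refl (fun s : ℝ => s ^ (-y)) atTop)).congr' EventuallyEq.rfl ?_
    filter_upwards [eventually_gt_atTop 0] with s hs
    rw [← rpow_add hs, ← hxy, sub_eq_add_neg]
  rcases hβ.eq_or_lt with h0 | h0
  · subst h0
    -- For `β = 0` the constant `B` merges into the leading coefficient; the intermediate power is
    -- absent.
    refine ⟨0, 1, _, one_pos, hmul (hβ_zero rfl) (by ring), ?_⟩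
    filter_upwards [hform, eventually_gt_atTop 0] with s hs hs0
    rw [hs, if_pos rfl, add_zero, div_eq_mul_inv, div_eq_mul_inv, ← rpow_neg hs0.le]
    ring
  · rw [if_neg h0.ne']
    rcases le_or_gt β 1 with h1 | h1
    · refine ⟨B, β, _, h0, hmul (y := γ + β) (hβ_mid h0 h1) (by ring), ?_⟩
      filter_upwards [hform, eventually_gt_atTop 0] with s hs hs0
      rw [hs, div_eq_mul_inv, div_eq_mul_inv, ← rpow_neg hs0.le, ← rpow_neg hs0.le]
      ring
    · obtain ⟨K, hK⟩ := hβ_large h1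
      -- For `β > 1` a bounded function is `o(s^{β-1})`, so the whole last term goes into the
      -- remainder.
      have hlo : ht =o[atTop] fun s : ℝ => s ^ (β - 1) := by
        have hO : ht =O[atTop] fun _ : ℝ => (1 : ℝ) := by
          refine IsBigO.of_bound K ?_
          filter_upwards [eventually_gt_atTop 0] with s hs
          simpa using hK s hs
        refine hO.trans_isLittleO ?_
        rw [isLittleO_const_left]
        right
        exact tendsto_norm_atTop_atTop.comp (tendsto_rpow_atTop (by linarith))
      refine ⟨0, 1, _, one_pos, hmul (y := γ + β) hlo (by ring), ?_⟩
      filter_upwards [hform, eventually_gt_atTop 0] with s hs hs0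
      rw [hs, div_eq_mul_inv, div_eq_mul_inv, ← rpow_neg hs0.le, ← rpow_neg hs0.le]
      ring

theorem drift_of_expansion {h e : ℝ → ℝ} {A B γ δ : ℝ} (hγ : 0 < γ) (hδ : 0 < δ)
    (he : e =o[atTop] fun s => s ^ (-(γ + 1)))
    (hh : ∀ᶠ s : ℝ in atTop, h s = 1 + A * s ^ (-γ) + B * s ^ (-(γ + δ)) + e s) :
    DriftAsymp h (γ + 1) (-(γ * A)) := by
  have h1 := (((DriftAsymp.const 1 (γ + 1)).add ((DriftAsymp.rpow γ).const_mul A)).add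
    (((DriftAsymp.rpow (γ + δ)).const_mul B).weaken
      (show γ + 1 < γ + δ + 1 by linarith))).add (DriftAsymp.of_isLittleO (by linarith) he)
  have h2 := h1.congr (hh.mono fun s hs => hs.symm)
  convert h2 using 1
  ring

theorem bound_of_expansion {h e : ℝ → ℝ} {A B γ δ : ℝ} (hδ : 0 < δ)
    (he : e =o[atTop] fun s => s ^ (-(γ + 1)))
    (hh : ∀ᶠ s : ℝ in atTop, h s = 1 + A * s ^ (-γ) + B * s ^ (-(γ + δ)) + e s) :
    ∃ C, 0 < C ∧ ∀ᶠ s : ℝ in atTop, |h s - 1| ≤ C * s ^ (-γ) := by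
  refine ⟨|A| + |B| + 1, by positivity, ?_⟩
  filter_upwards [hh, he.def one_pos, eventually_ge_atTop 1] with s h1 h2 hs
  have hs0 : 0 ≤ s := by linarith
  have hp : ∀ x : ℝ, 0 ≤ s ^ x := fun x => rpow_nonneg hs0 x
  have k1 : s ^ (-(γ + δ)) ≤ s ^ (-γ) := rpow_le_rpow_of_exponent_le hs (by linarith)
  have k2 : s ^ (-(γ + 1)) ≤ s ^ (-γ) := rpow_le_rpow_of_exponent_le hs (by linarith)
  rw [norm_of_nonneg (hp _), Real.norm_eq_abs, one_mul] at h2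
  rw [h1, show 1 + A * s ^ (-γ) + B * s ^ (-(γ + δ)) + e s - 1 =
    A * s ^ (-γ) + B * s ^ (-(γ + δ)) + e s by ring]
  refine (abs_add_three _ _ _).trans ?_
  rw [abs_mul, abs_mul, abs_of_nonneg (hp (-γ)), abs_of_nonneg (hp (-(γ + δ)))]
  have := mul_le_mul_of_nonneg_left k1 (abs_nonneg B)
  linarith

/-- Bounds for a function and its second derivative control the first derivative. -/
theorem bound_deriv_of_bound {h h₁ h₂ : ℝ → ℝ} {C γ : ℝ} (hγ : 0 < γ) (hC : 0 < C)
    (hd : ∀ s, 0 < s → HasDerivAt h (h₁ s) s) (hd' : ∀ s, 0 < s → HasDerivAt h₁ (h₂ s) s)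
    (h0 : ∀ᶠ s : ℝ in atTop, |h s - 1| ≤ C * s ^ (-γ))
    (h2 : ∀ᶠ s : ℝ in atTop, |h₂ s| ≤ C * s ^ (-γ)) :
    ∀ᶠ s : ℝ in atTop, |h₁ s| ≤ 3 * C * s ^ (-γ) := by
  filter_upwards [h0.and (eventually_shift h0), eventually_forall_ge_atTop.2 h2, eventually_gt_atTop 0]
    with s ⟨k0, k1⟩ k2 hs
  have hle : ∀ x, s ≤ x → C * x ^ (-γ) ≤ C * s ^ (-γ) := fun x hx => by
    exact mul_le_mul_of_nonneg_left (rpow_le_rpow_of_nonpos hs hx (by linarith)) hC.le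
  -- The mean slope over a unit step bounds `h₁ ξ` by `2 C s^{-γ}`; returning from `ξ` to `s` costs
  -- another `C s^{-γ}` through `h₂`.
  obtain ⟨ξ, hξ, hξe⟩ := exists_hasDerivAt_eq_slope h h₁ (show s < s + 1 by linarith)
    (fun x hx => (hd x (by linarith [hx.1])).continuousAt.continuousWithinAt)
    (fun x hx => hd x (by linarith [hx.1]))
  have e1 : h₁ ξ = (h (s + 1) - 1) - (h s - 1) := by
    rw [hξe]
    ring
  have e2 : |h₁ ξ| ≤ 2 * (C * s ^ (-γ)) := by
    rw [e1]
    refine (abs_sub _ _).trans ?_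
    have := (k1 1 (by norm_num)).trans (hle (s + 1) (by linarith))
    linarith
  have e3 := norm_image_sub_le_of_norm_deriv_le_segment' (f := h₁) (a := s) (b := ξ)
    (C := C * s ^ (-γ)) (fun x hx => (hd' x (by linarith [hx.1])).hasDerivWithinAt)
    (fun x hx => (k2 x hx.1).trans (hle x hx.1)) ξ ⟨hξ.1.le, le_rfl⟩
  rw [Real.norm_eq_abs] at e3
  have e4 : |h₁ s| ≤ |h₁ ξ| + |h₁ ξ - h₁ s| := by
    have := abs_sub (h₁ ξ) (h₁ ξ - h₁ s)
    rwa [sub_sub_cancel] at this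
  have e5 : C * s ^ (-γ) * (ξ - s) ≤ C * s ^ (-γ) := by
    refine mul_le_of_le_one_right ?_ (by linarith [hξ.2])
    have := rpow_nonneg hs.le (-γ)
    positivity
  linarith

end Asymptotics

/-! ### From the curvature function to the drift profile, and conclusion -/

section Main

/-- A curvature function with controlled derivatives yields a drift profile. -/
theorem exists_driftProfile {h h₁ h₂ : ℝ → ℝ} {C γ a : ℝ} (hγ : 0 < γ) (hC : 0 < C)
    (hd : ∀ s, 0 < s → HasDerivAt h (h₁ s) s) (hd' : ∀ s, 0 < s → HasDerivAt h₁ (h₂ s) s)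
    (h0 : ∀ᶠ s : ℝ in atTop, |h s - 1| ≤ C * s ^ (-γ))
    (h2 : ∀ᶠ s : ℝ in atTop, |h₂ s| ≤ C * s ^ (-γ))
    (hdrift : DriftAsymp h (γ + 1) (-a)) :
    ∃ (g g₁ g₂ : ℝ → ℝ) (K : ℝ≥0) (M S : ℝ), DriftProfile g g₁ g₂ K M S γ a ∧
      ∀ s, S < s → h s * (1 + g s) = 1 := by
  have hlim0 : Tendsto (fun s : ℝ => C * s ^ (-γ)) atTop (𝓝 0) := by
    simpa using (tendsto_rpow_neg_atTop hγ).const_mul C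
  have hlim : Tendsto h atTop (𝓝 1) := by
    rw [tendsto_iff_norm_sub_tendsto_zero]
    exact squeeze_zero' (.of_forall fun _ => norm_nonneg _) h0 hlim0
  -- The threshold `|h - 1| ≤ 1/17` is what yields `|1/h - 1| ≤ 1/16`.
  obtain ⟨S, hS⟩ := eventually_atTop.1 (((h0.and h2).and
    (bound_deriv_of_bound hγ hC hd hd' h0 h2)).and
    ((hlim0.eventually_le_const (show (0 : ℝ) < 1 / 17 by norm_num)).and (eventually_ge_atTop 1)))
  have hS1 : 1 ≤ S := (hS S le_rfl).2.2
  have hlow : ∀ s, S ≤ s → 16 / 17 ≤ h s := fun s hs => by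
    have := (abs_le.1 ((hS s hs).1.1.1.trans (hS s hs).2.1)).1
    linarith
  set M := 12 * C + 144 * C ^ 2
  have hM : 0 < M := by positivity
  have hginv : ∀ s, S ≤ s → (h s)⁻¹ ≤ 17 / 16 ∧ 0 < (h s)⁻¹ := fun s hs => by
    have := hlow s hs
    refine ⟨?_, inv_pos.2 (by linarith)⟩
    rw [inv_le_comm₀ (by linarith) (by norm_num)]
    norm_num
    linarith
  have hgsub : ∀ s, S ≤ s → |(h s)⁻¹ - 1| ≤ 17 / 16 * |h s - 1| := fun s hs => by
    have hne : h s ≠ 0 := by linarith [hlow s hs]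
    rw [show (h s)⁻¹ - 1 = -((h s)⁻¹ * (h s - 1)) by field_simp; ring, abs_neg, abs_mul,
      abs_of_pos (hginv s hs).2]
    gcongr
    exact (hginv s hs).1
  -- Freezing `g` below `S` makes it globally small and Lipschitz; the orbits used stay beyond `S`,
  -- so their curvature is unaffected.
  set g : ℝ → ℝ := fun s => (h (max s S))⁻¹ - 1 with hg
  set g₁ : ℝ → ℝ := fun s => -h₁ s / h s ^ 2 with hg₁
  set g₂ : ℝ → ℝ := fun s => (-h₂ s * h s ^ 2 - -h₁ s * (2 * h s * h₁ s)) / (h s ^ 2) ^ 2 with hg₂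
  have hgs : ∀ s, S ≤ s → g s = (h s)⁻¹ - 1 := fun s hs => by simp [hg, max_eq_left hs]
  have hε : ∀ s, S ≤ s → 0 ≤ s ^ (-γ) ∧ s ^ (-γ) ≤ 1 := fun s hs =>
    ⟨rpow_nonneg (by linarith) _, rpow_le_one_of_one_le_of_nonpos (by linarith) (by linarith)⟩
  have hb0 : ∀ s, S ≤ s → |(h s)⁻¹ - 1| ≤ M * s ^ (-γ) := fun s hs => by
    refine (hgsub s hs).trans ?_
    have h1 := (hS s hs).1.1.1
    have h2 : C * s ^ (-γ) * (17 / 16) ≤ M * s ^ (-γ) := by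
      rw [mul_right_comm]
      exact mul_le_mul_of_nonneg_right (by simp only [M]; nlinarith) (hε s hs).1
    linarith
  have hb1 : ∀ s, S ≤ s → |g₁ s| ≤ M * s ^ (-γ) := fun s hs => by
    have h1 := hlow s hs
    have h2 := (hS s hs).1.2
    have h3 : 1 / 2 ≤ h s ^ 2 := by nlinarith
    rw [hg₁, abs_div, abs_neg, abs_of_pos (show 0 < h s ^ 2 by linarith), div_le_iff₀ (by linarith)]
    have h4 : 3 * C * s ^ (-γ) ≤ M * s ^ (-γ) * (1 / 2) := by
      rw [mul_right_comm M]
      exact mul_le_mul_of_nonneg_right (by simp only [M]; nlinarith) (hε s hs).1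
    have h5 : M * s ^ (-γ) * (1 / 2) ≤ M * s ^ (-γ) * h s ^ 2 :=
      mul_le_mul_of_nonneg_left h3 (mul_nonneg hM.le (hε s hs).1)
    linarith
  have hb2 : ∀ s, S ≤ s → |g₂ s| ≤ M * s ^ (-γ) := fun s hs => by
    have h1 := hlow s hs
    have h2 := (hS s hs).1.2
    have h3 := (hS s hs).1.1.2
    have hpos : 0 < h s := by linarith
    obtain ⟨h4, h5⟩ := hε s hs
    have e : g₂ s = -(h₂ s / h s ^ 2) + 2 * (h₁ s * h₁ s) / h s ^ 3 := by
      simp only [hg₂]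
      field_simp
      ring
    have h6 : 1 / 2 ≤ h s ^ 2 := by nlinarith
    have h7 : 1 / 4 ≤ h s ^ 3 := by nlinarith
    rw [e]
    refine (abs_add_le _ _).trans ?_
    rw [abs_neg, abs_div, abs_div, abs_mul, abs_mul, abs_two,
      abs_of_pos (show 0 < h s ^ 2 by linarith), abs_of_pos (show 0 < h s ^ 3 by linarith)]
    have k1 : |h₂ s| / h s ^ 2 ≤ 2 * C * s ^ (-γ) := by
      rw [div_le_iff₀ (by linarith)]
      have : 0 ≤ 2 * C * s ^ (-γ) := by positivity
      nlinarith
    have k2 : |h₁ s| * |h₁ s| ≤ 9 * C ^ 2 * s ^ (-γ) := by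
      calc |h₁ s| * |h₁ s| ≤ (3 * C * s ^ (-γ)) * (3 * C * 1) := by
            gcongr
            exact h2.trans (by gcongr)
        _ = 9 * C ^ 2 * s ^ (-γ) := by ring
    have k3 : 2 * (|h₁ s| * |h₁ s|) / h s ^ 3 ≤ 72 * C ^ 2 * s ^ (-γ) := by
      rw [div_le_iff₀ (by linarith)]
      have : 0 ≤ C ^ 2 * s ^ (-γ) := by positivity
      nlinarith
    calc _ ≤ 2 * C * s ^ (-γ) + 72 * C ^ 2 * s ^ (-γ) := add_le_add k1 k3
      _ = (2 * C + 72 * C ^ 2) * s ^ (-γ) := by ring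
      _ ≤ M * s ^ (-γ) := mul_le_mul_of_nonneg_right (by simp only [M]; nlinarith) h4
  have hder : ∀ s, S ≤ s → HasDerivAt (fun s => (h s)⁻¹ - 1) (g₁ s) s := fun s hs =>
    ((hd s (by linarith)).inv (by linarith [hlow s hs])).sub_const 1
  have hLip : LipschitzOnWith (Real.toNNReal M) (fun s => (h s)⁻¹ - 1) (Ici S) := by
    refine Convex.lipschitzOnWith_of_nnnorm_hasDerivWithin_le (convex_Ici S)
      (fun s hs => (hder s hs).hasDerivWithinAt) fun s hs => ?_
    rw [← NNReal.coe_le_coe, coe_nnnorm, Real.coe_toNNReal _ hM.le]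
    exact (hb1 s hs).trans (mul_le_of_le_one_right hM.le (hε s hs).2)
  refine ⟨g, g₁, g₂, Real.toNNReal M, M, S, ⟨hγ, hS1, ?_, fun s => ?_, fun s hs => ?_,
    fun s hs => hb1 s hs.le, fun s hs => hb2 s hs.le, fun s hs => ?_, fun s hs => ?_, ?_⟩,
    fun s hs => ?_⟩
  · refine LipschitzWith.of_dist_le_mul fun x y => ?_
    refine (hLip.dist_le_mul _ (mem_Ici.2 (le_max_right x S)) _ (mem_Ici.2 (le_max_right y S))).trans ?_
    gcongr
    rw [Real.dist_eq, Real.dist_eq]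
    exact abs_max_sub_max_le_abs x y S
  · have h1 := hgsub (max s S) (le_max_right _ _)
    have h2 := hS (max s S) (le_max_right _ _)
    have h3 := h2.1.1.1.trans h2.2.1
    simp only [hg]
    linarith
  · rw [hgs s hs.le]
    exact hb0 s hs.le
  · refine (hder s hs.le).congr_of_eventuallyEq ?_
    filter_upwards [lt_mem_nhds hs] with x hx using hgs x hx.le
  · have hp : HasDerivAt (fun s => h s ^ 2) (2 * h s * h₁ s) s := by
      simpa using! (hd s (by linarith)).pow 2
    exact (hd' s (by linarith)).neg.div hp (by have := hlow s hs.le; positivity)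
  · have h3 := (hdrift.inv_sub_one hlim).congr (f' := g)
      ((eventually_ge_atTop S).mono fun s hs => (hgs s hs).symm)
    rw [neg_neg] at h3
    exact h3
  · rw [hgs s hs.le, add_sub_cancel, mul_inv_cancel₀ (by linarith [hlow s hs.le])]

/-- On the positive half-line `h` is the restriction of `H` to the real axis; values of `h` at
negative arguments are unconstrained. -/
theorem hasDerivAt_radial {H : ℂ → ℝ} {h : ℝ → ℝ} (hH : ContDiff ℝ 2 H)
    (hrad : ∀ p : ℂ, H p = h ‖p‖) :
    ∃ h₁ h₂ : ℝ → ℝ, (∀ s, 0 < s → HasDerivAt h (h₁ s) s) ∧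
      (∀ s, 0 < s → HasDerivAt h₁ (h₂ s) s) ∧ ∀ s, 0 < s → iteratedDeriv 2 h s = h₂ s := by
  set k : ℝ → ℝ := fun s => H (s : ℂ)
  have hk : ContDiff ℝ 2 k := hH.comp Complex.ofRealCLM.contDiff
  have hev : ∀ s, 0 < s → h =ᶠ[𝓝 s] k := fun s hs => by
    filter_upwards [lt_mem_nhds hs] with x hx
    simp only [k]
    rw [hrad, Complex.norm_of_nonneg hx.le]
  have hk1 : ContDiff ℝ 1 (deriv k) := by
    rw [show (2 : WithTop ℕ∞) = 1 + 1 by norm_num, contDiff_succ_iff_deriv] at hk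
    exact hk.2.2
  refine ⟨deriv k, deriv (deriv k), fun s hs => ?_, fun s _ => ?_, fun s hs => ?_⟩
  · exact (hk.differentiable (by norm_num) s).hasDerivAt.congr_of_eventuallyEq (hev s hs)
  · exact (hk1.differentiable (by norm_num) s).hasDerivAt
  · rw [(hev s hs).iteratedDeriv_eq 2, iteratedDeriv_succ, iteratedDeriv_one]

end Main

theorem mainTheorem7
    (H : ℂ → ℝ) (h ht : ℝ → ℝ) (A B C γ β : ℝ) (α : ℝ≥0)
    (hα0 : 0 < α) (hα1 : α < 1)
    (hA : A ≠ 0) (hγ : 1 < γ) (hβ : 0 ≤ β) (hC : 0 < C)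
    (hH : ContDiff ℝ 2 H)
    (hrad : ∀ p : ℂ, H p = h ‖p‖)
    (hform : ∀ᶠ s : ℝ in atTop, h s = 1 + A / s ^ γ + ht s / s ^ (γ + β))
    (hsmooth : ContDiffOn ℝ 2 ht (Ioi 0))
    (hβ_large : 1 < β → ∃ K : ℝ, ∀ s : ℝ, 0 < s → |ht s| ≤ K)
    (hβ_mid : 0 < β → β ≤ 1 →
      (fun s : ℝ => ht s - B) =o[atTop] (fun s : ℝ => s ^ (β - 1)))
    (hβ_zero : β = 0 →
      B ≠ -A ∧ (fun s : ℝ => ht s - B) =o[atTop] (fun s : ℝ => s ^ (-1 : ℝ)))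
    (hsecond : ∀ᶠ s : ℝ in atTop,
      |iteratedDeriv 2 h s| ≤ C / s ^ (γ + 1 + min 1 β)) :
    (∃ U : ℕ → ℝ → ℂ,
      (∀ k, IsCurvatureLoop H α (U k)) ∧
      Pairwise (fun j k => ¬ ∃ e : ℂ ≃ᵢ ℂ, e '' range (U j) = range (U k))) ∧
    (0 < A → (β = 0 → -A < B) → HasPerturbedLoops H γ α 1) ∧
    (A < 0 → (β = 0 → B < -A) → HasPerturbedLoops H γ α (-1)) := by
  have hγ0 : 0 < γ := by linarith
  obtain ⟨B', δ, e, hδ, he, hexp⟩ := exists_expansion hβ hform hβ_large hβ_mid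
    fun h0 => (hβ_zero h0).2
  set A' := if β = 0 then A + B else A with hA'
  obtain ⟨h₁, h₂, hd, hd', hit⟩ := hasDerivAt_radial hH hrad
  obtain ⟨C₀, hC₀, hb⟩ := bound_of_expansion hδ he hexp
  have hb0 : ∀ᶠ s : ℝ in atTop, |h s - 1| ≤ (C₀ + C) * s ^ (-γ) := by
    filter_upwards [hb, eventually_gt_atTop 0] with s hs hs0
    refine hs.trans ?_
    have := rpow_nonneg hs0.le (-γ)
    gcongr
    linarith
  have hb2 : ∀ᶠ s : ℝ in atTop, |h₂ s| ≤ (C₀ + C) * s ^ (-γ) := by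
    filter_upwards [hsecond, eventually_ge_atTop 1] with s hs hs1
    have hs0 : 0 < s := by linarith
    rw [← hit s hs0]
    refine hs.trans ?_
    rw [div_eq_mul_inv, ← rpow_neg hs0.le]
    have : 0 ≤ min 1 β := le_min zero_le_one hβ
    gcongr
    · linarith
    · linarith
  obtain ⟨g, g₁, g₂, K, M, S, hg, hgH⟩ := exists_driftProfile hγ0 (by positivity) hd hd' hb0 hb2
    (drift_of_expansion hγ0 hδ he hexp)
  have hHg : ∀ p, S < ‖p‖ → H p * (1 + g ‖p‖) = 1 := fun p hp => by rw [hrad]; exact hgH _ hp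
  have key : ∀ σ : ℝ, σ = 1 ∨ σ = -1 → 0 < A' * σ → HasPerturbedLoops H γ α σ :=
    fun σ hσ hpos => hasPerturbedLoops_of_profile hg hHg hα0 hα1.le hσ (by
      rw [mul_assoc]
      exact mul_pos hγ0 hpos)
  have hA'0 : A' ≠ 0 := by
    rw [hA']
    split_ifs with h0
    · intro h1
      exact (hβ_zero h0).1 (by linarith)
    · exact hA
  refine ⟨?_, fun hpos hB => key 1 (Or.inl rfl) ?_, fun hneg hB => key (-1) (Or.inr rfl) ?_⟩
  -- Whichever sign `A'` has, one of the two families exists.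
  · rcases hA'0.lt_or_gt with h1 | h1
    · exact (key (-1) (Or.inr rfl) (by linarith)).exists_noncongruent hγ0 (Or.inr rfl)
    · exact (key 1 (Or.inl rfl) (by linarith)).exists_noncongruent hγ0 (Or.inl rfl)
  · rw [hA']
    split_ifs with h0
    · linarith [hB h0]
    · linarith
  · rw [hA']
    split_ifs with h0
    · linarith [hB h0]
    · linarith
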